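/- Notation. For $u,v\in L^2(\mathbb R)$ (complex-valued), the joint Wigner distribution is $$\mathcal W(u,v)(x,\xi)=\int_{\mathbb R}e^{-2i\pi z\xi}\,u\bigl(x+\tfrac z2\bigr)\,\overline{v\bigl(x-\tfrac z2\bigr)}\,dz .$$ The Weyl quantization of a bounded measurable symbol $a$ on $\mathbb R^2$ is the operator $\mathrm{Op}_w(a)$ defined weakly by $\langle \mathrm{Op}_w(a)u,v\rangle=\iint a(x,\xi)\,\mathcal W(u,v)(x,\xi)\,dx\,d\xi$ for $u,v$ in the Schwartz space $\mathscr S(\mathbb R)$. The Fourier transform is $\hat u(\tau)=\int e^{-2i\pi x\tau}u(x)\,dx$. The Airy function $\mathrm{Ai}$ is the inverse Fourier transform of $t\mapsto e^{i(2\pi t)^3/3}$; it extends to the entire function $\mathrm{Ai}(z)=\frac1{2\pi}\int_{\mathbb R}e^{\frac i3(t+i)^3+iz(t+i)}\,dt$ and is real on $\mathbb R$. Theorem. Let $H(\xi-x^2)=\mathbf 1\{(x,\xi)\in\mathbb R^2:\ \xi\ge x^2\}$ be the indicator function of the epigraph of the parabola $\xi=x^2$. For $\eta\in\mathbb R$ put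 $$G(\eta)=\frac23+\int_0^\eta \mathrm{Ai}(\xi)\,d\xi .$$ Then: 1. $G(\eta)=\int_{-\infty}^\eta\mathrm{Ai}(\xi)\,d\xi$ (convergent improper integral) for all real $\eta$; $G$ is real-valued on $\mathbb R$ and is the restriction to $\mathbb R$ of an entire primitive of $\mathrm{Ai}$. 2. The Airy function has a largest real zero $\eta_0$, and $G(\mathbb R)=[G(\eta_0),1)$, where $\eta_0\approx-2.338107410$ and $G(\eta_0)\approx-0.2743520591$ (with errors less than $10^{-9}$ and $10^{-10}$, respectively). 3. The Weyl quantization of $H(\xi-x^2)$ extends (uniquely) to a bounded operator $A$ on $L^2(\mathbb R)$, which is unitarily equivalent to the Fourier multiplier $G(2^{4/3}\pi^{2/3}\tau)$, that is, to the operator $M$ with $\widehat{Mu}(\tau)=G(2^{4/3}\pi^{2/3}\tau)\,\hat u(\tau)$. 4. $A$ is self-adjoint, has norm $1$, and its spectrum is $[G(\eta_0),1]$. The spectrum is purely continuous: for every $\mu\in[G(\eta_0),1]$ the operator $A-\mu$ is injective with dense range, but not surjective. 5. For all $u\in L^2(\mathbb R)$, $$G(\eta_0)\|u\|_{L^2(\mathbb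 R)}^2\le\langle Au,u\rangle\le\|u\|_{L^2(\mathbb R)}^2 ,$$ and $\langle Au,u\rangle=\iint_{\xi\ge x^2}\mathcal W(u,u)(x,\xi)\,dx\,d\xi$ whenever $\mathcal W(u,u)$ is Lebesgue integrable on $\{\xi\ge x^2\}$ (in particular for every $u\in\mathscr S(\mathbb R)$), so that then $$G(\eta_0)\|u\|_{L^2(\mathbb R)}^2\le\iint_{\xi\ge x^2}\mathcal W(u,u)(x,\xi)\,dx\,d\xi\le\|u\|_{L^2(\mathbb R)}^2 .$$ -/

import Mathlib

open MeasureTheory Filter Topology FourierTransform SchwartzMap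

noncomputable section

/-- The Hilbert space `L²(ℝ)` of complex-valued functions, with Lebesgue measure. -/
abbrev L2R : Type := Lp (α := ℝ) ℂ 2 (volume : Measure ℝ)

/-- The joint Wigner distribution
`W(u,v)(x,ξ) = ∫ e^{-2iπzξ} u(x+z/2) conj(v(x-z/2)) dz`.
For `u, v` in `L²(ℝ)` the integrand is absolutely integrable for every `(x,ξ)`, and the value does
not depend on the representatives. -/
def wigner (u v : ℝ → ℂ) (p : ℝ × ℝ) : ℂ :=
  ∫ z : ℝ, Complex.exp (-2 * Complex.I * Real.pi * z * p.2) *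
    u (p.1 + z / 2) * (starRingEnd ℂ) (v (p.1 - z / 2))

/-- The closed epigraph `{(x,ξ) : ξ ≥ x²}` of the parabola. -/
def parabolaEpigraph : Set (ℝ × ℝ) := {p | p.1 ^ 2 ≤ p.2}

/-- The symbol `H(ξ - x²)`: the indicator function of the epigraph. -/
def parabolaSymbol : ℝ × ℝ → ℂ := parabolaEpigraph.indicator (fun _ => 1)

/-- The bounded operator `A` on `L²(ℝ)` is (the continuous extension of) the Weyl quantization of
the symbol `a`: for all Schwartz functions `u, v`, `⟨A u, v⟩ = ∬ a(x,ξ) W(u,v)(x,ξ) dx dξ`, with an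
absolutely convergent integral. (`inner ℂ` is conjugate-linear in its first argument.) -/
def IsWeylQuantization (a : ℝ × ℝ → ℂ) (A : L2R →L[ℂ] L2R) : Prop :=
  ∀ u v : 𝓢(ℝ, ℂ),
    Integrable (fun p : ℝ × ℝ => a p * wigner u v p) ∧
    inner ℂ (v.toLp 2 volume : L2R) (A (u.toLp 2 volume)) = ∫ p : ℝ × ℝ, a p * wigner u v p

/-- The bounded operator `M` on `L²(ℝ)` is the Fourier multiplier by the function `m`:
the Fourier transform (with kernel `e^{-2iπxτ}`) of `M u` is `m(τ)` times that of `u`. -/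
def IsFourierMultiplier (m : ℝ → ℂ) (M : L2R →L[ℂ] L2R) : Prop :=
  ∀ u : L2R, ((𝓕 (M u) : L2R) : ℝ → ℂ) =ᵐ[volume] fun τ => m τ * ((𝓕 u : L2R) : ℝ → ℂ) τ

/-- The Airy function on `ℂ`, as the absolutely convergent integral
`Ai(z) = (1/2π) ∫ e^{i(t+i)³/3 + iz(t+i)} dt`. -/
def airyAi (z : ℂ) : ℂ :=
  1 / (2 * Real.pi) * ∫ t : ℝ, Complex.exp
    (Complex.I * ((t : ℂ) + Complex.I) ^ 3 / 3 + Complex.I * z * ((t : ℂ) + Complex.I))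

/-- The function `f` is the inverse Fourier transform, in the sense of tempered distributions, of
the (bounded) function `g`. -/
def IsInverseFourierTransformOf (f g : ℝ → ℂ) : Prop :=
  ∀ φ : 𝓢(ℝ, ℂ),
    Integrable (fun x => f x * φ x) ∧ Integrable (fun t => g t * (𝓕⁻ φ : 𝓢(ℝ, ℂ)) t) ∧
    ∫ x : ℝ, f x * φ x = ∫ t : ℝ, g t * (𝓕⁻ φ : 𝓢(ℝ, ℂ)) t

/-- `G(η) = 2/3 + ∫₀^η Ai(ξ) dξ` for real `η` (the Airy function is real on the real line). -/
def airyG (η : ℝ) : ℝ := 2 / 3 + ∫ ξ in (0 : ℝ)..η, (airyAi ξ).re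

/-- The continuous spectrum of a bounded operator: the `μ` for which `A - μ` is injective, with
dense range, and not surjective. -/
def continuousSpectrum (A : L2R →L[ℂ] L2R) : Set ℂ :=
  {μ | Function.Injective (fun u => A u - μ • u) ∧ DenseRange (fun u => A u - μ • u) ∧
    ¬ Function.Surjective (fun u => A u - μ • u)}

end

noncomputable section

/-! ### Contour integrals for the Airy function -/

/-! A cubic chirp straightens the parabola. Since `(x+z/2)³ - (x-z/2)³ = 3x²z + z³/4`, writing `u =
e^{2πix³/3} g` and `v = e^{2πix³/3} h` makes `wigner u v (x, η + x²)` the Fourier transform in `z`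
of `e^{iπz³/6} g(x+z/2) conj(h(x-z/2))` (`wigner_shear`), and the epigraph becomes the half plane `η
≥ 0`. Integration over `x` turns the kernel into a correlation, which by Plancherel is `∫ e^{2πizτ}
ĝ(τ) conj(ĥ(τ)) dτ`. So the pairing is diagonal in `τ`, with multiplier formally the integral over
`η > 0` and `z` of `e^{2πiz(τ-η)} e^{iπz³/6}`. After `z = ct` with `c³ = 16π²` the phase is the one
defining `Ai`, and the multiplier is `∫_{-∞}^{cτ} Ai = G(cτ)`.

`setIntegral_wigner_parabolaEpigraph` makes this rigorous, assuming only that the Wigner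
distribution is integrable on the epigraph. The half line is cut off by `e^{-aη} - e^{-bη}`, whose
Fourier transform is integrable; the multiplier is then exactly a difference of two exponential
averages of `G`, and these tend to `G` as `b → ∞` and to `G(-∞) = 0` as `a → 0`. For Schwartz
functions the integrability is `integrable_wigner_schwartz`.

Thus `A` is multiplication by the real continuous function `G(cτ)`, up to a unitary map. Its values
fill `[G(η₀), 1)`, which gives the spectrum, the norm and the bounds of the quadratic form; its
level sets are null because `G` is real analytic and not constant, so there are no eigenvalues
(`spectrum_conj_mulL2`).

The facts about `Ai` come from the integrals of `(iw)ⁿ e^{iw³/3 + izw}` over a line `Im w = s > 0`.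
They do not depend on `s`, differentiation in `z` raises `n` by one, and `n = -1` is the primitive
vanishing at `+∞`. Its value `-1/3` at `0` is found by deforming the exponent `3` to `2`, where the
integral is Gaussian. At `-∞`, two integrations by parts and a monotone energy show that `G` has a
limit, and pairing `Ai` with wide Gaussians identifies it as `0`.

For the range of `G`: it increases on `[η₀, ∞)` towards `1`, it decreases on `[-3.5, η₀]`, and
further left `|G| ≤ 0.27 < |G(η₀)|`. The numerical values come from the Taylor series at `0`. The
values `Ai(0)` and `Ai'(0)` are themselves obtained by solving two linear equations, which state
that `Ai` and its primitive nearly vanish at `11`. -/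

lemma exp_neg_sq_add_abs_le {s : ℝ} (hs : 0 < s) (k t : ℝ) :
    Real.exp (-s * t ^ 2 + k * |t|) ≤ Real.exp (k ^ 2 / (2 * s)) * Real.exp (-(s / 2) * t ^ 2) := by
  rw [← Real.exp_add]
  apply Real.exp_le_exp.2
  have h : 0 ≤ (s * |t| - k) ^ 2 / (2 * s) := by positivity
  have h2 : (s * |t| - k) ^ 2 / (2 * s) = s / 2 * t ^ 2 - k * |t| + k ^ 2 / (2 * s) := by
    rw [← sq_abs t]; field_simp; ring
  nlinarith

lemma integrable_exp_neg_sq_add_abs {s : ℝ} (hs : 0 < s) (k : ℝ) :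
    Integrable (fun t : ℝ => Real.exp (-s * t ^ 2 + k * |t|)) := by
  refine Integrable.mono' ((integrable_exp_neg_mul_sq (half_pos hs)).const_mul
    (Real.exp (k ^ 2 / (2 * s)))) (by fun_prop) (ae_of_all _ fun t => ?_)
  rw [Real.norm_of_nonneg (Real.exp_pos _).le]
  exact exp_neg_sq_add_abs_le hs k t

/-- The exponential `e^{i w³/3 + i z w}` in the integral representation of the Airy function. -/
def airyExp (z w : ℂ) : ℂ := Complex.exp (Complex.I * w ^ 3 / 3 + Complex.I * z * w)

lemma norm_airyExp (z : ℂ) (t s : ℝ) :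
    ‖airyExp z (t + s * Complex.I)‖ =
      Real.exp (-s * t ^ 2 + s ^ 3 / 3 - s * z.re - t * z.im) := by
  rw [airyExp, Complex.norm_exp]
  congr 1
  have h3 : (Complex.I * ((t : ℂ) + s * Complex.I) ^ 3 / 3).re = -s * t ^ 2 + s ^ 3 / 3 := by
    have : Complex.I * ((t : ℂ) + s * Complex.I) ^ 3 / 3
      = ((-s * t ^ 2 + s ^ 3 / 3 : ℝ) : ℂ) + ((t ^ 3 / 3 - t * s ^ 2 : ℝ) : ℂ) * Complex.I := by
      push_cast
      ring_nf
      simp only [Complex.I_sq, Complex.I_pow_four]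
      ring_nf
      rw [show Complex.I ^ 3 = -Complex.I by rw [pow_succ, Complex.I_sq]; ring]
      ring
    rw [this, Complex.add_re, Complex.ofReal_re, Complex.re_ofReal_mul]; simp
  rw [Complex.add_re, h3]
  simp only [Complex.mul_re, Complex.I_re, Complex.I_im, Complex.mul_im, Complex.add_re,
    Complex.add_im, Complex.ofReal_re, Complex.ofReal_im]
  ring

lemma differentiable_airyExp (z : ℂ) : Differentiable ℂ (airyExp z) := by
  unfold airyExp; fun_prop

lemma hasDerivAt_airyExp_left (z w : ℂ) :
    HasDerivAt (fun z => airyExp z w) (Complex.I * w * airyExp z w) z := by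
  unfold airyExp
  have : HasDerivAt (fun z : ℂ => Complex.I * w ^ 3 / 3 + Complex.I * z * w) (Complex.I * w) z := by
    have := (((hasDerivAt_id z).const_mul Complex.I).mul_const w).const_add
      (Complex.I * w ^ 3 / 3)
    simpa using this
  exact this.cexp.congr_deriv (by ring)

lemma hasDerivAt_airyExp_right (z w : ℂ) :
    HasDerivAt (airyExp z) ((Complex.I * w ^ 2 + Complex.I * z) * airyExp z w) w := by
  unfold airyExp
  have h1 : HasDerivAt (fun w : ℂ => Complex.I * w ^ 3 / 3 + Complex.I * z * w)
      (Complex.I * w ^ 2 + Complex.I * z) w := by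
    have := ((((hasDerivAt_id w).pow 3).const_mul Complex.I).div_const 3).add
      ((hasDerivAt_id w).const_mul (Complex.I * z))
    exact this.congr_deriv (by simp; ring)
  exact h1.cexp.congr_deriv (by ring)

/-- Both signs of `n` are covered by adding two constants: for `n ≥ 0` the base is at most
`e^{s'+|t|}`, for `n < 0` it is bounded below by the height `s` of the line. The growth in `|t|` is
later absorbed by the Gaussian factor of `airyExp`. -/
lemma norm_zpow_le {s s' y : ℝ} (hs : 0 < s) (hy : s ≤ y) (hy' : y ≤ s') (n : ℤ) (t : ℝ) :
    ‖(Complex.I * (t + y * Complex.I)) ^ n‖ ≤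
      (Real.exp (n.natAbs * s') + (s ^ n.natAbs)⁻¹) * Real.exp (n.natAbs * |t|) := by
  have hlow : s ≤ ‖(t : ℂ) + y * Complex.I‖ := by
    have := Complex.abs_im_le_norm ((t : ℂ) + y * Complex.I)
    simp at this
    exact hy.trans ((le_abs_self y).trans this)
  have hup : ‖(t : ℂ) + y * Complex.I‖ ≤ Real.exp (s' + |t|) := by
    have h1 : ‖(t : ℂ) + y * Complex.I‖ ≤ |t| + |y| := by
      refine (norm_add_le _ _).trans ?_
      simp
    rw [abs_of_pos (hs.trans_le hy)] at h1
    linarith [Real.add_one_le_exp (s' + |t|)]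
  have h1 : (1 : ℝ) ≤ Real.exp (n.natAbs * |t|) := Real.one_le_exp (by positivity)
  rw [norm_zpow, norm_mul, Complex.norm_I, one_mul]
  rcases Int.natAbs_eq n with h | h
  · have : ‖(t : ℂ) + y * Complex.I‖ ^ n ≤ Real.exp (n.natAbs * s') * Real.exp (n.natAbs * |t|) := by
      rw [← Real.exp_add, ← mul_add, Real.exp_nat_mul]
      conv_lhs => rw [h, zpow_natCast]
      gcongr
    refine this.trans ?_
    rw [add_mul]
    have : 0 ≤ (s ^ n.natAbs)⁻¹ * Real.exp (n.natAbs * |t|) := by positivity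
    linarith
  · have : ‖(t : ℂ) + y * Complex.I‖ ^ n ≤ (s ^ n.natAbs)⁻¹ := by
      conv_lhs => rw [h, zpow_neg, zpow_natCast]
      gcongr
    refine this.trans ?_
    have h2 : 0 ≤ (s ^ n.natAbs)⁻¹ := by positivity
    have h3 : 0 ≤ Real.exp (n.natAbs * s') := by positivity
    nlinarith

/-- The integrand `(iw)ⁿ e^{iw³/3 + izw}`. -/
def airyKernel (n : ℤ) (z w : ℂ) : ℂ := (Complex.I * w) ^ n * airyExp z w

/-- Uniformity in `z` serves for differentiating under the integral, uniformity in the height `y`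
for moving the contour. -/
lemma norm_airyKernel_le {s s' : ℝ} (hs : 0 < s) (n : ℤ) (R : ℝ) :
    ∃ C k : ℝ, 0 ≤ C ∧ ∀ z : ℂ, ‖z‖ ≤ R → ∀ y : ℝ, s ≤ y → y ≤ s' → ∀ t : ℝ,
      ‖airyKernel n z (t + y * Complex.I)‖ ≤ C * Real.exp (-s * t ^ 2 + k * |t|) := by
  refine ⟨(Real.exp (n.natAbs * s') + (s ^ n.natAbs)⁻¹) * Real.exp (s' ^ 3 / 3 + s' * R),
    n.natAbs + R, by positivity, fun z hz y hy hy' t => ?_⟩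
  have hypos := hs.trans_le hy
  rw [airyKernel, norm_mul, norm_airyExp]
  have h2 : Real.exp (-y * t ^ 2 + y ^ 3 / 3 - y * z.re - t * z.im) ≤
      Real.exp (s' ^ 3 / 3 + s' * R) * Real.exp (-s * t ^ 2 + R * |t|) := by
    rw [← Real.exp_add]
    apply Real.exp_le_exp.2
    have hre := (Complex.abs_re_le_norm z).trans hz
    have him := (Complex.abs_im_le_norm z).trans hz
    have hR : 0 ≤ R := (norm_nonneg z).trans hz
    have e1 : -y * t ^ 2 ≤ -s * t ^ 2 := by nlinarith [sq_nonneg t]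
    have e2 : y ^ 3 ≤ s' ^ 3 := by gcongr
    have e3 : -(y * z.re) ≤ s' * R := by
      have : -(y * z.re) ≤ y * R := by nlinarith [neg_abs_le z.re]
      nlinarith
    have e4 : -(t * z.im) ≤ R * |t| := by
      have : |t * z.im| ≤ |t| * R := by rw [abs_mul]; gcongr
      linarith [neg_abs_le (t * z.im)]
    linarith
  refine (mul_le_mul (norm_zpow_le hs hy hy' n t) h2 (by positivity) (by positivity)).trans
    (le_of_eq ?_)
  rw [show -s * t ^ 2 + ((n.natAbs : ℝ) + R) * |t| = (n.natAbs : ℝ) * |t| + (-s * t ^ 2 + R * |t|)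
    by ring, Real.exp_add (_ * |t|)]
  ring

lemma differentiableAt_airyKernel (n : ℤ) (z : ℂ) {w : ℂ} (hw : w ≠ 0) :
    DifferentiableAt ℂ (airyKernel n z) w := by
  unfold airyKernel
  refine DifferentiableAt.mul (DifferentiableAt.zpow (by fun_prop) (Or.inl ?_))
    (differentiable_airyExp z w)
  simp [hw]

lemma line_ne_zero {s : ℝ} (hs : 0 < s) (t : ℝ) : (t : ℂ) + s * Complex.I ≠ 0 := by
  intro h
  have := congrArg Complex.im h
  simp at this
  exact hs.ne' this

lemma continuous_airyKernel_line {s : ℝ} (hs : 0 < s) (n : ℤ) (z : ℂ) :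
    Continuous fun t : ℝ => airyKernel n z (t + s * Complex.I) := by
  rw [continuous_iff_continuousAt]
  intro t
  exact ContinuousAt.comp (f := fun t : ℝ => (t : ℂ) + s * Complex.I)
    (differentiableAt_airyKernel n z (line_ne_zero hs t)).continuousAt (by fun_prop)

lemma integrable_airyKernel {s : ℝ} (hs : 0 < s) (n : ℤ) (z : ℂ) :
    Integrable fun t : ℝ => airyKernel n z (t + s * Complex.I) := by
  obtain ⟨C, k, -, h⟩ := norm_airyKernel_le (s' := s) hs n ‖z‖
  exact Integrable.mono' ((integrable_exp_neg_sq_add_abs hs k).const_mul C)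
    (continuous_airyKernel_line hs n z).aestronglyMeasurable
    (ae_of_all _ fun t => h z le_rfl s le_rfl le_rfl t)

/-- The integral of `(iw)ⁿ e^{iw³/3 + izw}` along the line `Im w = s`. -/
def airyInt (s : ℝ) (n : ℤ) (z : ℂ) : ℂ := ∫ t : ℝ, airyKernel n z (t + s * Complex.I)

/-- Differentiating `e^{izw}` in `z` brings down one factor `iw`. Negative `n` are allowed because
the contour avoids `w = 0`; this makes `n = -1` a primitive of `n = 0`. -/
lemma hasDerivAt_airyInt {s : ℝ} (hs : 0 < s) (n : ℤ) (z : ℂ) :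
    HasDerivAt (airyInt s n) (airyInt s (n + 1) z) z := by
  obtain ⟨C, k, -, h⟩ := norm_airyKernel_le (s' := s) hs (n + 1) (‖z‖ + 1)
  refine (hasDerivAt_integral_of_dominated_loc_of_deriv_le (Metric.ball_mem_nhds z one_pos)
    (bound := fun t => C * Real.exp (-s * t ^ 2 + k * |t|))
    (F' := fun z t => airyKernel (n + 1) z (t + s * Complex.I))
    (Eventually.of_forall fun x => (continuous_airyKernel_line hs n x).aestronglyMeasurable)
    (integrable_airyKernel hs n z)
    (continuous_airyKernel_line hs (n + 1) z).aestronglyMeasurable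
    (ae_of_all _ fun t x hx => h x ?_ s le_rfl le_rfl t)
    ((integrable_exp_neg_sq_add_abs hs k).const_mul C)
    (ae_of_all _ fun t x _ => ?_)).2
  · have : ‖x - z‖ < 1 := by simpa [dist_eq_norm] using hx
    linarith [norm_le_norm_add_norm_sub' x z]
  · unfold airyKernel
    have := (hasDerivAt_airyExp_left x (t + s * Complex.I)).const_mul
      ((Complex.I * (t + s * Complex.I)) ^ n)
    refine this.congr_deriv ?_
    rw [zpow_add_one₀ (mul_ne_zero Complex.I_ne_zero (line_ne_zero hs t))]
    ring

/-- The integrals of a holomorphic function with rapid decay along two parallel lines agree. -/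
lemma integral_line_eq_of_decay {Φ : ℂ → ℂ} {s s' C c : ℝ} (hss : s ≤ s') (hc : 0 < c)
    (hd : ∀ w : ℂ, s ≤ w.im → DifferentiableAt ℂ Φ w)
    (hb : ∀ y, s ≤ y → y ≤ s' → ∀ t : ℝ, ‖Φ (t + y * Complex.I)‖ ≤ C * Real.exp (-c * t ^ 2)) :
    ∫ t : ℝ, Φ (t + s * Complex.I) = ∫ t : ℝ, Φ (t + s' * Complex.I) := by
  have hline : ∀ y, s ≤ y → y ≤ s' → Integrable fun t : ℝ => Φ (t + y * Complex.I) := by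
    intro y hy hy'
    refine Integrable.mono' ((integrable_exp_neg_mul_sq hc).const_mul C)
      (Continuous.aestronglyMeasurable ?_) (ae_of_all _ fun t => hb y hy hy' t)
    rw [continuous_iff_continuousAt]
    intro t
    exact ContinuousAt.comp (f := fun t : ℝ => (t : ℂ) + y * Complex.I)
      (hd _ (by simpa using hy)).continuousAt (by fun_prop)
  have hT : Tendsto (fun T : ℝ => T) atTop atTop := tendsto_id
  have lim1 := intervalIntegral_tendsto_integral (hline s le_rfl hss) tendsto_neg_atTop_atBot hT
  have lim2 := intervalIntegral_tendsto_integral (hline s' hss le_rfl) tendsto_neg_atTop_atBot hT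
  -- The two vertical sides of the rectangle, at abscissae `±T`, are handled together by a sign `ε`.
  have hside : ∀ ε : ℝ, |ε| = 1 → Tendsto (fun T : ℝ => ∫ y in s..s', Φ ((ε * T : ℝ) + y * Complex.I))
      atTop (𝓝 0) := by
    intro ε hε
    have h0 : Tendsto (fun T : ℝ => C * Real.exp (-c * T ^ 2) * |s' - s|) atTop (𝓝 0) := by
      have : Tendsto (fun T : ℝ => Real.exp (-c * T ^ 2)) atTop (𝓝 0) := by
        apply Real.tendsto_exp_atBot.comp
        have := (tendsto_pow_atTop (two_ne_zero) (α := ℝ)).const_mul_atTop_of_neg (neg_lt_zero.2 hc)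
        exact this
      simpa using (this.const_mul C).mul_const |s' - s|
    refine squeeze_zero_norm (fun T => ?_) h0
    apply intervalIntegral.norm_integral_le_of_norm_le_const
    intro y hy
    rw [Set.uIoc_of_le hss] at hy
    have := hb y hy.1.le hy.2 (ε * T)
    rwa [mul_pow, ← sq_abs ε, hε, one_pow, one_mul] at this
  have hrect : ∀ T : ℝ, (∫ t in (-T)..T, Φ (t + s * Complex.I)) -
      (∫ t in (-T)..T, Φ (t + s' * Complex.I)) +
      Complex.I * (∫ y in s..s', Φ ((1 * T : ℝ) + y * Complex.I)) -
      Complex.I * (∫ y in s..s', Φ (((-1) * T : ℝ) + y * Complex.I)) = 0 := by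
    intro T
    have := Complex.integral_boundary_rect_eq_zero_of_differentiableOn Φ
      ((-T : ℝ) + s * Complex.I) ((T : ℝ) + s' * Complex.I) ?_
    · simpa using this
    · intro w hw
      refine (hd w ?_).differentiableWithinAt
      have := (Complex.mem_reProdIm.1 hw).2
      simp only [Complex.add_im, Complex.ofReal_im, Complex.mul_im, Complex.ofReal_re,
        Complex.I_im, mul_one, Complex.I_re, mul_zero, add_zero, zero_add] at this
      rw [Set.uIcc_of_le hss] at this
      exact this.1
  have hlim := ((lim1.sub lim2).add ((hside 1 (by simp)).const_mul Complex.I)).sub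
    ((hside (-1) (by simp)).const_mul Complex.I)
  have := tendsto_nhds_unique (hlim.congr hrect) tendsto_const_nhds
  simp only [mul_zero, add_zero, sub_zero] at this
  exact sub_eq_zero.1 this

lemma airyInt_eq_of_le {s s' : ℝ} (hs : 0 < s) (hss : s ≤ s') (n : ℤ) (z : ℂ) :
    airyInt s n z = airyInt s' n z := by
  obtain ⟨C, k, hC, h⟩ := norm_airyKernel_le (s' := s') hs n ‖z‖
  refine integral_line_eq_of_decay (c := s / 2) (C := C * Real.exp (k ^ 2 / (2 * s))) hss
    (half_pos hs) (fun w hw => differentiableAt_airyKernel n z ?_) fun y hy hy' t => ?_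
  · rintro rfl
    simp at hw; linarith
  · refine (h z le_rfl y hy hy' t).trans ?_
    rw [mul_assoc]
    exact mul_le_mul_of_nonneg_left (exp_neg_sq_add_abs_le hs k t) hC

/-- The free height is the tool behind all pointwise bounds: each of them moves the contour to a
height suited to the argument. -/
lemma airyInt_eq {s s' : ℝ} (hs : 0 < s) (hs' : 0 < s') (n : ℤ) (z : ℂ) :
    airyInt s n z = airyInt s' n z := by
  rcases le_total s s' with h | h
  · exact airyInt_eq_of_le hs h n z
  · exact (airyInt_eq_of_le hs' h n z).symm

lemma airyAi_eq_airyInt (z : ℂ) : airyAi z = 1 / (2 * Real.pi) * airyInt 1 0 z := by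
  simp [airyAi, airyInt, airyKernel, airyExp]

/-- This is the Airy equation: the derivative of `e^{iw³/3 + izw}` along the line is `(iw² + iz)`
times the exponential, and its integral vanishes. -/
lemma airyInt_two (z : ℂ) : airyInt 1 2 z = z * airyInt 1 0 z := by
  have hd : ∀ t : ℝ, HasDerivAt (fun t : ℝ => airyKernel 0 z (t + (1 : ℝ) * Complex.I))
      (-Complex.I * airyKernel 2 z (t + (1 : ℝ) * Complex.I) +
        Complex.I * z * airyKernel 0 z (t + (1 : ℝ) * Complex.I)) t := by
    intro t
    have h1 : HasDerivAt (fun t : ℝ => (t : ℂ) + (1 : ℝ) * Complex.I) 1 t :=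
      (Complex.ofRealCLM.hasDerivAt (x := t)).add_const _
    have h2 := (hasDerivAt_airyExp_right z (t + (1 : ℝ) * Complex.I)).comp_of_eq t h1 rfl
    simp only [airyKernel, zpow_zero, one_mul]
    refine h2.congr_deriv ?_
    rw [show (2 : ℤ) = ((2 : ℕ) : ℤ) by rfl, zpow_natCast, mul_pow, Complex.I_sq]
    ring
  have i2 := (integrable_airyKernel one_pos 2 z).const_mul (-Complex.I)
  have i0 := (integrable_airyKernel one_pos 0 z).const_mul (Complex.I * z)
  have := integral_eq_zero_of_hasDerivAt_of_integrable hd (i2.add i0)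
    (integrable_airyKernel one_pos 0 z)
  rw [integral_add i2 i0, integral_const_mul, integral_const_mul] at this
  have h3 : Complex.I * (-(airyInt 1 2 z) + z * airyInt 1 0 z) = 0 := by
    rw [← this]; simp only [airyInt]; ring
  have := (mul_eq_zero.1 h3).resolve_left Complex.I_ne_zero
  linear_combination -this

end

noncomputable section

/-! ### The integral of the Airy function over the half line -/

/-- On `[0, 2π]` the cosine decreases and then increases, so on a subinterval it is largest at an
endpoint. -/
lemma cos_le_max_of_mem {a b x : ℝ} (ha : 0 ≤ a) (hax : a ≤ x) (hxb : x ≤ b)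
    (hb : b ≤ 2 * Real.pi) : Real.cos x ≤ max (Real.cos a) (Real.cos b) := by
  rcases le_total x Real.pi with h | h
  · exact le_max_of_le_left (Real.cos_le_cos_of_nonneg_of_le_pi ha h hax)
  · refine le_max_of_le_right ?_
    rw [← Real.cos_two_pi_sub x, ← Real.cos_two_pi_sub b]
    exact Real.cos_le_cos_of_nonneg_of_le_pi (by linarith) (by linarith) (by linarith)

lemma one_add_mul_I_mem_slitPlane (τ : ℝ) : 1 + τ * Complex.I ∈ Complex.slitPlane :=
  Or.inl (by simp)

lemma one_add_mul_I_ne_zero (τ : ℝ) : 1 + τ * Complex.I ≠ 0 :=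
  Complex.slitPlane_ne_zero (one_add_mul_I_mem_slitPlane τ)

lemma norm_sq_one_add_mul_I (τ : ℝ) : ‖1 + τ * Complex.I‖ ^ 2 = 1 + τ ^ 2 := by
  rw [← Complex.normSq_eq_norm_sq]
  simp [Complex.normSq_apply]; ring

lemma one_le_norm_one_add_mul_I (τ : ℝ) : 1 ≤ ‖1 + τ * Complex.I‖ := by
  nlinarith [norm_sq_one_add_mul_I τ, norm_nonneg (1 + τ * Complex.I), sq_nonneg τ]

lemma norm_one_add_mul_I_le (τ : ℝ) : ‖1 + τ * Complex.I‖ ≤ 1 + |τ| := by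
  refine (norm_add_le _ _).trans ?_
  simp

/-- With `W = 1 + iτ` and `θ = |arg W|`, the real part is `|W|^α cos(αθ)` and `cos θ = 1/|W|`. For
`|τ| ≥ 2` both `cos 2θ` and `cos 3θ` are negative enough, hence so is `cos αθ` in between; for `|τ|
≤ 2` the bound `|W|³ ≤ 27` suffices. -/
lemma re_cpow_le {α : ℝ} (h2 : 2 ≤ α) (h3 : α ≤ 3) (τ : ℝ) :
    ((1 + τ * Complex.I) ^ (α : ℂ)).re ≤ 30 - |τ| := by
  set W : ℂ := 1 + τ * Complex.I with hW
  have hW0 : W ≠ 0 := one_add_mul_I_ne_zero τ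
  have hr2 : ‖W‖ ^ 2 = 1 + τ ^ 2 := norm_sq_one_add_mul_I τ
  have hr1 : 1 ≤ ‖W‖ := one_le_norm_one_add_mul_I τ
  have hr' : ‖W‖ ≤ 1 + |τ| := norm_one_add_mul_I_le τ
  have hre : W.re = 1 := by simp [hW]
  have hform : (W ^ (α : ℂ)).re = ‖W‖ ^ α * Real.cos (α * |W.arg|) := by
    have h1 : (Complex.log W * α).re = Real.log ‖W‖ * α := by
      rw [Complex.re_mul_ofReal, Complex.log_re]
    have h2 : (Complex.log W * α).im = α * W.arg := by
      rw [Complex.im_mul_ofReal, Complex.log_im, mul_comm]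
    rw [Complex.cpow_def_of_ne_zero hW0, Complex.exp_re, h1, h2,
      Real.rpow_def_of_pos (by linarith)]
    congr 1
    rw [← Real.cos_abs, abs_mul, abs_of_nonneg (by linarith : 0 ≤ α)]
  have hcos : Real.cos |W.arg| = 1 / ‖W‖ := by rw [Real.cos_abs, Complex.cos_arg hW0, hre]
  have harg : |W.arg| ≤ Real.pi / 2 := by
    rw [Complex.abs_arg_le_pi_div_two_iff, hre]; norm_num
  have hpow3 : ‖W‖ ^ α ≤ ‖W‖ ^ 3 := by
    rw [← Real.rpow_natCast]
    exact Real.rpow_le_rpow_of_exponent_le hr1 (by simpa using h3)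
  have hpow2 : ‖W‖ ^ 2 ≤ ‖W‖ ^ α := by
    rw [← Real.rpow_natCast]
    exact Real.rpow_le_rpow_of_exponent_le hr1 (by simpa using h2)
  have hpos : 0 ≤ ‖W‖ ^ α := by positivity
  rw [hform]
  rcases le_total |τ| 2 with hτ | hτ
  · have : ‖W‖ ^ 3 ≤ 27 := by
      calc ‖W‖ ^ 3 ≤ 3 ^ 3 := by gcongr; linarith
        _ = 27 := by norm_num
    nlinarith [Real.cos_le_one (α * |W.arg|)]
  · have hmax := cos_le_max_of_mem (a := 2 * |W.arg|) (x := α * |W.arg|) (b := 3 * |W.arg|)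
      (by positivity) (by gcongr) (by gcongr) (by linarith [Real.pi_pos])
    rw [Real.cos_two_mul, Real.cos_three_mul, hcos] at hmax
    have hr0 : 0 < ‖W‖ := by linarith
    have hτ2 : τ ^ 2 = |τ| ^ 2 := (sq_abs τ).symm
    have e1 : ‖W‖ ^ 2 * (2 * (1 / ‖W‖) ^ 2 - 1) ≤ -|τ| := by
      have : ‖W‖ ^ 2 * (2 * (1 / ‖W‖) ^ 2 - 1) = 2 - ‖W‖ ^ 2 := by field_simp
      rw [this, hr2, hτ2]; nlinarith
    have e2 : ‖W‖ ^ 2 * (4 * (1 / ‖W‖) ^ 3 - 3 * (1 / ‖W‖)) ≤ -|τ| := by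
      have : ‖W‖ ^ 2 * (4 * (1 / ‖W‖) ^ 3 - 3 * (1 / ‖W‖)) = (4 - 3 * ‖W‖ ^ 2) / ‖W‖ := by
        field_simp
      rw [this, div_le_iff₀ hr0, hr2, hτ2]
      nlinarith
    have hle : ‖W‖ ^ 2 * max (2 * (1 / ‖W‖) ^ 2 - 1) (4 * (1 / ‖W‖) ^ 3 - 3 * (1 / ‖W‖)) ≤ -|τ| := by
      rcases max_choice (2 * (1 / ‖W‖) ^ 2 - 1) (4 * (1 / ‖W‖) ^ 3 - 3 * (1 / ‖W‖)) with h | h <;>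
        rw [h] <;> assumption
    set m := max (2 * (1 / ‖W‖) ^ 2 - 1) (4 * (1 / ‖W‖) ^ 3 - 3 * (1 / ‖W‖))
    have hm : m ≤ 0 := by
      by_contra hcon
      push Not at hcon
      have : 0 < ‖W‖ ^ 2 * m := by positivity
      linarith [abs_nonneg τ]
    nlinarith

/-- Four powers of `|W|` cover the worst factor `W^α log W` in `powKernelDeriv`. Two more are paid
for the integrable weight `|W|⁻² = (1 + τ²)⁻¹`, and all six are absorbed by `e^{-|τ|/3}`; the number
`18 = 6 · 3` comes from `|W| ≤ 18 e^{|τ|/18}`. -/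
lemma norm_mul_exp_cpow_le {α : ℝ} (h2 : 2 ≤ α) (h3 : α ≤ 3) (τ : ℝ) :
    ‖1 + τ * Complex.I‖ ^ 4 * ‖Complex.exp ((1 + τ * Complex.I) ^ (α : ℂ) / 3)‖ ≤
      18 ^ 6 * Real.exp 10 * (1 + τ ^ 2)⁻¹ := by
  have hr1 : ‖1 + τ * Complex.I‖ ≤ 18 * Real.exp (|τ| / 18) := by
    have := norm_one_add_mul_I_le τ
    have h := Real.add_one_le_exp (|τ| / 18)
    linarith [abs_nonneg τ]
  have h6 : ‖1 + τ * Complex.I‖ ^ 6 ≤ 18 ^ 6 * Real.exp (|τ| / 3) := by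
    calc ‖1 + τ * Complex.I‖ ^ 6 ≤ (18 * Real.exp (|τ| / 18)) ^ 6 := by gcongr
      _ = 18 ^ 6 * Real.exp (|τ| / 3) := by
        rw [mul_pow, ← Real.exp_nat_mul]; congr 2; push_cast; ring
  have he : ‖Complex.exp ((1 + τ * Complex.I) ^ (α : ℂ) / 3)‖ ≤ Real.exp 10 * Real.exp (-|τ| / 3) := by
    rw [Complex.norm_exp, ← Real.exp_add]
    apply Real.exp_le_exp.2
    have := re_cpow_le h2 h3 τ
    have h : ((1 + τ * Complex.I) ^ (α : ℂ) / 3).re = ((1 + τ * Complex.I) ^ (α : ℂ)).re / 3 := by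
      rw [← Complex.div_ofReal_re]; norm_num
    rw [h]; linarith
  have hpos : 0 < 1 + τ ^ 2 := by positivity
  rw [← div_eq_mul_inv, le_div_iff₀ hpos, ← norm_sq_one_add_mul_I]
  calc _ = ‖1 + τ * Complex.I‖ ^ 6 * ‖Complex.exp ((1 + τ * Complex.I) ^ (α : ℂ) / 3)‖ := by ring
    _ ≤ (18 ^ 6 * Real.exp (|τ| / 3)) * (Real.exp 10 * Real.exp (-|τ| / 3)) := by gcongr
    _ = 18 ^ 6 * Real.exp 10 * (Real.exp (|τ| / 3) * Real.exp (-|τ| / 3)) := by ring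
    _ = _ := by rw [← Real.exp_add]; ring_nf; simp

end

/-! ### Deformation of the exponent `3` to `2`, and the value at `0` of the primitive of `Ai` -/

noncomputable section

/-- The integrand `α e^{W^α/3}/W` with `W = 1 + iτ`. -/
def powKernel (α τ : ℝ) : ℂ :=
  α * (Complex.exp ((1 + τ * Complex.I) ^ (α : ℂ) / 3) / (1 + τ * Complex.I))

/-- The `α`-derivative of `powKernel`. -/
def powKernelDeriv (α τ : ℝ) : ℂ :=
  Complex.exp ((1 + τ * Complex.I) ^ (α : ℂ) / 3) / (1 + τ * Complex.I) +
  α * (Complex.exp ((1 + τ * Complex.I) ^ (α : ℂ) / 3) *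
    ((1 + τ * Complex.I) ^ (α : ℂ) * Complex.log (1 + τ * Complex.I) / 3) / (1 + τ * Complex.I))

lemma hasDerivAt_exp_cpow (α τ : ℝ) :
    HasDerivAt (fun α : ℝ => Complex.exp ((1 + τ * Complex.I) ^ (α : ℂ) / 3))
      (Complex.exp ((1 + τ * Complex.I) ^ (α : ℂ) / 3) *
        ((1 + τ * Complex.I) ^ (α : ℂ) * Complex.log (1 + τ * Complex.I) / 3)) α := by
  have h1 : HasDerivAt (fun α : ℂ => (1 + τ * Complex.I) ^ α)
      ((1 + τ * Complex.I) ^ (α : ℂ) * Complex.log (1 + τ * Complex.I)) (α : ℂ) := by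
    have := (hasDerivAt_id (α : ℂ)).const_cpow (c := 1 + τ * Complex.I)
      (Or.inl (one_add_mul_I_ne_zero τ))
    exact this.congr_deriv (by simp)
  exact ((h1.div_const 3).cexp).comp_ofReal

lemma hasDerivAt_powKernel (α τ : ℝ) :
    HasDerivAt (fun α : ℝ => powKernel α τ) (powKernelDeriv α τ) α := by
  have h := ((hasDerivAt_exp_cpow α τ).div_const (1 + τ * Complex.I))
  have h' := (Complex.ofRealCLM.hasDerivAt (x := α)).mul h
  refine (h'.congr_deriv ?_)
  simp [powKernelDeriv]

lemma continuous_exp_cpow (α : ℝ) :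
    Continuous fun τ : ℝ => Complex.exp ((1 + τ * Complex.I) ^ (α : ℂ) / 3) := by
  have : Continuous fun τ : ℝ => (1 + τ * Complex.I) ^ (α : ℂ) :=
    Continuous.cpow (by fun_prop) continuous_const fun τ => one_add_mul_I_mem_slitPlane τ
  fun_prop

lemma continuous_log_line : Continuous fun τ : ℝ => Complex.log (1 + τ * Complex.I) :=
  Continuous.clog (by fun_prop) fun τ => one_add_mul_I_mem_slitPlane τ

lemma continuous_powKernel (α : ℝ) : Continuous (powKernel α) :=
  continuous_const.mul ((continuous_exp_cpow α).div (by fun_prop) one_add_mul_I_ne_zero)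

lemma continuous_powKernelDeriv (α : ℝ) : Continuous (powKernelDeriv α) := by
  have h : Continuous fun τ : ℝ => (1 + τ * Complex.I) ^ (α : ℂ) :=
    Continuous.cpow (by fun_prop) continuous_const fun τ => one_add_mul_I_mem_slitPlane τ
  have h1 := continuous_exp_cpow α
  have h2 := continuous_log_line
  exact (h1.div (by fun_prop) one_add_mul_I_ne_zero).add (continuous_const.mul
    ((h1.mul ((h.mul h2).div_const 3)).div (by fun_prop) one_add_mul_I_ne_zero))

lemma norm_log_line_le (τ : ℝ) :
    ‖Complex.log (1 + τ * Complex.I)‖ ≤ 5 * ‖1 + τ * Complex.I‖ := by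
  have hr1 := one_le_norm_one_add_mul_I τ
  have h1 := Complex.norm_le_abs_re_add_abs_im (Complex.log (1 + τ * Complex.I))
  rw [Complex.log_re, Complex.log_im] at h1
  have h2 := Complex.abs_arg_le_pi (1 + τ * Complex.I)
  have h3 := Real.log_le_sub_one_of_pos (zero_lt_one.trans_le hr1)
  have h4 := Real.log_nonneg hr1
  rw [abs_of_nonneg h4] at h1
  linarith [Real.pi_le_four]

lemma norm_powKernel_le {α : ℝ} (h2 : 2 ≤ α) (h3 : α ≤ 3) (τ : ℝ) :
    ‖powKernel α τ‖ ≤ 3 * (18 ^ 6 * Real.exp 10 * (1 + τ ^ 2)⁻¹) := by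
  have h := norm_mul_exp_cpow_le h2 h3 τ
  have hr1 := one_le_norm_one_add_mul_I τ
  rw [powKernel, norm_mul, norm_div, Complex.norm_real, Real.norm_of_nonneg (by linarith)]
  gcongr
  refine le_trans ?_ h
  refine (div_le_self (norm_nonneg _) hr1).trans ?_
  exact le_mul_of_one_le_left (norm_nonneg _) (one_le_pow₀ hr1)

lemma norm_powKernelDeriv_le {α : ℝ} (h2 : 2 ≤ α) (h3 : α ≤ 3) (τ : ℝ) :
    ‖powKernelDeriv α τ‖ ≤ 6 * (18 ^ 6 * Real.exp 10 * (1 + τ ^ 2)⁻¹) := by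
  have h := norm_mul_exp_cpow_le h2 h3 τ
  have hr1 := one_le_norm_one_add_mul_I τ
  have hlog := norm_log_line_le τ
  set B := 18 ^ 6 * Real.exp 10 * (1 + τ ^ 2)⁻¹
  set e := ‖Complex.exp ((1 + τ * Complex.I) ^ (α : ℂ) / 3)‖ with he
  set r := ‖1 + τ * Complex.I‖ with hr
  have he0 : 0 ≤ e := norm_nonneg _
  have hα : ‖(1 + τ * Complex.I) ^ (α : ℂ)‖ ≤ r ^ 3 := by
    rw [Complex.norm_cpow_of_ne_zero (one_add_mul_I_ne_zero τ)]
    simp only [Complex.ofReal_re, Complex.ofReal_im, mul_zero, Real.exp_zero, div_one]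
    rw [← Real.rpow_natCast]
    exact Real.rpow_le_rpow_of_exponent_le hr1 (by simpa using h3)
  have t1 : ‖Complex.exp ((1 + τ * Complex.I) ^ (α : ℂ) / 3) / (1 + τ * Complex.I)‖ ≤ B := by
    rw [norm_div]
    exact ((div_le_self he0 hr1).trans (le_mul_of_one_le_left he0 (one_le_pow₀ hr1))).trans h
  have t2 : ‖(α : ℂ) * (Complex.exp ((1 + τ * Complex.I) ^ (α : ℂ) / 3) *
    ((1 + τ * Complex.I) ^ (α : ℂ) * Complex.log (1 + τ * Complex.I) / 3) /
      (1 + τ * Complex.I))‖ ≤ 5 * B := by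
    rw [norm_mul, norm_div, norm_mul, norm_div, norm_mul, Complex.norm_real,
      Real.norm_of_nonneg (by linarith), Complex.norm_ofNat, ← he, ← hr]
    calc α * (e * (‖(1 + τ * Complex.I) ^ (α : ℂ)‖ * ‖Complex.log (1 + τ * Complex.I)‖ / 3) / r)
        ≤ 3 * (e * (r ^ 3 * (5 * r) / 3) / r) := by gcongr
      _ ≤ 3 * (e * (r ^ 3 * (5 * r) / 3)) := by
        gcongr
        exact div_le_self (by positivity) hr1
      _ = 5 * (r ^ 4 * e) := by ring
      _ ≤ 5 * B := by gcongr
  exact (norm_add_le _ _).trans (by linarith)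

/-- Up to the factor `i`, the integrand is the `τ`-derivative of `e^{W^α/3} log W`, which is itself
integrable. -/
lemma integral_powKernelDeriv {α : ℝ} (h2 : 2 ≤ α) (h3 : α ≤ 3) :
    ∫ τ, powKernelDeriv α τ = 0 := by
  have hi : Integrable (powKernelDeriv α) :=
    Integrable.mono' ((integrable_inv_one_add_sq.const_mul _).const_mul _)
      (continuous_powKernelDeriv α).aestronglyMeasurable
      (ae_of_all _ (norm_powKernelDeriv_le h2 h3))
  have hd : ∀ τ : ℝ, HasDerivAt (fun τ : ℝ => Complex.exp ((1 + τ * Complex.I) ^ (α : ℂ) / 3) *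
      Complex.log (1 + τ * Complex.I)) (Complex.I * powKernelDeriv α τ) τ := by
    intro τ
    have hW : HasDerivAt (fun τ : ℝ => 1 + (τ : ℂ) * Complex.I) Complex.I τ := by
      have := ((Complex.ofRealCLM.hasDerivAt (x := τ)).mul_const Complex.I).const_add 1
      exact this.congr_deriv (by simp)
    have h1 := (((hasDerivAt_id _).cpow_const (c := (α : ℂ))
      (one_add_mul_I_mem_slitPlane τ)).div_const 3).cexp
    have h2 := h1.mul (Complex.hasDerivAt_log (one_add_mul_I_mem_slitPlane τ))
    have h3 := h2.comp τ hW
    refine h3.congr_deriv ?_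
    simp only [powKernelDeriv, id]
    rw [Complex.cpow_sub _ _ (one_add_mul_I_ne_zero τ), Complex.cpow_one]
    have := one_add_mul_I_ne_zero τ
    field_simp
    ring
  have hm : Integrable (fun τ : ℝ => Complex.exp ((1 + τ * Complex.I) ^ (α : ℂ) / 3) *
      Complex.log (1 + τ * Complex.I)) := by
    refine Integrable.mono' ((integrable_inv_one_add_sq.const_mul
      (18 ^ 6 * Real.exp 10)).const_mul 5)
      ((continuous_exp_cpow α).mul continuous_log_line).aestronglyMeasurable
      (ae_of_all _ fun τ => ?_)
    have h := norm_mul_exp_cpow_le h2 h3 τ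
    have hr1 := one_le_norm_one_add_mul_I τ
    rw [norm_mul]
    calc _ ≤ ‖Complex.exp ((1 + τ * Complex.I) ^ (α : ℂ) / 3)‖ * (5 * ‖1 + τ * Complex.I‖) := by
          gcongr; exact norm_log_line_le τ
      _ ≤ ‖Complex.exp ((1 + τ * Complex.I) ^ (α : ℂ) / 3)‖ * (5 * ‖1 + τ * Complex.I‖ ^ 4) := by
          gcongr; exact le_self_pow₀ hr1 (by norm_num)
      _ ≤ _ := by linarith
  have := integral_eq_zero_of_hasDerivAt_of_integrable hd (hi.const_mul Complex.I) hm
  rw [integral_const_mul] at this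
  exact (mul_eq_zero.1 this).resolve_left Complex.I_ne_zero

/-- Since `α dW/W = d(W^α)/W^α`, changing `α` only deforms the contour of `e^{v/3} dv/v`. In place
of a contour argument, the `α`-derivative of the integral is shown to vanish. -/
lemma integral_powKernel_eq : ∫ τ, powKernel 3 τ = ∫ τ, powKernel 2 τ := by
  have hcont : ContinuousOn (fun α : ℝ => ∫ τ, powKernel α τ) (Set.Icc 2 3) := by
    refine continuousOn_of_dominated (fun α _ => (continuous_powKernel α).aestronglyMeasurable)
      (fun α hα => ae_of_all _ (norm_powKernel_le hα.1 hα.2))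
      ((integrable_inv_one_add_sq.const_mul _).const_mul _) (ae_of_all _ fun τ α _ =>
        (hasDerivAt_powKernel α τ).continuousAt.continuousWithinAt)
  have hder : ∀ α ∈ Set.Ioo (2 : ℝ) 3, HasDerivAt (fun α : ℝ => ∫ τ, powKernel α τ) 0 α := by
    intro α hα
    have := (hasDerivAt_integral_of_dominated_loc_of_deriv_le (μ := volume)
      (isOpen_Ioo.mem_nhds hα)
      (bound := fun τ => 6 * (18 ^ 6 * Real.exp 10 * (1 + τ ^ 2)⁻¹))
      (F := powKernel) (F' := powKernelDeriv)
      (Eventually.of_forall fun x => (continuous_powKernel x).aestronglyMeasurable)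
      (Integrable.mono' ((integrable_inv_one_add_sq.const_mul _).const_mul _)
        (continuous_powKernel α).aestronglyMeasurable
        (ae_of_all _ (norm_powKernel_le hα.1.le hα.2.le)))
      (continuous_powKernelDeriv α).aestronglyMeasurable
      (ae_of_all _ fun τ x hx => norm_powKernelDeriv_le hx.1.le hx.2.le τ)
      ((integrable_inv_one_add_sq.const_mul _).const_mul _)
      (ae_of_all _ fun τ x _ => hasDerivAt_powKernel x τ)).2
    rwa [integral_powKernelDeriv hα.1.le hα.2.le] at this
  -- The derivative is known only on the open interval, so constancy is obtained on `[a, 3]` for `a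
  -- > 2`, and then `a → 2` by continuity.
  have hconst : ∀ a ∈ Set.Ioo (2 : ℝ) 3, ∫ τ, powKernel 3 τ = ∫ τ, powKernel a τ := by
    intro a ha
    exact constant_of_has_deriv_right_zero (f := fun α : ℝ => ∫ τ, powKernel α τ)
      (hcont.mono (Set.Icc_subset_Icc_left ha.1.le))
      (fun x hx => (hder x ⟨ha.1.trans_le hx.1, hx.2⟩).hasDerivWithinAt) 3
      (Set.right_mem_Icc.2 ha.2.le)
  have hlim : Tendsto (fun α : ℝ => ∫ τ, powKernel α τ) (𝓝[Set.Ioo 2 3] 2)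
      (𝓝 (∫ τ, powKernel 2 τ)) :=
    ((hcont 2 (by norm_num)).mono Set.Ioo_subset_Icc_self).tendsto
  have hne : (𝓝[Set.Ioo (2 : ℝ) 3] 2).NeBot := by
    rw [nhdsWithin_Ioo_eq_nhdsGT (by norm_num)]; infer_instance
  refine tendsto_nhds_unique (hlim.congr' ?_) tendsto_const_nhds |>.symm
  filter_upwards [self_mem_nhdsWithin] with a ha using (hconst a ha).symm

/-- Write `1/W = ∫₀^∞ e^{-Wx} dx`, valid since `Re W = 1`, and exchange the integrals: the one in
`τ` is Gaussian and leaves `2√(3π) e^{-3x²/4}`, half a Gaussian in `x`. -/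
lemma integral_powKernel_two : ∫ τ, powKernel 2 τ = 2 * Real.pi := by
  have hk : ∀ τ : ℝ, powKernel 2 τ = ∫ x in Set.Ioi (0 : ℝ), 2 *
      Complex.exp ((1 + τ * Complex.I) ^ 2 / 3 - (1 + τ * Complex.I) * x) := by
    intro τ
    have h1 : ∀ x : ℝ, 2 * Complex.exp ((1 + τ * Complex.I) ^ 2 / 3 - (1 + τ * Complex.I) * x)
        = (2 * Complex.exp ((1 + τ * Complex.I) ^ 2 / 3)) *
          Complex.exp (-(1 + τ * Complex.I) * x) := by
      intro x
      rw [mul_assoc, ← Complex.exp_add]; ring_nf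
    simp_rw [h1]
    rw [integral_const_mul, integral_exp_mul_complex_Ioi (by simp)]
    simp only [powKernel, Complex.ofReal_zero, mul_zero, Complex.exp_zero]
    rw [show ((2 : ℝ) : ℂ) = ((2 : ℕ) : ℂ) by norm_num, Complex.cpow_natCast]
    have := one_add_mul_I_ne_zero τ
    field_simp
    push_cast; ring
  have hx : ∀ x : ℝ, ∫ τ : ℝ, 2 *
      Complex.exp ((1 + τ * Complex.I) ^ 2 / 3 - (1 + τ * Complex.I) * x)
      = ((2 * √(3 * Real.pi) * Real.exp (-(3 / 4) * x ^ 2) : ℝ) : ℂ) := by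
    intro x
    have h1 : ∀ τ : ℝ, 2 * Complex.exp ((1 + τ * Complex.I) ^ 2 / 3 - (1 + τ * Complex.I) * x)
        = 2 * Complex.exp (-(1 / 3) * (τ : ℂ) ^ 2 + (Complex.I * (2 / 3 - x)) * τ + (1 / 3 - x)) := by
      intro τ
      congr 2
      ring_nf
      simp only [Complex.I_sq]
      ring
    simp_rw [h1]
    rw [integral_const_mul, integral_cexp_quadratic (by norm_num)]
    have h2 : ((Real.pi : ℂ) / - -(1 / 3)) ^ (1 / 2 : ℂ) = ((√(3 * Real.pi) : ℝ) : ℂ) := by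
      rw [Real.sqrt_eq_rpow, Complex.ofReal_cpow (by positivity)]
      congr 1 <;> push_cast <;> ring
    rw [h2]
    push_cast
    rw [mul_assoc]
    congr 3
    rw [mul_pow, Complex.I_sq]
    ring
  simp_rw [hk]
  rw [integral_integral_swap]
  · simp_rw [hx]
    rw [integral_complex_ofReal, integral_const_mul, integral_gaussian_Ioi]
    rw [show 2 * √(3 * Real.pi) * (√(Real.pi / (3 / 4)) / 2) = 2 * Real.pi by
      rw [show 2 * √(3 * Real.pi) * (√(Real.pi / (3 / 4)) / 2)
        = √(3 * Real.pi) * √(Real.pi / (3 / 4)) by ring, ← Real.sqrt_mul (by positivity),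
        show 3 * Real.pi * (Real.pi / (3 / 4)) = (2 * Real.pi) ^ 2 by ring]
      exact Real.sqrt_sq (by positivity)]
    push_cast; rfl
  · have hb : Integrable (fun p : ℝ × ℝ => (2 * Real.exp (1 / 3) * Real.exp (-(1 / 3) * p.1 ^ 2)) *
        Real.exp (-1 * p.2)) (volume.prod (volume.restrict (Set.Ioi (0 : ℝ)))) :=
      ((integrable_exp_neg_mul_sq (by norm_num)).const_mul _).mul_prod
        (integrableOn_exp_mul_Ioi (by norm_num) 0)
    refine Integrable.mono' hb (Continuous.aestronglyMeasurable (by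
      simp only [Function.uncurry_def]; fun_prop)) (ae_of_all _ fun p => ?_)
    simp only [Function.uncurry_def, norm_mul, Complex.norm_ofNat, Complex.norm_exp]
    rw [mul_assoc, mul_assoc, ← Real.exp_add, ← Real.exp_add]
    gcongr
    apply le_of_eq
    have : (1 + (p.1 : ℂ) * Complex.I) ^ 2 / 3 - (1 + p.1 * Complex.I) * p.2
      = ((1 / 3 - p.1 ^ 2 / 3 - p.2 : ℝ) : ℂ) + ((2 * p.1 / 3 - p.1 * p.2 : ℝ) : ℂ) * Complex.I := by
      push_cast
      ring_nf
      simp only [Complex.I_sq]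
      ring
    rw [this, Complex.add_re, Complex.ofReal_re, Complex.re_ofReal_mul, Complex.I_re]
    ring

/-- The primitive of the Airy function that vanishes at `+∞` takes the value `-1/3` at `0`. -/
lemma airyInt_neg_one_zero : airyInt 1 (-1) 0 = -(2 * Real.pi / 3) := by
  have h := integral_powKernel_eq.trans integral_powKernel_two
  rw [airyInt, ← integral_neg_eq_self]
  -- After the reflection `t = -τ` the contour is `w = i(1 + iτ) = iW`, so `iw = -W` and `iw³/3 =
  -- W³/3`.
  have : ∀ τ : ℝ, airyKernel (-1) 0 ((-τ : ℝ) + (1 : ℝ) * Complex.I) = -(1 / 3) * powKernel 3 τ := by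
    intro τ
    have e1 : Complex.I * (((-τ : ℝ) : ℂ) + (1 : ℝ) * Complex.I) = -(1 + τ * Complex.I) := by
      push_cast; ring_nf; simp only [Complex.I_sq]; ring
    have e2 : ((-τ : ℝ) : ℂ) + (1 : ℝ) * Complex.I = Complex.I * (1 + τ * Complex.I) := by
      push_cast; ring_nf; simp only [Complex.I_sq]; ring
    rw [airyKernel, e1, e2, airyExp, powKernel, zpow_neg_one,
      show ((3 : ℝ) : ℂ) = ((3 : ℕ) : ℂ) by norm_num, Complex.cpow_natCast]
    have e3 : Complex.I * (Complex.I * (1 + τ * Complex.I)) ^ 3 / 3 +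
        Complex.I * 0 * (Complex.I * (1 + τ * Complex.I)) = (1 + τ * Complex.I) ^ 3 / 3 := by
      rw [mul_pow, ← mul_assoc, ← pow_succ', Complex.I_pow_four]; ring
    rw [e3]
    have := one_add_mul_I_ne_zero τ
    push_cast
    field_simp
  simp_rw [this]
  rw [integral_const_mul, h]
  ring

end

noncomputable section

/-! ### The Airy function on the real line -/

lemma airyKernel_eq (n : ℤ) (z w : ℂ) :
    airyKernel n z w =
      (Complex.I * w) ^ n * Complex.exp (-(Complex.I * w) ^ 3 / 3 + z * (Complex.I * w)) := by
  rw [airyKernel, airyExp]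
  congr 2
  rw [mul_pow, pow_succ Complex.I 2, Complex.I_sq]
  ring

/-- For real `x` the kernel is a function of `iw` with real coefficients, and reflecting `t`
conjugates `iw`. Hence all the integrals are real on the real line. -/
lemma conj_airyKernel (n : ℤ) (x s t : ℝ) :
    (starRingEnd ℂ) (airyKernel n x (t + s * Complex.I)) =
      airyKernel n x ((-t : ℝ) + s * Complex.I) := by
  have h : (starRingEnd ℂ) (Complex.I * (t + s * Complex.I)) =
      Complex.I * ((-t : ℝ) + s * Complex.I) := by
    simp [mul_add]
  rw [airyKernel_eq, airyKernel_eq, map_mul, map_zpow₀, ← Complex.exp_conj]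
  simp only [map_add, map_div₀, map_neg, map_pow, h, map_mul (starRingEnd ℂ) (x : ℂ),
    Complex.conj_ofReal, map_ofNat]

lemma conj_airyInt (s : ℝ) (n : ℤ) (x : ℝ) :
    (starRingEnd ℂ) (airyInt s n x) = airyInt s n x := by
  rw [airyInt, ← integral_conj]
  simp_rw [conj_airyKernel]
  exact integral_neg_eq_self (fun t : ℝ => airyKernel n x (t + s * Complex.I)) volume

/-- The iterated derivatives `Ai⁽ⁿ⁾`; for `n = -1` the primitive of `Ai` vanishing at `+∞`. -/
def airyD (n : ℤ) (z : ℂ) : ℂ := 1 / (2 * Real.pi) * airyInt 1 n z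

lemma airyD_zero : airyD 0 = airyAi := by
  ext z; rw [airyD, airyAi_eq_airyInt]

lemma hasDerivAt_airyD (n : ℤ) (z : ℂ) : HasDerivAt (airyD n) (airyD (n + 1) z) z :=
  (hasDerivAt_airyInt one_pos n z).const_mul _

lemma airyD_two (z : ℂ) : airyD 2 z = z * airyAi z := by
  rw [airyD, airyInt_two, airyAi_eq_airyInt]; ring

lemma airyD_im (n : ℤ) (x : ℝ) : (airyD n x).im = 0 := by
  rw [← Complex.conj_eq_iff_im, airyD, map_mul, conj_airyInt]
  simp [Complex.conj_ofNat]

/-- The restriction of `airyD` to the real line. -/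
def airyR (n : ℤ) (x : ℝ) : ℝ := (airyD n x).re

lemma ofReal_airyR (n : ℤ) (x : ℝ) : (airyR n x : ℂ) = airyD n x :=
  Complex.ext (by simp [airyR]) (by simp [airyD_im])

lemma hasDerivAt_airyR (n : ℤ) (x : ℝ) : HasDerivAt (airyR n) (airyR (n + 1) x) x :=
  (hasDerivAt_airyD n x).real_of_complex

lemma airyR_two (x : ℝ) : airyR 2 x = x * airyR 0 x := by
  have := airyD_two x
  rw [← airyD_zero, ← ofReal_airyR, ← ofReal_airyR] at this
  exact_mod_cast this

lemma hasDerivAt_airyR_one (x : ℝ) : HasDerivAt (airyR 1) (x * airyR 0 x) x := by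
  rw [← airyR_two]; exact hasDerivAt_airyR 1 x

lemma hasDerivAt_airyR_zero (x : ℝ) : HasDerivAt (airyR 0) (airyR 1 x) x :=
  hasDerivAt_airyR 0 x

lemma hasDerivAt_airyR_neg_one (x : ℝ) : HasDerivAt (airyR (-1)) (airyR 0 x) x :=
  hasDerivAt_airyR (-1) x

lemma continuous_airyR (n : ℤ) : Continuous (airyR n) :=
  continuous_iff_continuousAt.2 fun x => (hasDerivAt_airyR n x).continuousAt

lemma airyR_zero (x : ℝ) : airyR 0 x = (airyAi x).re := by rw [airyR, airyD_zero]

lemma airyR_neg_one_zero : airyR (-1) 0 = -(1 / 3) := by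
  rw [airyR, airyD, Complex.ofReal_zero, airyInt_neg_one_zero]
  have : (1 / (2 * Real.pi) * -(2 * Real.pi / 3) : ℂ) = ((-(1 / 3) : ℝ) : ℂ) := by
    have : (Real.pi : ℂ) ≠ 0 := by exact_mod_cast Real.pi_ne_zero
    push_cast; field_simp
  rw [this, Complex.ofReal_re]

/-- The constant `2/3` in `airyG` is `1 - 1/3`, so that `G - 1` is the primitive of `Ai` vanishing
at `+∞`. -/
lemma airyG_eq (x : ℝ) : airyG x = 1 + airyR (-1) x := by
  have : ∫ ξ in (0 : ℝ)..x, (airyAi ξ).re = airyR (-1) x - airyR (-1) 0 := by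
    refine intervalIntegral.integral_eq_sub_of_hasDerivAt (fun y _ => ?_) ?_
    · rw [← airyR_zero]; exact hasDerivAt_airyR_neg_one y
    · simp_rw [← airyR_zero]; exact (continuous_airyR 0).intervalIntegrable _ _
  rw [airyG, this, airyR_neg_one_zero]; ring

lemma hasDerivAt_airyG (x : ℝ) : HasDerivAt airyG (airyR 0 x) x := by
  rw [show airyG = fun x => 1 + airyR (-1) x from funext airyG_eq]
  exact (hasDerivAt_airyR_neg_one x).const_add 1

lemma continuous_airyG : Continuous airyG :=
  continuous_iff_continuousAt.2 fun x => (hasDerivAt_airyG x).continuousAt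

lemma differentiable_airyAi : Differentiable ℂ airyAi := by
  rw [← airyD_zero]; exact fun z => (hasDerivAt_airyD 0 z).differentiableAt

/-- The entire primitive of the Airy function that extends `airyG`. -/
lemma exists_entire_airyG :
    ∃ F : ℂ → ℂ, (∀ z : ℂ, HasDerivAt F (airyAi z) z) ∧ ∀ η : ℝ, F η = (airyG η : ℂ) := by
  refine ⟨fun z => 1 + airyD (-1) z, fun z => ?_, fun η => ?_⟩
  · rw [← airyD_zero]; exact (hasDerivAt_airyD (-1) z).const_add 1
  · rw [airyG_eq]; push_cast; rw [ofReal_airyR]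

/-! ### Bounds on the real line -/

lemma norm_airyKernel_real (n : ℤ) (x s t : ℝ) :
    ‖airyKernel n x (t + s * Complex.I)‖ =
      ‖(t : ℂ) + s * Complex.I‖ ^ n * (Real.exp (s ^ 3 / 3 - s * x) * Real.exp (-s * t ^ 2)) := by
  rw [airyKernel, norm_mul, norm_airyExp, norm_zpow, norm_mul, Complex.norm_I, one_mul,
    ← Real.exp_add]
  congr 2
  simp
  ring

lemma le_norm_line (s t : ℝ) : s ≤ ‖(t : ℂ) + s * Complex.I‖ := by
  have := Complex.abs_im_le_norm ((t : ℂ) + s * Complex.I)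
  simp at this
  exact (le_abs_self s).trans this

lemma integral_gaussian_le {f : ℝ → ℂ} {K s : ℝ} (hs : 0 < s)
    (hf : ∀ t, ‖f t‖ ≤ K * Real.exp (-s * t ^ 2)) : ‖∫ t, f t‖ ≤ K * √(Real.pi / s) := by
  rw [← integral_gaussian, ← integral_const_mul]
  exact norm_integral_le_of_norm_le ((integrable_exp_neg_mul_sq hs).const_mul _) (ae_of_all _ hf)

lemma abs_airyR_eq {s : ℝ} (hs : 0 < s) (n : ℤ) (x : ℝ) :
    |airyR n x| = ‖airyInt s n x‖ / (2 * Real.pi) := by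
  have h : ‖airyD n x‖ = |airyR n x| := by rw [← ofReal_airyR, Complex.norm_real, Real.norm_eq_abs]
  rw [← h, airyD, norm_mul, airyInt_eq one_pos hs]
  simp [abs_of_pos Real.pi_pos]
  ring

lemma abs_airyR_zero_le {s : ℝ} (hs : 0 < s) (x : ℝ) :
    |airyR 0 x| ≤ Real.exp (s ^ 3 / 3 - s * x) * √(Real.pi / s) / (2 * Real.pi) := by
  rw [abs_airyR_eq hs]
  gcongr
  refine integral_gaussian_le hs fun t => ?_
  rw [norm_airyKernel_real, zpow_zero, one_mul]

lemma abs_airyR_neg_one_le {s : ℝ} (hs : 0 < s) (x : ℝ) :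
    |airyR (-1) x| ≤ Real.exp (s ^ 3 / 3 - s * x) / s * √(Real.pi / s) / (2 * Real.pi) := by
  rw [abs_airyR_eq hs]
  gcongr
  refine integral_gaussian_le hs fun t => ?_
  rw [norm_airyKernel_real, zpow_neg_one, div_mul_eq_mul_div, mul_comm, ← div_eq_mul_inv]
  gcongr
  exact le_norm_line s t

lemma exists_abs_airyR_le (n : ℤ) : ∃ C : ℝ, 0 ≤ C ∧ ∀ x, |airyR n x| ≤ C * Real.exp (-x) := by
  refine ⟨(∫ t : ℝ, ‖airyKernel n (0 : ℝ) (t + (1 : ℝ) * Complex.I)‖) / (2 * Real.pi),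
    by positivity, fun x => ?_⟩
  rw [abs_airyR_eq one_pos, div_mul_eq_mul_div, ← integral_mul_const]
  gcongr
  refine (norm_integral_le_integral_norm _).trans (le_of_eq ?_)
  congr 1 with t
  rw [norm_airyKernel_real, norm_airyKernel_real, sub_eq_add_neg, Real.exp_add,
    sub_eq_add_neg (_ / 3), Real.exp_add]
  simp
  ring

lemma tendsto_airyR_atTop (n : ℤ) : Tendsto (airyR n) atTop (𝓝 0) := by
  obtain ⟨C, -, h⟩ := exists_abs_airyR_le n
  refine squeeze_zero_norm h ?_
  simpa using (Real.tendsto_exp_neg_atTop_nhds_zero).const_mul C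

lemma tendsto_airyG_atTop : Tendsto airyG atTop (𝓝 1) := by
  rw [show airyG = fun x => 1 + airyR (-1) x from funext airyG_eq]
  simpa using (tendsto_airyR_atTop (-1)).const_add 1

/-- At height `s = 1/(1+|x|)` the factor `e^{-sx}` stays bounded for negative `x`, at the cost of
only `√(1/s) ≤ 1 + |x|`. This crude growth bound is enough for the integrability questions below. -/
lemma exists_abs_airyR_zero_le : ∃ C : ℝ, 0 ≤ C ∧ ∀ x, |airyR 0 x| ≤ C * (1 + |x|) := by
  refine ⟨Real.exp (4 / 3) * √Real.pi / (2 * Real.pi), by positivity, fun x => ?_⟩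
  have hx : 0 < 1 + |x| := by positivity
  refine (abs_airyR_zero_le (inv_pos.2 hx) x).trans ?_
  have h1 : Real.exp ((1 + |x|)⁻¹ ^ 3 / 3 - (1 + |x|)⁻¹ * x) ≤ Real.exp (4 / 3) := by
    apply Real.exp_le_exp.2
    have a1 : (1 + |x|)⁻¹ ≤ 1 := inv_le_one_of_one_le₀ (by linarith [abs_nonneg x])
    have a2 : (1 + |x|)⁻¹ ^ 3 ≤ 1 := pow_le_one₀ (by positivity) a1
    have a3 : -((1 + |x|)⁻¹ * x) ≤ 1 := by
      rw [← mul_neg, inv_mul_le_iff₀ hx]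
      linarith [neg_le_abs x]
    linarith
  have h2 : √(Real.pi / (1 + |x|)⁻¹) ≤ √Real.pi * (1 + |x|) := by
    rw [div_inv_eq_mul, Real.sqrt_mul Real.pi_pos.le]
    gcongr
    exact Real.sqrt_le_iff.2 ⟨hx.le, by nlinarith [abs_nonneg x]⟩
  calc _ ≤ Real.exp (4 / 3) * (√Real.pi * (1 + |x|)) / (2 * Real.pi) := by gcongr
    _ = _ := by ring

end

noncomputable section

/-! ### The Airy function as an inverse Fourier transform -/

/-- On the line `w = u + is`, the choice `z = x + s²` cancels the linear term produced by the cube.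
So `e^{i(2πt)³/3}` damped by a Gaussian has an explicit shift of `Ai` as inverse Fourier transform.
-/
lemma exp_mul_airyAi_shift {s : ℝ} (hs : 0 < s) (x : ℝ) :
    Complex.exp (s * x + 2 * s ^ 3 / 3) * airyAi ((x + s ^ 2 : ℝ) : ℂ) =
      ∫ t : ℝ, Complex.exp (Complex.I * (2 * Real.pi * t) ^ 3 / 3 - s * (2 * Real.pi * t) ^ 2) *
        Complex.exp (2 * Real.pi * Complex.I * t * x) := by
  have hpi : (Real.pi : ℂ) ≠ 0 := by exact_mod_cast Real.pi_ne_zero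
  set h : ℝ → ℂ := fun u => Complex.exp (Complex.I * u ^ 3 / 3 - s * u ^ 2) *
    Complex.exp (Complex.I * u * x)
  have h1 : ∀ t : ℝ,
      Complex.exp (Complex.I * (2 * Real.pi * t) ^ 3 / 3 - s * (2 * Real.pi * t) ^ 2) *
        Complex.exp (2 * Real.pi * Complex.I * t * x) = h (2 * Real.pi * t) := by
    intro t
    simp only [h]
    push_cast
    congr 2
    ring
  simp_rw [h1]
  rw [Measure.integral_comp_mul_left h, airyAi_eq_airyInt, airyInt_eq one_pos hs, airyInt,
    abs_of_pos (by positivity)]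
  have h2 : ∀ u : ℝ, h u = Complex.exp (s * x + 2 * s ^ 3 / 3) *
      airyKernel 0 ((x + s ^ 2 : ℝ) : ℂ) (u + s * Complex.I) := by
    intro u
    simp only [h]
    rw [airyKernel, zpow_zero, one_mul, airyExp, ← Complex.exp_add, ← Complex.exp_add]
    congr 1
    push_cast
    ring_nf
    simp only [Complex.I_sq, Complex.I_pow_four]
    rw [show Complex.I ^ 3 = -Complex.I by rw [pow_succ, Complex.I_sq]; ring]
    ring
  simp_rw [h2]
  rw [integral_const_mul, Complex.real_smul]
  push_cast
  field_simp

/-- The domination for `s → 0`. Placing the contour at height `s + σ` with `σ = 1/(1+|x|)` makes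
`e^{-sx}` cancel the prefactor `e^{sx}`, and `e^{-σx}` stays bounded. -/
lemma norm_exp_mul_airyAi_shift_le {s : ℝ} (hs : 0 < s) (hs1 : s ≤ 1) (x : ℝ) :
    ‖Complex.exp (s * x + 2 * s ^ 3 / 3) * airyAi ((x + s ^ 2 : ℝ) : ℂ)‖ ≤
      Real.exp 6 * √Real.pi / (2 * Real.pi) * (1 + |x|) := by
  have hx : 0 < 1 + |x| := by positivity
  set σ := (1 + |x|)⁻¹ with hσ
  have hσ0 : 0 < σ := inv_pos.2 hx
  have hσ1 : σ ≤ 1 := inv_le_one_of_one_le₀ (by linarith [abs_nonneg x])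
  have hσx : -(σ * x) ≤ 1 := by
    rw [← mul_neg, hσ, inv_mul_le_iff₀ hx]
    linarith [neg_le_abs x]
  rw [norm_mul, ← airyD_zero, ← ofReal_airyR, Complex.norm_real, Real.norm_eq_abs,
    show ((s : ℂ) * x + 2 * s ^ 3 / 3) = ((s * x + 2 * s ^ 3 / 3 : ℝ) : ℂ) by push_cast; rfl,
    Complex.norm_exp_ofReal]
  have hA := abs_airyR_zero_le (add_pos hs hσ0) (x + s ^ 2)
  have h2 : √(Real.pi / (s + σ)) ≤ √Real.pi * (1 + |x|) := by
    have : √(Real.pi / (s + σ)) ≤ √(Real.pi * (1 + |x|)) := by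
      apply Real.sqrt_le_sqrt
      rw [div_le_iff₀ (by positivity), mul_assoc]
      have : (1 + |x|) * σ = 1 := mul_inv_cancel₀ hx.ne'
      have h3 : 1 ≤ (1 + |x|) * (s + σ) := by rw [mul_add, this]; nlinarith
      exact le_mul_of_one_le_right Real.pi_pos.le h3
    refine this.trans ?_
    rw [Real.sqrt_mul Real.pi_pos.le]
    gcongr
    exact Real.sqrt_le_iff.2 ⟨hx.le, by nlinarith [abs_nonneg x]⟩
  have h3 : Real.exp (s * x + 2 * s ^ 3 / 3) *
      Real.exp ((s + σ) ^ 3 / 3 - (s + σ) * (x + s ^ 2)) ≤ Real.exp 6 := by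
    rw [← Real.exp_add]
    apply Real.exp_le_exp.2
    have e1 : (s + σ) ^ 3 ≤ 2 ^ 3 := by gcongr; linarith
    have e2 : 0 ≤ s ^ 3 := by positivity
    have e3 : 0 ≤ σ * s ^ 2 := by positivity
    have e4 : s ^ 3 ≤ 1 := pow_le_one₀ hs.le hs1
    nlinarith
  calc _ ≤ Real.exp (s * x + 2 * s ^ 3 / 3) *
        (Real.exp ((s + σ) ^ 3 / 3 - (s + σ) * (x + s ^ 2)) * √(Real.pi / (s + σ)) /
          (2 * Real.pi)) := by gcongr
    _ = (Real.exp (s * x + 2 * s ^ 3 / 3) *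
        Real.exp ((s + σ) ^ 3 / 3 - (s + σ) * (x + s ^ 2))) * √(Real.pi / (s + σ)) /
          (2 * Real.pi) := by ring
    _ ≤ Real.exp 6 * (√Real.pi * (1 + |x|)) / (2 * Real.pi) := by gcongr
    _ = _ := by ring

lemma norm_exp_cubic (t s : ℝ) :
    ‖Complex.exp (Complex.I * (2 * Real.pi * t) ^ 3 / 3 - s * (2 * Real.pi * t) ^ 2)‖ =
      Real.exp (-(s * (2 * Real.pi) ^ 2) * t ^ 2) := by
  have : Complex.I * (2 * Real.pi * t) ^ 3 / 3 - s * (2 * Real.pi * t) ^ 2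
    = ((-(s * (2 * Real.pi) ^ 2) * t ^ 2 : ℝ) : ℂ) +
      (((2 * Real.pi * t) ^ 3 / 3 : ℝ) : ℂ) * Complex.I := by
    push_cast; ring
  rw [this, Complex.norm_exp, Complex.add_re, Complex.ofReal_re, Complex.re_ofReal_mul]
  simp

/-- The Airy function is the inverse Fourier transform of `t ↦ e^{i(2πt)³/3}`, tested against a
function `φ` with integrable first moment and integrable inverse Fourier transform. -/
lemma integral_airyAi_mul {φ : ℝ → ℂ} (hφ : Integrable φ)
    (hφ1 : Integrable fun x : ℝ => (1 + |x| : ℝ) * φ x) (hF : Integrable (𝓕⁻ φ)) :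
    ∫ x : ℝ, airyAi x * φ x =
      ∫ t : ℝ, Complex.exp (Complex.I * (2 * Real.pi * t) ^ 3 / 3) * 𝓕⁻ φ t := by
  -- The damped identity is Fubini; then `s → 0` on both sides by dominated convergence.
  have hreg : ∀ s : ℝ, 0 < s →
      ∫ x : ℝ, Complex.exp (s * x + 2 * s ^ 3 / 3) * airyAi ((x + s ^ 2 : ℝ) : ℂ) * φ x =
      ∫ t : ℝ, Complex.exp (Complex.I * (2 * Real.pi * t) ^ 3 / 3 - s * (2 * Real.pi * t) ^ 2) *
        𝓕⁻ φ t := by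
    intro s hs
    simp_rw [exp_mul_airyAi_shift hs, ← integral_mul_const]
    rw [integral_integral_swap]
    · congr 1 with t
      rw [Real.fourierInv_eq', ← integral_const_mul]
      congr 1 with x
      rw [smul_eq_mul, mul_assoc]
      congr 3
      simp
      ring
    · have hg : Integrable (fun t : ℝ => Real.exp (-(s * (2 * Real.pi) ^ 2) * t ^ 2)) :=
        integrable_exp_neg_mul_sq (by positivity)
      refine Integrable.mono' (hφ.norm.mul_prod hg) ?_ (ae_of_all _ fun p => ?_)
      · refine (Continuous.aestronglyMeasurable (by fun_prop)).mul
          (hφ.aestronglyMeasurable.comp_fst)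
      · simp only [Function.uncurry_def, norm_mul, norm_exp_cubic]
        have : ‖Complex.exp (2 * Real.pi * Complex.I * p.2 * p.1)‖ = 1 := by
          rw [show (2 * Real.pi * Complex.I * p.2 * p.1 : ℂ) =
            ((2 * Real.pi * p.2 * p.1 : ℝ) : ℂ) * Complex.I by push_cast; ring]
          exact Complex.norm_exp_ofReal_mul_I _
        rw [this, mul_one, mul_comm]
  have hpos : ∀ᶠ s : ℝ in 𝓝[>] 0, 0 < s ∧ s ≤ 1 := by
    filter_upwards [Ioc_mem_nhdsGT (zero_lt_one (α := ℝ))] with s hs using hs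
  have hcont : Continuous fun x : ℝ => airyAi x :=
    differentiable_airyAi.continuous.comp Complex.continuous_ofReal
  have lim1 : Tendsto (fun s : ℝ => ∫ x : ℝ,
      Complex.exp (s * x + 2 * s ^ 3 / 3) * airyAi ((x + s ^ 2 : ℝ) : ℂ) * φ x) (𝓝[>] 0)
      (𝓝 (∫ x : ℝ, airyAi x * φ x)) := by
    refine tendsto_integral_filter_of_dominated_convergence
      (fun x => Real.exp 6 * √Real.pi / (2 * Real.pi) * ‖(1 + |x| : ℝ) * φ x‖) ?_ ?_
      (hφ1.norm.const_mul _) (ae_of_all _ fun x => ?_)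
    · refine Eventually.of_forall fun s => AEStronglyMeasurable.mul
        (Continuous.aestronglyMeasurable ?_) hφ.aestronglyMeasurable
      exact (by fun_prop : Continuous _).mul (hcont.comp (by fun_prop))
    · filter_upwards [hpos] with s hs
      refine ae_of_all _ fun x => ?_
      have e : ‖((1 + |x| : ℝ) : ℂ) * φ x‖ = (1 + |x|) * ‖φ x‖ := by
        rw [norm_mul, Complex.norm_real, Real.norm_of_nonneg (by positivity)]
      rw [e, norm_mul, ← mul_assoc]
      gcongr
      exact norm_exp_mul_airyAi_shift_le hs.1 hs.2 x
    · have : Continuous fun s : ℝ =>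
          Complex.exp (s * x + 2 * s ^ 3 / 3) * airyAi ((x + s ^ 2 : ℝ) : ℂ) * φ x :=
        ((by fun_prop : Continuous _).mul (hcont.comp (by fun_prop))).mul continuous_const
      have := (this.tendsto 0).mono_left (nhdsWithin_le_nhds (s := Set.Ioi 0))
      simpa using this
  have lim2 : Tendsto (fun s : ℝ => ∫ t : ℝ,
      Complex.exp (Complex.I * (2 * Real.pi * t) ^ 3 / 3 - s * (2 * Real.pi * t) ^ 2) *
        𝓕⁻ φ t) (𝓝[>] 0)
      (𝓝 (∫ t : ℝ, Complex.exp (Complex.I * (2 * Real.pi * t) ^ 3 / 3) * 𝓕⁻ φ t)) := by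
    refine tendsto_integral_filter_of_dominated_convergence (fun t => ‖𝓕⁻ φ t‖) ?_ ?_ hF.norm
      (ae_of_all _ fun t => ?_)
    · exact Eventually.of_forall fun s => AEStronglyMeasurable.mul
        (Continuous.aestronglyMeasurable (by fun_prop)) hF.aestronglyMeasurable
    · filter_upwards [hpos] with s hs
      refine ae_of_all _ fun t => ?_
      rw [norm_mul, norm_exp_cubic]
      refine mul_le_of_le_one_left (norm_nonneg _) (Real.exp_le_one_iff.2 ?_)
      have := hs.1
      have : 0 ≤ s * (2 * Real.pi) ^ 2 * t ^ 2 := by positivity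
      linarith
    · have : Continuous fun s : ℝ =>
          Complex.exp (Complex.I * (2 * Real.pi * t) ^ 3 / 3 - s * (2 * Real.pi * t) ^ 2) *
            𝓕⁻ φ t := by fun_prop
      have := (this.tendsto 0).mono_left (nhdsWithin_le_nhds (s := Set.Ioi 0))
      simpa using this
  refine tendsto_nhds_unique lim1 (lim2.congr' ?_)
  filter_upwards [hpos] with s hs using (hreg s hs.1).symm

lemma isInverseFourierTransformOf_airyAi :
    IsInverseFourierTransformOf (fun x : ℝ => airyAi x)
      (fun t : ℝ => Complex.exp (Complex.I * (2 * Real.pi * t) ^ 3 / 3)) := by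
  intro φ
  have hφ1 : Integrable fun x : ℝ => ((1 + |x| : ℝ) : ℂ) * φ x := by
    have h := (φ.integrable (μ := volume)).norm.add (φ.integrable_pow_mul volume 1)
    refine h.mono' ?_ (ae_of_all _ fun x => ?_)
    · exact (Continuous.aestronglyMeasurable (by fun_prop)).mul φ.continuous.aestronglyMeasurable
    · rw [norm_mul, Complex.norm_real, Real.norm_of_nonneg (by positivity)]
      simp [add_mul]
  have hF : Integrable (𝓕⁻ (φ : ℝ → ℂ)) := by
    rw [← SchwartzMap.fourierInv_coe]; exact (𝓕⁻ φ).integrable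
  have hcont : Continuous fun x : ℝ => airyAi x :=
    differentiable_airyAi.continuous.comp Complex.continuous_ofReal
  refine ⟨?_, ?_, ?_⟩
  · obtain ⟨C, hC, hb⟩ := exists_abs_airyR_zero_le
    refine (hφ1.norm.const_mul C).mono' (hcont.mul φ.continuous).aestronglyMeasurable
      (ae_of_all _ fun x => ?_)
    change ‖airyAi x * φ x‖ ≤ _
    rw [norm_mul, norm_mul, ← airyD_zero, ← ofReal_airyR, Complex.norm_real, Complex.norm_real,
      Real.norm_of_nonneg (by positivity : 0 ≤ 1 + |x|), ← mul_assoc]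
    gcongr
    exact hb x
  · rw [SchwartzMap.fourierInv_coe]
    refine hF.norm.mono' ?_ (ae_of_all _ fun t => ?_)
    · exact (Continuous.aestronglyMeasurable (by fun_prop)).mul hF.aestronglyMeasurable
    · have := norm_exp_cubic t 0
      simp only [Complex.ofReal_zero, zero_mul, sub_zero, neg_zero, Real.exp_zero] at this
      rw [norm_mul, this, one_mul]
  · rw [SchwartzMap.fourierInv_coe]
    exact integral_airyAi_mul φ.integrable hφ1 hF

end

noncomputable section

/-! ### Behaviour at `-∞` -/

/-- The Sonin energy `Ai² - Ai'²/x` of the Airy function. -/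
def airyEnergy (x : ℝ) : ℝ := airyR 0 x ^ 2 - airyR 1 x ^ 2 / x

/-- The cross terms cancel by the Airy equation. For `x < 0` both terms of the energy are
nonnegative, so its monotonicity controls `Ai` on the whole half line to the left of a point. -/
lemma hasDerivAt_airyEnergy {x : ℝ} (hx : x ≠ 0) :
    HasDerivAt airyEnergy (airyR 1 x ^ 2 / x ^ 2) x := by
  have h := ((hasDerivAt_airyR_zero x).pow 2).sub
    (((hasDerivAt_airyR_one x).pow 2).div (hasDerivAt_id x) hx)
  refine h.congr_deriv ?_
  simp only [id, Nat.cast_ofNat, Nat.add_one_sub_one, pow_one, Pi.pow_apply]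
  field_simp
  ring

lemma airyEnergy_mono {x y : ℝ} (hxy : x ≤ y) (hy : y < 0) : airyEnergy x ≤ airyEnergy y := by
  have : MonotoneOn airyEnergy (Set.Iio 0) := by
    refine monotoneOn_of_deriv_nonneg (convex_Iio 0)
      (fun x hx => (hasDerivAt_airyEnergy (ne_of_lt hx)).continuousAt.continuousWithinAt) ?_ ?_ <;>
    rw [interior_Iio]
    · exact fun x hx => (hasDerivAt_airyEnergy (ne_of_lt hx)).differentiableAt.differentiableWithinAt
    · intro x hx
      rw [(hasDerivAt_airyEnergy (ne_of_lt hx)).deriv]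
      positivity
  exact this (hxy.trans_lt hy) hy hxy

lemma sq_airyR_zero_le_energy {x : ℝ} (hx : x < 0) : airyR 0 x ^ 2 ≤ airyEnergy x := by
  have : airyR 1 x ^ 2 / x ≤ 0 := div_nonpos_of_nonneg_of_nonpos (sq_nonneg _) hx.le
  unfold airyEnergy; linarith

lemma airyEnergy_nonneg {x : ℝ} (hx : x < 0) : 0 ≤ airyEnergy x :=
  (sq_nonneg _).trans (sq_airyR_zero_le_energy hx)

lemma abs_airyR_zero_le_sqrt {x y : ℝ} (hxy : x ≤ y) (hy : y < 0) :
    |airyR 0 x| ≤ √(airyEnergy y) :=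
  Real.abs_le_sqrt ((sq_airyR_zero_le_energy (hxy.trans_lt hy)).trans (airyEnergy_mono hxy hy))

/-- The leading terms of the primitive of `Ai` at `-∞`, from two integrations by parts. -/
def airyBdry (x : ℝ) : ℝ := airyR 1 x / x + airyR 0 x / x ^ 2

/-- Cauchy–Schwarz for the vectors `(Ai, Ai'/√(-x))` and `(1/x², -1/√(-x))`, whose squared norms are
the energy and `1/x⁴ + 1/(-x)`; `key` is the corresponding Lagrange identity. -/
lemma abs_airyBdry_le {x : ℝ} (hx : x < 0) :
    |airyBdry x| ≤ √(airyEnergy x) * √(1 / (-x) + 1 / (-x) ^ 4) := by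
  rw [← Real.sqrt_mul (airyEnergy_nonneg hx)]
  apply Real.abs_le_sqrt
  have hx0 : x ≠ 0 := hx.ne
  have key : airyEnergy x * (1 / (-x) + 1 / (-x) ^ 4) - airyBdry x ^ 2 =
      (airyR 0 x + airyR 1 x / x ^ 2) ^ 2 / (-x) := by
    unfold airyEnergy airyBdry
    rw [show (-x) ^ 4 = x ^ 4 by ring]
    field_simp
    ring
  have : 0 ≤ (airyR 0 x + airyR 1 x / x ^ 2) ^ 2 / (-x) := div_nonneg (sq_nonneg _) (by linarith)
  linarith

/-- The remainder after two integrations by parts. -/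
def airyRem (x : ℝ) : ℝ := airyG x - airyBdry x

/-- By the Airy equation `(Ai'/x)' = Ai - Ai'/x²`, and `(Ai/x²)'` restores the last term. What is
left is `O(|x|⁻³)`. -/
lemma hasDerivAt_airyRem {x : ℝ} (hx : x ≠ 0) : HasDerivAt airyRem (2 * airyR 0 x / x ^ 3) x := by
  have h := (hasDerivAt_airyG x).sub (((hasDerivAt_airyR_one x).div (hasDerivAt_id x) hx).add
    ((hasDerivAt_airyR_zero x).div ((hasDerivAt_id x).pow 2) (pow_ne_zero 2 hx)))
  refine h.congr_deriv ?_
  simp only [id, Nat.cast_ofNat, Nat.add_one_sub_one, pow_one, Pi.pow_apply]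
  field_simp
  ring

lemma hasDerivAt_inv_sq {x : ℝ} (hx : x ≠ 0) (e : ℝ) :
    HasDerivAt (fun t => e / t ^ 2) (-(2 * e / x ^ 3)) x := by
  have h := (hasDerivAt_const x e).div ((hasDerivAt_id x).pow 2) (pow_ne_zero 2 hx)
  refine h.congr_deriv ?_
  simp only [id, Nat.cast_ofNat, Nat.add_one_sub_one, pow_one, Pi.pow_apply]
  field_simp
  ring

/-- To the left of `x` the derivative of the remainder is at most `2√E/|t|³` in size, which is the
derivative of `√E/t²` for `t < 0`. The two signs `σ = ±1` give a two-sided estimate without any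
integral. -/
lemma airyRem_add_monotoneOn {x : ℝ} (hx : x < 0) {σ : ℝ} (hσ : |σ| = 1) :
    MonotoneOn (fun t => σ * airyRem t + √(airyEnergy x) / t ^ 2) (Set.Iic x) := by
  have hd : ∀ t ∈ Set.Iic x, HasDerivAt (fun t => σ * airyRem t + √(airyEnergy x) / t ^ 2)
      (σ * (2 * airyR 0 t / t ^ 3) + -(2 * √(airyEnergy x) / t ^ 3)) t := fun t ht =>
    have ht0 : t ≠ 0 := ((Set.mem_Iic.1 ht).trans_lt hx).ne
    ((hasDerivAt_airyRem ht0).const_mul σ).add (hasDerivAt_inv_sq ht0 _)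
  refine monotoneOn_of_deriv_nonneg (convex_Iic x)
      (fun t ht => (hd t ht).continuousAt.continuousWithinAt) ?_ ?_ <;>
    rw [interior_Iic]
  · exact fun t ht => (hd t (Set.mem_Iic.2 (le_of_lt ht))).differentiableAt.differentiableWithinAt
  · intro t ht
    have htx : t ≤ x := le_of_lt ht
    rw [(hd t htx).deriv]
    have ht0 : t < 0 := htx.trans_lt hx
    have h1 : |σ * airyR 0 t| ≤ √(airyEnergy x) := by
      rw [abs_mul, hσ, one_mul]; exact abs_airyR_zero_le_sqrt htx hx
    have h2 := (abs_le.1 h1).2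
    have h3 : t ^ 3 < 0 := Odd.pow_neg (by decide) ht0
    have : σ * (2 * airyR 0 t / t ^ 3) + -(2 * √(airyEnergy x) / t ^ 3) =
      2 * (σ * airyR 0 t - √(airyEnergy x)) / t ^ 3 := by ring
    rw [this]
    exact div_nonneg_of_nonpos (by linarith) h3.le

lemma abs_airyRem_sub_le {x y : ℝ} (hyx : y ≤ x) (hx : x < 0) :
    |airyRem x - airyRem y| ≤ √(airyEnergy x) / x ^ 2 := by
  have h1 := airyRem_add_monotoneOn hx (σ := 1) (by simp) (Set.mem_Iic.2 hyx) Set.self_mem_Iic hyx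
  have h2 := airyRem_add_monotoneOn hx (σ := -1) (by simp) (Set.mem_Iic.2 hyx)
    Set.self_mem_Iic hyx
  simp only at h1 h2
  have h3 : 0 ≤ √(airyEnergy x) / y ^ 2 := by positivity
  rw [abs_le]
  constructor <;> linarith

lemma tendsto_airyBdry : Tendsto airyBdry atBot (𝓝 0) := by
  have hb : ∀ᶠ x : ℝ in atBot, ‖airyBdry x‖ ≤
      √(airyEnergy (-1)) * √(1 / (-x) + 1 / (-x) ^ 4) := by
    filter_upwards [eventually_le_atBot (-1 : ℝ)] with x hx
    refine (abs_airyBdry_le (by linarith)).trans ?_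
    gcongr
    exact airyEnergy_mono hx (by norm_num)
  refine squeeze_zero_norm' hb ?_
  have h1 : Tendsto (fun x : ℝ => 1 / (-x) + 1 / (-x) ^ 4) atBot (𝓝 (0 + 0)) := by
    refine Tendsto.add ?_ ?_
    · exact tendsto_const_nhds.div_atTop tendsto_neg_atBot_atTop
    · exact tendsto_const_nhds.div_atTop
        ((tendsto_pow_atTop (four_ne_zero) (α := ℝ)).comp tendsto_neg_atBot_atTop)
  have h2 := ((Real.continuous_sqrt.tendsto _).comp h1).const_mul (√(airyEnergy (-1)))
  simpa using h2

lemma exists_tendsto_airyG_atBot : ∃ c, Tendsto airyG atBot (𝓝 c) := by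
  set e := √(airyEnergy (-1))
  -- The truncation `min x (-1)` extends a function monotone on `(-∞, -1]` to a monotone function on
  -- the line; bounded below, it has a limit at `-∞`.
  have hmono : Monotone fun x : ℝ => airyRem (min x (-1)) + e / (min x (-1)) ^ 2 := by
    intro x y hxy
    have := airyRem_add_monotoneOn (x := -1) (by norm_num) (σ := 1) (by simp)
      (Set.mem_Iic.2 (min_le_right x (-1))) (Set.mem_Iic.2 (min_le_right y (-1)))
      (min_le_min_right (-1) hxy)
    simpa using this
  have hbdd : BddBelow (Set.range fun x : ℝ => airyRem (min x (-1)) + e / (min x (-1)) ^ 2) := by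
    refine ⟨airyRem (-1) - e, ?_⟩
    rintro _ ⟨x, rfl⟩
    have h := abs_airyRem_sub_le (min_le_right x (-1)) (by norm_num)
    norm_num at h
    have h3 : 0 ≤ e / (min x (-1)) ^ 2 := by positivity
    have := (abs_le.1 h).2
    simp only
    linarith
  have hlim := tendsto_atBot_ciInf hmono hbdd
  set c := ⨅ x : ℝ, (airyRem (min x (-1)) + e / (min x (-1)) ^ 2)
  refine ⟨c, ?_⟩
  have he : Tendsto (fun x : ℝ => e / x ^ 2) atBot (𝓝 0) := by
    have : Tendsto (fun x : ℝ => x ^ 2) atBot atTop := by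
      have := (tendsto_pow_atTop (two_ne_zero) (α := ℝ)).comp tendsto_neg_atBot_atTop
      refine this.congr fun x => by simp
    exact tendsto_const_nhds.div_atTop this
  have := (hlim.sub he).add tendsto_airyBdry
  simp only [sub_zero, add_zero] at this
  refine this.congr' ?_
  filter_upwards [eventually_le_atBot (-1 : ℝ)] with x hx
  rw [min_eq_left hx, airyRem]; ring

lemma exists_abs_airyG_le : ∃ K, 0 ≤ K ∧ ∀ x, |airyG x| ≤ K := by
  obtain ⟨C, hC, h⟩ := exists_abs_airyR_le (-1)
  set e := √(airyEnergy (-1))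
  refine ⟨(1 + C * Real.exp 1) + (|airyRem (-1)| + e + e * √2), by positivity, fun x => ?_⟩
  rcases le_total x (-1) with hx | hx
  · have h1 := abs_airyRem_sub_le hx (by norm_num)
    norm_num at h1
    have h2 : |airyBdry x| ≤ e * √2 := by
      refine (abs_airyBdry_le (by linarith)).trans ?_
      have a1 : 1 / (-x) ≤ 1 := by rw [div_le_one (by linarith)]; linarith
      have a2 : 1 / (-x) ^ 4 ≤ 1 := by
        rw [div_le_one (pow_pos (by linarith) 4)]; exact one_le_pow₀ (by linarith)
      gcongr
      · exact Real.sqrt_le_sqrt (airyEnergy_mono hx (by norm_num))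
      · linarith
    have h3 : airyG x = airyRem x + airyBdry x := by unfold airyRem; ring
    have h4 : |airyRem x| ≤ |airyRem (-1)| + e := by
      have := abs_sub_abs_le_abs_sub (airyRem x) (airyRem (-1))
      rw [abs_sub_comm] at this
      linarith
    rw [h3]
    have := abs_add_le (airyRem x) (airyBdry x)
    have : 0 ≤ C * Real.exp 1 := by positivity
    linarith
  · rw [airyG_eq]
    have h1 : |airyR (-1) x| ≤ C * Real.exp 1 :=
      (h x).trans (by gcongr; linarith)
    have h2 := abs_add_le 1 (airyR (-1) x)
    rw [abs_one] at h2
    have : 0 ≤ |airyRem (-1)| + e + e * √2 := by positivity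
    linarith

end

/-! ### Identification of the limit of `airyG` at `-∞` by Gaussian pairing -/

noncomputable section

lemma integrable_mul_exp_neg_pi_sq : Integrable fun y : ℝ => y * Real.exp (-Real.pi * y ^ 2) :=
  integrable_mul_exp_neg_mul_sq Real.pi_pos

lemma integral_Ioi_mul_exp_neg_pi_sq :
    ∫ y in Set.Ioi (0 : ℝ), 2 * Real.pi * (y * Real.exp (-Real.pi * y ^ 2)) = 1 := by
  have hd : ∀ y ∈ Set.Ici (0 : ℝ), HasDerivAt (fun y : ℝ => -Real.exp (-Real.pi * y ^ 2))
      (2 * Real.pi * (y * Real.exp (-Real.pi * y ^ 2))) y := by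
    intro y _
    have := ((((hasDerivAt_id y).pow 2).const_mul (-Real.pi)).exp).neg
    refine this.congr_deriv ?_
    simp
    ring
  have hlim : Tendsto (fun y : ℝ => -Real.exp (-Real.pi * y ^ 2)) atTop (𝓝 (-0)) := by
    refine Tendsto.neg (Real.tendsto_exp_atBot.comp ?_)
    exact (tendsto_pow_atTop (two_ne_zero) (α := ℝ)).const_mul_atTop_of_neg
      (neg_lt_zero.2 Real.pi_pos)
  rw [integral_Ioi_of_hasDerivAt_of_tendsto' hd
    (integrable_mul_exp_neg_pi_sq.const_mul _).integrableOn hlim]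
  simp

lemma integral_mul_exp_neg_pi_sq_eq_zero :
    ∫ y : ℝ, 2 * Real.pi * (y * Real.exp (-Real.pi * y ^ 2)) = 0 := by
  have h := integral_neg_eq_self (fun y : ℝ => 2 * Real.pi * (y * Real.exp (-Real.pi * y ^ 2)))
    volume
  have h2 : (fun y : ℝ => 2 * Real.pi * (-y * Real.exp (-Real.pi * (-y) ^ 2))) =
      fun y => -(2 * Real.pi * (y * Real.exp (-Real.pi * y ^ 2))) := by
    ext y; rw [neg_sq]; ring
  rw [h2, integral_neg] at h
  linarith

lemma integral_airyR_mul_gaussian {k : ℝ} (hk : 0 < k) :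
    ∫ x : ℝ, airyR 0 x * Real.exp (-Real.pi * (x / k) ^ 2) =
      ∫ y : ℝ, airyG (k * y) * (2 * Real.pi * (y * Real.exp (-Real.pi * y ^ 2))) := by
  have hsc : ∀ h : ℝ → ℝ, Integrable h → Integrable fun x => h (x / k) := fun h hh =>
    hh.comp_div hk.ne'
  have hgauss : Integrable fun x : ℝ => Real.exp (-Real.pi * (x / k) ^ 2) :=
    hsc _ (integrable_exp_neg_mul_sq Real.pi_pos)
  have hgauss1 : Integrable fun x : ℝ => x / k * Real.exp (-Real.pi * (x / k) ^ 2) :=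
    hsc _ integrable_mul_exp_neg_pi_sq
  obtain ⟨K, hK, hG⟩ := exists_abs_airyG_le
  obtain ⟨C, hC, hA⟩ := exists_abs_airyR_zero_le
  have hd : ∀ x : ℝ, HasDerivAt (fun x : ℝ => Real.exp (-Real.pi * (x / k) ^ 2))
      (-(2 * Real.pi / k) * (x / k * Real.exp (-Real.pi * (x / k) ^ 2))) x := by
    intro x
    have := ((((hasDerivAt_id x).div_const k).pow 2).const_mul (-Real.pi)).exp
    refine this.congr_deriv ?_
    simp
    ring
  have hibp := integral_mul_deriv_eq_deriv_mul_of_integrable (u := airyG)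
    (u' := airyR 0) (v := fun x : ℝ => Real.exp (-Real.pi * (x / k) ^ 2))
    (v' := fun x => -(2 * Real.pi / k) * (x / k * Real.exp (-Real.pi * (x / k) ^ 2)))
    (fun x _ => hasDerivAt_airyG x) (fun x _ => hd x) ?_ ?_ ?_
  · rw [← neg_eq_iff_eq_neg] at hibp
    rw [← hibp, ← integral_neg]
    have := Measure.integral_comp_div (fun y => airyG (k * y) *
      (2 * Real.pi / k * (y * Real.exp (-Real.pi * y ^ 2)))) k
    rw [abs_of_pos hk, smul_eq_mul, ← integral_const_mul] at this
    refine Eq.trans ?_ (this.trans ?_)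
    · refine integral_congr_ae (ae_of_all _ fun x => ?_)
      simp only [mul_div_cancel₀ x hk.ne']
      ring
    · refine integral_congr_ae (ae_of_all _ fun x => ?_)
      simp only
      field_simp
  · exact (hgauss1.const_mul _).bdd_mul continuous_airyG.aestronglyMeasurable
      (ae_of_all _ hG)
  · refine ((hgauss.norm.add (hgauss1.norm.const_mul k)).const_mul C).mono'
      ((continuous_airyR 0).mul (by fun_prop)).aestronglyMeasurable (ae_of_all _ fun x => ?_)
    simp only [Pi.mul_apply, Pi.add_apply, norm_mul, Real.norm_eq_abs, abs_div, abs_of_pos hk]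
    calc _ ≤ C * (1 + |x|) * |Real.exp (-Real.pi * (x / k) ^ 2)| := by gcongr; exact hA x
      _ = _ := by field_simp
  · exact hgauss.bdd_mul continuous_airyG.aestronglyMeasurable (ae_of_all _ hG)

lemma integral_airyR_mul_gaussian_fourier {k : ℝ} (hk : 0 < k) :
    ((∫ x : ℝ, airyR 0 x * Real.exp (-Real.pi * (x / k) ^ 2) : ℝ) : ℂ) =
      ∫ u : ℝ, Complex.exp (Complex.I * (2 * Real.pi * (u / k)) ^ 3 / 3) *
        Complex.exp (-Real.pi * u ^ 2) := by
  have hkc : (k : ℂ) ≠ 0 := by exact_mod_cast hk.ne'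
  set φ : ℝ → ℂ := fun x => Complex.exp (-Real.pi * ((k ^ 2)⁻¹ : ℂ) * x ^ 2) with hφdef
  have hre : 0 < ((k ^ 2)⁻¹ : ℂ).re := by
    rw [show ((k ^ 2)⁻¹ : ℂ) = (((k ^ 2)⁻¹ : ℝ) : ℂ) by push_cast; rfl, Complex.ofReal_re]
    positivity
  have hφr : ∀ x : ℝ, φ x = (Real.exp (-Real.pi * (x / k) ^ 2) : ℝ) := by
    intro x
    simp only [hφdef]
    push_cast
    congr 1
    field_simp
  have hF : 𝓕⁻ φ = fun t : ℝ => (k : ℂ) * Complex.exp (-Real.pi * (k * t) ^ 2) := by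
    ext t
    rw [Real.fourierInv_eq_fourier_neg, hφdef, fourier_gaussian_pi hre]
    have h1 : ((k ^ 2)⁻¹ : ℂ) ^ (1 / 2 : ℂ) = (k : ℂ)⁻¹ := by
      rw [show ((k ^ 2)⁻¹ : ℂ) = (((k⁻¹) ^ 2 : ℝ) : ℂ) by push_cast; rw [inv_pow],
        show (1 / 2 : ℂ) = ((1 / 2 : ℝ) : ℂ) by push_cast; rfl,
        ← Complex.ofReal_cpow (by positivity), ← Real.sqrt_eq_rpow,
        Real.sqrt_sq (by positivity)]
      push_cast; rfl
    simp only [h1]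
    rw [one_div, inv_inv]
    congr 2
    push_cast
    field_simp
  have hgauss : Integrable fun x : ℝ => Real.exp (-Real.pi * (x / k) ^ 2) :=
    (integrable_exp_neg_mul_sq Real.pi_pos).comp_div hk.ne'
  have hgauss1 : Integrable fun x : ℝ => x / k * Real.exp (-Real.pi * (x / k) ^ 2) :=
    integrable_mul_exp_neg_pi_sq.comp_div hk.ne'
  have hφi : Integrable φ := by
    rw [show φ = fun x => ((Real.exp (-Real.pi * (x / k) ^ 2) : ℝ) : ℂ) from funext hφr]
    exact hgauss.ofReal
  have hmain := integral_airyAi_mul hφi ?_ ?_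
  · rw [hF] at hmain
    have hl : ∫ x : ℝ, airyAi x * φ x =
        ((∫ x : ℝ, airyR 0 x * Real.exp (-Real.pi * (x / k) ^ 2) : ℝ) : ℂ) := by
      rw [← integral_complex_ofReal]
      congr 1 with x
      rw [hφr, ← airyD_zero, ← ofReal_airyR]
      push_cast; rfl
    rw [← hl, hmain]
    have := Measure.integral_comp_mul_left (fun u : ℝ =>
      Complex.exp (Complex.I * (2 * Real.pi * (u / k)) ^ 3 / 3) * Complex.exp (-Real.pi * u ^ 2)) k
    rw [abs_of_pos (inv_pos.2 hk), Complex.real_smul, Complex.ofReal_inv,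
      eq_inv_mul_iff_mul_eq₀ hkc, ← integral_const_mul] at this
    rw [← this]
    congr 1 with t
    push_cast
    rw [mul_div_cancel_left₀ _ hkc]
    ring
  · have : Integrable fun x : ℝ => (1 + |x|) * Real.exp (-Real.pi * (x / k) ^ 2) := by
      refine (hgauss.norm.add (hgauss1.norm.const_mul k)).mono'
        (Continuous.aestronglyMeasurable (by fun_prop)) (ae_of_all _ fun x => ?_)
      simp only [Pi.add_apply, norm_mul, Real.norm_eq_abs, abs_div, abs_of_pos hk,
        abs_of_nonneg (by positivity : 0 ≤ 1 + |x|)]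
      apply le_of_eq; field_simp
    refine (this.ofReal (𝕜 := ℂ)).congr (ae_of_all _ fun x => ?_)
    beta_reduce
    rw [hφr]
    exact Complex.ofReal_mul _ _
  · rw [hF]
    have h := (integrable_exp_neg_mul_sq Real.pi_pos).comp_mul_left' hk.ne'
    refine ((h.ofReal (𝕜 := ℂ)).const_mul (k : ℂ)).congr (ae_of_all _ fun x => ?_)
    simp

/-- The integral of `Ai` against `e^{-π(x/k)²}` is computed in two ways as `k → ∞`. On the Fourier
side the cubic phase tends to `1` and the limit is `1`; after an integration by parts `G(ky)` tends
to `1` or to its limit `c` at `-∞` according to the sign of `y`, and the limit is `1 - c`. -/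
lemma tendsto_airyG_atBot : Tendsto airyG atBot (𝓝 0) := by
  obtain ⟨c, hc⟩ := exists_tendsto_airyG_atBot
  obtain ⟨K, hK, hG⟩ := exists_abs_airyG_le
  set h : ℝ → ℝ := fun y => 2 * Real.pi * (y * Real.exp (-Real.pi * y ^ 2)) with hh
  have hhi : Integrable h := integrable_mul_exp_neg_pi_sq.const_mul _
  -- The limit of `G(k·)`, a step function with values `c` and `1`, is written as `c` plus `1 - c`
  -- times the indicator of the positive half line, because `h` has total integral `0` and integral
  -- `1` over `(0, ∞)`.
  have lim1 : Tendsto (fun k : ℝ => ∫ y : ℝ, airyG (k * y) * h y) atTop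
      (𝓝 (∫ y : ℝ, (c * h y + (1 - c) * (Set.Ioi 0).indicator h y))) := by
    refine tendsto_integral_filter_of_dominated_convergence (fun y => K * ‖h y‖) ?_ ?_
      (hhi.norm.const_mul K) ?_
    · exact Eventually.of_forall fun k => (continuous_airyG.comp (by fun_prop)).aestronglyMeasurable.mul
        hhi.aestronglyMeasurable
    · refine Eventually.of_forall fun k => ae_of_all _ fun y => ?_
      rw [norm_mul]
      gcongr
      exact hG _
    · refine ae_of_all _ fun y => ?_
      rcases lt_trichotomy y 0 with hy | hy | hy
      · rw [Set.indicator_of_notMem (by simpa using hy.le), mul_zero, add_zero]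
        exact (hc.comp (tendsto_id.atTop_mul_const_of_neg hy)).mul_const _
      · subst hy; simp [hh]
      · rw [Set.indicator_of_mem (by simpa using hy), ← add_mul, add_sub_cancel]
        exact (tendsto_airyG_atTop.comp (tendsto_id.atTop_mul_const hy)).mul_const _
  have hval : ∫ y : ℝ, (c * h y + (1 - c) * (Set.Ioi 0).indicator h y) = 1 - c := by
    rw [integral_add (hhi.const_mul _) ((hhi.indicator measurableSet_Ioi).const_mul _),
      integral_const_mul c, integral_const_mul (1 - c), integral_indicator measurableSet_Ioi,
      integral_mul_exp_neg_pi_sq_eq_zero, integral_Ioi_mul_exp_neg_pi_sq]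
    ring
  have hg : Integrable fun u : ℝ => Complex.exp (-Real.pi * u ^ 2) := by
    refine (integrable_exp_neg_mul_sq Real.pi_pos).ofReal.congr (ae_of_all _ fun x => ?_)
    simp
  have lim2 : Tendsto (fun k : ℝ => ∫ u : ℝ,
      Complex.exp (Complex.I * (2 * Real.pi * (u / k)) ^ 3 / 3) * Complex.exp (-Real.pi * u ^ 2))
      atTop (𝓝 (∫ u : ℝ, Complex.exp (-Real.pi * u ^ 2))) := by
    refine tendsto_integral_filter_of_dominated_convergence
      (fun u => ‖Complex.exp (-Real.pi * u ^ 2)‖) ?_ ?_ hg.norm ?_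
    · exact Eventually.of_forall fun k => Continuous.aestronglyMeasurable (by fun_prop)
    · refine Eventually.of_forall fun k => ae_of_all _ fun u => ?_
      rw [norm_mul, show (Complex.I * (2 * Real.pi * (u / k)) ^ 3 / 3 : ℂ) =
        (((2 * Real.pi * (u / k)) ^ 3 / 3 : ℝ) : ℂ) * Complex.I by push_cast; ring,
        Complex.norm_exp_ofReal_mul_I, one_mul]
    · refine ae_of_all _ fun u => ?_
      have h0 : Tendsto (fun k : ℝ => u / k) atTop (𝓝 0) := tendsto_const_nhds.div_atTop tendsto_id
      have hcont : Continuous fun q : ℝ => Complex.exp (Complex.I * (2 * Real.pi * q) ^ 3 / 3) *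
        Complex.exp (-Real.pi * u ^ 2) := by fun_prop
      have := (hcont.tendsto 0).comp h0
      simpa [Function.comp_def] using this
  have hval2 : ∫ u : ℝ, Complex.exp (-Real.pi * u ^ 2) = 1 := by
    have h1 : ∀ u : ℝ, Complex.exp (-Real.pi * u ^ 2) = (Real.exp (-Real.pi * u ^ 2) : ℝ) := by
      intro u; push_cast; rfl
    simp_rw [h1]
    rw [integral_complex_ofReal, integral_gaussian, div_self Real.pi_ne_zero, Real.sqrt_one]
    simp
  rw [hval] at lim1
  rw [hval2] at lim2
  have hcong : ∀ᶠ k : ℝ in atTop, (∫ u : ℝ,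
      Complex.exp (Complex.I * (2 * Real.pi * (u / k)) ^ 3 / 3) * Complex.exp (-Real.pi * u ^ 2)) =
      ((∫ y : ℝ, airyG (k * y) * h y : ℝ) : ℂ) := by
    filter_upwards [eventually_gt_atTop 0] with k hk
    rw [← integral_airyR_mul_gaussian hk, integral_airyR_mul_gaussian_fourier hk]
  have lim3 := (Complex.continuous_ofReal.tendsto _).comp lim1
  have := tendsto_nhds_unique (lim2.congr' hcong) lim3
  have h1 : (1 : ℝ) = 1 - c := by exact_mod_cast this
  have : c = 0 := by linarith
  rwa [this] at hc

lemma tendsto_integral_airyAi_atBot (η : ℝ) :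
    Tendsto (fun R : ℝ => ∫ ξ in R..η, (airyAi ξ).re) atBot (𝓝 (airyG η)) := by
  have : ∀ R, ∫ ξ in R..η, (airyAi ξ).re = airyG η - airyG R := by
    intro R
    refine intervalIntegral.integral_eq_sub_of_hasDerivAt (fun y _ => ?_) ?_
    · rw [← airyR_zero]; exact hasDerivAt_airyG y
    · simp_rw [← airyR_zero]; exact (continuous_airyR 0).intervalIntegrable _ _
  simp_rw [this]
  simpa using tendsto_airyG_atBot.const_sub (airyG η)

/-- An explicit bound for the decay of `airyG` at `-∞`. -/
lemma abs_airyG_le_of_le {x y : ℝ} (hxy : x ≤ y) (hy : y < 0) :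
    |airyG x| ≤ √(airyEnergy y) * (√(1 / (-y) + 1 / (-y) ^ 4) + 1 / y ^ 2) := by
  have hx : x < 0 := hxy.trans_lt hy
  have hrem : |airyRem x| ≤ √(airyEnergy x) / x ^ 2 := by
    have hlim : Tendsto airyRem atBot (𝓝 0) := by
      have := tendsto_airyG_atBot.sub tendsto_airyBdry
      rwa [sub_zero] at this
    have h2 : Tendsto (fun t => |airyRem x - airyRem t|) atBot (𝓝 |airyRem x - 0|) :=
      (hlim.const_sub _).abs
    rw [sub_zero] at h2
    refine le_of_tendsto h2 ?_
    filter_upwards [eventually_le_atBot x] with t ht using abs_airyRem_sub_le ht hx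
  have hG : airyG x = airyBdry x + airyRem x := by unfold airyRem; ring
  have hE := Real.sqrt_le_sqrt (airyEnergy_mono hxy hy)
  have h4 : (-y) ^ 4 ≤ (-x) ^ 4 := pow_le_pow_left₀ (by linarith) (by linarith) 4
  have h2 : y ^ 2 ≤ x ^ 2 := by nlinarith
  have hy4 : 0 < (-y) ^ 4 := pow_pos (by linarith) 4
  have hy2 : 0 < y ^ 2 := by nlinarith
  calc |airyG x| ≤ |airyBdry x| + |airyRem x| := by rw [hG]; exact abs_add_le _ _
    _ ≤ √(airyEnergy x) * √(1 / (-x) + 1 / (-x) ^ 4) + √(airyEnergy x) / x ^ 2 :=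
        add_le_add (abs_airyBdry_le hx) hrem
    _ = √(airyEnergy x) * (√(1 / (-x) + 1 / (-x) ^ 4) + 1 / x ^ 2) := by ring
    _ ≤ _ := by
      gcongr
      linarith

end

noncomputable section

/-! ### Taylor expansion at the origin -/

lemma iteratedDeriv_airyD (n : ℤ) (k : ℕ) : iteratedDeriv k (airyD n) = airyD (n + k) := by
  induction k with
  | zero => simp
  | succ k ih =>
    rw [iteratedDeriv_succ, ih]
    ext z
    rw [(hasDerivAt_airyD (n + k) z).deriv]
    push_cast
    rw [add_assoc]

lemma airyD_recurrence (k : ℕ) (z : ℂ) :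
    airyD (k + 2) z = z * airyD k z + k * airyD (k - 1) z := by
  induction k generalizing z with
  | zero => simpa [airyD_zero] using airyD_two z
  | succ k ih =>
    have h1 := hasDerivAt_airyD (k + 2) z
    have h2 : HasDerivAt (airyD (k + 2))
        (1 * airyD k z + z * airyD (k + 1) z + k * airyD (k - 1 + 1) z) z := by
      rw [show airyD (k + 2) = fun z => z * airyD k z + k * airyD (k - 1) z from funext ih]
      exact ((hasDerivAt_id z).mul (hasDerivAt_airyD k z)).add
        ((hasDerivAt_airyD (k - 1) z).const_mul _)
    have h3 := h1.unique h2
    rw [show ((k + 1 : ℕ) : ℤ) + 2 = k + 2 + 1 by push_cast; ring, h3]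
    push_cast
    simp only [sub_add_cancel, add_sub_cancel_right]
    ring

/-- Differentiate the Airy equation `m + 1` times at `0`. For `m = -1` the coefficient is zero, in
accordance with `Ai''(0) = 0`. -/
lemma airyR_recurrence {m : ℤ} (hm : -1 ≤ m) : airyR (m + 3) 0 = (m + 1) * airyR m 0 := by
  obtain ⟨k, hk⟩ := Int.eq_ofNat_of_zero_le (by linarith : 0 ≤ m + 1)
  have h := airyD_recurrence k (0 : ℝ)
  have e1 : (k : ℤ) + 2 = m + 3 := by omega
  have e2 : (k : ℤ) - 1 = m := by omega
  rw [e1, e2, Complex.ofReal_zero, zero_mul, zero_add] at h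
  have e3 : (k : ℝ) = m + 1 := by exact_mod_cast hk.symm
  rw [airyR, airyR, Complex.ofReal_zero, h, ← e3, ← Complex.ofReal_natCast, Complex.re_ofReal_mul]

/-- The Taylor terms of `airyR n` at the origin. -/
def airyTerm (n : ℤ) (x : ℝ) (k : ℕ) : ℝ := x ^ k / k.factorial * airyR (n + k) 0

lemma hasSum_airyTerm (n : ℤ) (x : ℝ) : HasSum (airyTerm n x) (airyR n x) := by
  have h := Complex.hasSum_taylorSeries_of_entire
    (f := airyD n) (fun z => (hasDerivAt_airyD n z).differentiableAt) 0 x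
  have h2 := Complex.hasSum_re h
  rw [airyR]
  refine h2.congr_fun fun k => ?_
  rw [iteratedDeriv_airyD, airyTerm, airyR, smul_eq_mul, smul_eq_mul, sub_zero,
    Complex.ofReal_zero, ← mul_assoc]
  rw [show ((k.factorial : ℂ)⁻¹ * (x : ℂ) ^ k) = ((x ^ k / k.factorial : ℝ) : ℂ) by
    push_cast; ring, Complex.re_ofReal_mul]

/-- The recurrence links derivatives three orders apart, so within each residue class modulo `3` the
terms are multiples of a single value at the origin. -/
lemma airyR_eq_tsum (n : ℤ) (x : ℝ) :
    airyR n x = ∑' j : ℕ, airyTerm n x (3 * j) + ∑' j : ℕ, airyTerm n x (1 + 3 * j) +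
      ∑' j : ℕ, airyTerm n x (2 + 3 * j) := by
  have h := hasSum_airyTerm n x
  rw [← h.tsum_eq, Nat.sumByResidueClasses h.summable 3]
  have := Fin.sum_univ_three (fun j : ZMod 3 => ∑' m, airyTerm n x (j.val + 3 * m))
  refine this.trans ?_
  congr 3
  · congr 1 with j; exact congrArg _ (zero_add _)

/-- The ratio of consecutive Taylor terms in the residue class of `r` modulo 3. -/
def airyRatio (n : ℤ) (r : ℕ) (x : ℝ) (j : ℕ) : ℝ :=
  x ^ 3 * (n + r + 3 * j + 1) / ((r + 3 * j + 1) * (r + 3 * j + 2) * (r + 3 * j + 3))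

lemma airyTerm_succ {n : ℤ} (hn : -1 ≤ n) (r : ℕ) (x : ℝ) (j : ℕ) :
    airyTerm n x (r + 3 * (j + 1)) = airyRatio n r x j * airyTerm n x (r + 3 * j) := by
  have hrec := airyR_recurrence (m := n + ((r + 3 * j : ℕ) : ℤ)) (by omega)
  rw [show n + ((r + 3 * j : ℕ) : ℤ) + 3 = n + ((r + 3 * (j + 1) : ℕ) : ℤ) by push_cast; ring]
    at hrec
  rw [airyTerm, airyTerm, hrec, show r + 3 * (j + 1) = r + 3 * j + 1 + 1 + 1 by ring, airyRatio,
    Nat.factorial_succ, Nat.factorial_succ, Nat.factorial_succ]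
  have : ((r + 3 * j).factorial : ℝ) ≠ 0 := by positivity
  push_cast
  have h1 : (r : ℝ) + 3 * j + 1 ≠ 0 := by positivity
  have h2 : (r : ℝ) + 3 * j + 1 + 1 ≠ 0 := by positivity
  have h3 : (r : ℝ) + 3 * j + 1 + 1 + 1 ≠ 0 := by positivity
  have h2' : (r : ℝ) + 3 * j + 2 ≠ 0 := by positivity
  have h3' : (r : ℝ) + 3 * j + 3 ≠ 0 := by positivity
  field_simp
  ring

lemma abs_airyRatio_le {n : ℤ} (hn : -1 ≤ n) (hn1 : n ≤ 1) (r : ℕ) (x : ℝ) {N j : ℕ} (hj : N ≤ j)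
    (hN : 2 * |x| ^ 3 ≤ (3 * N + 1) * (3 * N + 2)) : |airyRatio n r x j| ≤ 1 / 2 := by
  have hn' : (-1 : ℝ) ≤ n := by exact_mod_cast hn
  have hn1' : (n : ℝ) ≤ 1 := by exact_mod_cast hn1
  have hj' : (N : ℝ) ≤ j := by exact_mod_cast hj
  have hr : (0 : ℝ) ≤ r := by positivity
  have hN0 : (0 : ℝ) ≤ N := by positivity
  have hnum : 0 ≤ (n : ℝ) + r + 3 * j + 1 := by linarith
  rw [airyRatio, abs_div, abs_mul, abs_pow, abs_of_nonneg hnum,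
    abs_of_pos (by positivity : 0 < ((r : ℝ) + 3 * j + 1) * (r + 3 * j + 2) * (r + 3 * j + 3)),
    div_le_iff₀ (by positivity)]
  have h1 : (3 * (N : ℝ) + 1) * (3 * N + 2) ≤ (r + 3 * j + 1) * (r + 3 * j + 2) := by
    gcongr <;> linarith
  have h2 : (n : ℝ) + r + 3 * j + 1 ≤ r + 3 * j + 3 := by linarith
  calc |x| ^ 3 * (n + r + 3 * j + 1)
      ≤ (((r + 3 * j + 1) * (r + 3 * j + 2)) / 2) * (r + 3 * j + 3) := by gcongr; linarith
    _ = _ := by ring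

/-- The nested form `1 + q j (1 + q (j+1) (1 + ⋯))` with `N` summands. -/
def nestedSum (q : ℕ → ℝ) : ℕ → ℕ → ℝ
  | 0, _ => 0
  | N + 1, j => 1 + q j * nestedSum q N (j + 1)

lemma sum_range_eq_nestedSum {t q : ℕ → ℝ} (h : ∀ j, t (j + 1) = q j * t j) (N j : ℕ) :
    ∑ i ∈ Finset.range N, t (j + i) = t j * nestedSum q N j := by
  induction N generalizing j with
  | zero => simp [nestedSum]
  | succ N ih =>
    rw [Finset.sum_range_succ', nestedSum]
    have : ∀ i, t (j + (i + 1)) = t (j + 1 + i) := fun i => by congr 1; ring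
    simp_rw [this]
    rw [ih, h, add_zero]
    ring

/-- The product `q j * q (j+1) * ⋯` of `N` factors. -/
def nestedProd (q : ℕ → ℝ) : ℕ → ℕ → ℝ
  | 0, _ => 1
  | N + 1, j => q j * nestedProd q N (j + 1)

lemma eq_mul_nestedProd {t q : ℕ → ℝ} (h : ∀ j, t (j + 1) = q j * t j) (N j : ℕ) :
    t (j + N) = t j * nestedProd q N j := by
  induction N generalizing j with
  | zero => simp [nestedProd]
  | succ N ih =>
    rw [nestedProd, show j + (N + 1) = j + 1 + N by ring, ih, h]
    ring

/-- From index `N` on the terms at least halve, so the tail is at most twice its first term. -/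
lemma abs_tsum_sub_nestedSum_le {t q : ℕ → ℝ} (h : ∀ j, t (j + 1) = q j * t j) (hs : Summable t)
    {N : ℕ} (hq : ∀ j, N ≤ j → |q j| ≤ 1 / 2) :
    |∑' j, t j - t 0 * nestedSum q N 0| ≤ 2 * |t 0 * nestedProd q N 0| := by
  have h1 := sum_range_eq_nestedSum h N 0
  have h2 := eq_mul_nestedProd h N 0
  simp only [zero_add] at h1 h2
  rw [← h1, ← h2, ← hs.sum_add_tsum_nat_add N, add_sub_cancel_left]
  have hb : ∀ i : ℕ, ‖t (i + N)‖ ≤ |t N| * (1 / 2) ^ i := by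
    intro i
    induction i with
    | zero => simp
    | succ i ih =>
      rw [show i + 1 + N = i + N + 1 by ring, h, norm_mul, pow_succ]
      calc ‖q (i + N)‖ * ‖t (i + N)‖ ≤ 1 / 2 * (|t N| * (1 / 2) ^ i) := by
            gcongr
            exact hq _ (by omega)
        _ = _ := by ring
  have := tsum_of_norm_bounded (hasSum_geometric_two.mul_left |t N|) hb
  rw [mul_comm]
  exact this

lemma summable_airyTerm_residue (n : ℤ) (x : ℝ) (r : ℕ) :
    Summable fun j => airyTerm n x (r + 3 * j) :=
  (hasSum_airyTerm n x).summable.comp_injective fun a b hab => by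
    have : r + 3 * a = r + 3 * b := hab
    omega

lemma airyTerm_series_bound {n : ℤ} (hn : -1 ≤ n) (hn1 : n ≤ 1) (r : ℕ) (x : ℝ) {N : ℕ}
    (hN : 2 * |x| ^ 3 ≤ (3 * N + 1) * (3 * N + 2)) :
    |∑' j, airyTerm n x (r + 3 * j) - airyTerm n x r * nestedSum (airyRatio n r x) N 0| ≤
      2 * |airyTerm n x r * nestedProd (airyRatio n r x) N 0| := by
  have := abs_tsum_sub_nestedSum_le (t := fun j => airyTerm n x (r + 3 * j))
    (airyTerm_succ hn r x) (summable_airyTerm_residue n x r)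
    (fun j hj => abs_airyRatio_le hn hn1 r x hj hN)
  simpa using this

lemma tsum_airyTerm_eq_zero {n : ℤ} (hn : -1 ≤ n) (r : ℕ) (x : ℝ) (h : airyR (n + r) 0 = 0) :
    ∑' j, airyTerm n x (r + 3 * j) = 0 := by
  have : ∀ j, airyTerm n x (r + 3 * j) = 0 := by
    intro j
    induction j with
    | zero => simp [airyTerm, h]
    | succ j ih => rw [airyTerm_succ hn, ih, mul_zero]
  simp [this]

lemma airyR_two_zero : airyR 2 0 = 0 := by rw [airyR_two, zero_mul]

lemma airyR_three_zero : airyR 3 0 = airyR 0 0 := by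
  simpa using airyR_recurrence (m := 0) (by norm_num)

lemma exp_third_le : Real.exp (1 / 3) ≤ 2 := by
  have h := Real.exp_one_lt_d9
  have h3 : Real.exp (1 / 3) ^ 3 = Real.exp 1 := by rw [← Real.exp_nat_mul]; norm_num
  by_contra hc
  push Not at hc
  have : 2 ^ 3 < Real.exp (1 / 3) ^ 3 := by gcongr
  linarith

lemma abs_airyR_zero_zero_le : |airyR 0 0| ≤ 1 := by
  refine (abs_airyR_zero_le one_pos 0).trans ?_
  rw [div_le_one (by positivity), div_one]
  norm_num
  have h2 : √Real.pi ≤ Real.pi :=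
    Real.sqrt_le_iff.2 ⟨Real.pi_pos.le, by nlinarith [Real.pi_gt_three]⟩
  exact mul_le_mul exp_third_le h2 (by positivity) (by norm_num)

lemma abs_airyR_one_le (x : ℝ) : |airyR 1 x| ≤ Real.exp (-x) := by
  rw [abs_airyR_eq one_pos, div_le_iff₀ (by positivity)]
  refine (integral_gaussian_le (K := Real.exp (1 / 3) * Real.exp (-x)) (s := 1 / 2) (by norm_num)
    fun t => ?_).trans ?_
  · rw [norm_airyKernel_real, zpow_one]
    -- Half of the Gaussian is spent on the factor `|t + i| = √(1 + t²) ≤ e^{t²/2}`.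
    have h1 : ‖(t : ℂ) + (1 : ℝ) * Complex.I‖ ≤ Real.exp (t ^ 2 / 2) := by
      refine abs_le_of_sq_le_sq' ?_ (Real.exp_pos _).le |>.2
      rw [← Complex.normSq_eq_norm_sq, ← Real.exp_nat_mul]
      have := Real.add_one_le_exp (t ^ 2)
      simp only [Complex.normSq_apply]
      simp
      rw [mul_div_cancel₀ _ (two_ne_zero)]
      nlinarith
    calc _ ≤ Real.exp (t ^ 2 / 2) *
          (Real.exp (1 ^ 3 / 3 - 1 * x) * Real.exp (-1 * t ^ 2)) := by gcongr
      _ = _ := by simp only [← Real.exp_add]; ring_nf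
  · have h2 : √(Real.pi / (1 / 2)) ≤ Real.pi :=
      Real.sqrt_le_iff.2 ⟨Real.pi_pos.le, by nlinarith [Real.pi_gt_three]⟩
    calc _ ≤ 2 * Real.exp (-x) * Real.pi := by gcongr; exact exp_third_le
      _ = _ := by ring

lemma abs_airyR_one_zero_le : |airyR 1 0| ≤ 1 := by
  simpa using abs_airyR_one_le 0

/-- `c` is one of the unknown numbers `Ai(0)`, `Ai'(0)`, and `H` a decimal rounding of the partial
sum `h`. The rough bound `|c| ≤ 1` makes both errors absolute, before `c` is known precisely. -/
lemma abs_sub_mul_le {S c h H p ε : ℝ} (hc : |c| ≤ 1) (hS : |S - c * h| ≤ 2 * |c * p|)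
    (hε : |h - H| + 2 * |p| ≤ ε) : |S - c * H| ≤ ε := by
  have h1 : |S - c * H| ≤ |S - c * h| + |c * (h - H)| := by
    rw [show S - c * H = (S - c * h) + c * (h - H) by ring]; exact abs_add_le _ _
  rw [abs_mul] at h1 hS
  have h2 : |c| * |h - H| ≤ |h - H| := mul_le_of_le_one_left (abs_nonneg _) hc
  have h3 : |c| * |p| ≤ |p| := mul_le_of_le_one_left (abs_nonneg _) hc
  linarith

/-- Numerical evaluation of `Ai` from its values at the origin. -/
lemma abs_airyR_zero_sub_le {x H0 H1 ε : ℝ} (N : ℕ)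
    (hN : 2 * |x| ^ 3 ≤ (3 * N + 1) * (3 * N + 2))
    (h0 : |nestedSum (airyRatio 0 0 x) N 0 - H0| + 2 * |nestedProd (airyRatio 0 0 x) N 0| ≤ ε)
    (h1 : |x * nestedSum (airyRatio 0 1 x) N 0 - H1| +
      2 * |x * nestedProd (airyRatio 0 1 x) N 0| ≤ ε) :
    |airyR 0 x - (airyR 0 0 * H0 + airyR 1 0 * H1)| ≤ 2 * ε := by
  have b0 := airyTerm_series_bound (n := 0) (by norm_num) (by norm_num) 0 x hN
  have b1 := airyTerm_series_bound (n := 0) (by norm_num) (by norm_num) 1 x hN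
  have b2 := tsum_airyTerm_eq_zero (n := 0) (by norm_num) 2 x (by simpa using airyR_two_zero)
  have e0 : airyTerm 0 x 0 = airyR 0 0 := by simp [airyTerm]
  have e1 : airyTerm 0 x 1 = airyR 1 0 * x := by simp [airyTerm, mul_comm]
  rw [e0] at b0
  rw [e1, mul_assoc, mul_assoc] at b1
  have c0 := abs_sub_mul_le abs_airyR_zero_zero_le b0 h0
  have c1 := abs_sub_mul_le abs_airyR_one_zero_le b1 h1
  rw [airyR_eq_tsum 0 x, b2]
  simp only [zero_add] at c0
  rw [abs_le] at *
  constructor <;> linarith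

/-- Numerical evaluation of the primitive of `Ai` from the values of `Ai` at the origin. -/
lemma abs_airyR_neg_one_sub_le {x H0 H1 ε : ℝ} (N : ℕ)
    (hN : 2 * |x| ^ 3 ≤ (3 * N + 1) * (3 * N + 2))
    (h0 : |x * nestedSum (airyRatio (-1) 1 x) N 0 - H0| +
      2 * |x * nestedProd (airyRatio (-1) 1 x) N 0| ≤ ε)
    (h1 : |x ^ 2 / 2 * nestedSum (airyRatio (-1) 2 x) N 0 - H1| +
      2 * |x ^ 2 / 2 * nestedProd (airyRatio (-1) 2 x) N 0| ≤ ε) :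
    |airyR (-1) x - (-(1 / 3) + airyR 0 0 * H0 + airyR 1 0 * H1)| ≤ 2 * ε := by
  have b0 := airyTerm_series_bound (n := -1) (by norm_num) (by norm_num) 1 x hN
  have b1 := airyTerm_series_bound (n := -1) (by norm_num) (by norm_num) 2 x hN
  -- For `n = -1` and `r = 0` the first ratio vanishes, so only the constant term `-1/3` survives.
  have b2 : ∑' j, airyTerm (-1) x (3 * j) = -(1 / 3) := by
    rw [tsum_eq_single 0]
    · simp [airyTerm, airyR_neg_one_zero]
    · intro j hj
      obtain ⟨k, rfl⟩ := Nat.exists_eq_succ_of_ne_zero hj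
      clear hj
      induction k with
      | zero =>
        have := airyTerm_succ (n := -1) le_rfl 0 x 0
        simpa [airyRatio] using this
      | succ k ih =>
        have := airyTerm_succ (n := -1) le_rfl 0 x (k + 1)
        rw [zero_add, zero_add, ih, mul_zero] at this
        exact this
  have e0 : airyTerm (-1) x 1 = airyR 0 0 * x := by simp [airyTerm, mul_comm]
  have e1 : airyTerm (-1) x 2 = airyR 1 0 * (x ^ 2 / 2) := by
    simp [airyTerm, mul_comm, Nat.factorial]
  rw [e0, mul_assoc, mul_assoc] at b0
  rw [e1, mul_assoc, mul_assoc] at b1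
  have c0 := abs_sub_mul_le abs_airyR_zero_zero_le b0 h0
  have c1 := abs_sub_mul_le abs_airyR_one_zero_le b1 h1
  rw [airyR_eq_tsum (-1) x, b2]
  rw [abs_le] at *
  constructor <;> linarith

/-- Numerical evaluation of `Ai'` from the values of `Ai` at the origin. -/
lemma abs_airyR_one_sub_le {x H0 H1 ε : ℝ} (N : ℕ)
    (hN : 2 * |x| ^ 3 ≤ (3 * N + 1) * (3 * N + 2))
    (h0 : |x ^ 2 / 2 * nestedSum (airyRatio 1 2 x) N 0 - H0| +
      2 * |x ^ 2 / 2 * nestedProd (airyRatio 1 2 x) N 0| ≤ ε)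
    (h1 : |nestedSum (airyRatio 1 0 x) N 0 - H1| +
      2 * |nestedProd (airyRatio 1 0 x) N 0| ≤ ε) :
    |airyR 1 x - (airyR 0 0 * H0 + airyR 1 0 * H1)| ≤ 2 * ε := by
  have b0 := airyTerm_series_bound (n := 1) (by norm_num) (by norm_num) 2 x hN
  have b1 := airyTerm_series_bound (n := 1) (by norm_num) (by norm_num) 0 x hN
  have b2 := tsum_airyTerm_eq_zero (n := 1) (by norm_num) 1 x (by simpa using airyR_two_zero)
  have e0 : airyTerm 1 x 2 = airyR 0 0 * (x ^ 2 / 2) := by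
    simp [airyTerm, mul_comm, airyR_three_zero, Nat.factorial]
  have e1 : airyTerm 1 x 0 = airyR 1 0 := by simp [airyTerm]
  rw [e0, mul_assoc, mul_assoc] at b0
  rw [e1] at b1
  have c0 := abs_sub_mul_le abs_airyR_zero_zero_le b0 h0
  have c1 := abs_sub_mul_le abs_airyR_one_zero_le b1 h1
  rw [airyR_eq_tsum 1 x, b2]
  simp only [zero_add] at c1
  rw [abs_le] at *
  constructor <;> linarith

end

noncomputable section

/-! ### Numerical values -/

lemma airyR_zero_at_eleven :
    |airyR 0 (11) - (airyR 0 0 * 9233445116.52951211791308837497 +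
      airyR 1 0 * 12665712084.80833992572096707679)| ≤ 2 * (2 / 10 ^ 20) := by
  refine abs_airyR_zero_sub_le 52 ?_ ?_ ?_ <;> norm_num [nestedSum, nestedProd, airyRatio, abs_of_pos, abs_of_neg]

lemma airyR_neg_one_at_eleven :
    |airyR (-1) (11) - (-(1 / 3) + airyR 0 0 * 2845570334.21852960401899332618 +
      airyR 1 0 * 3903329050.37490987181588167628)| ≤ 2 * (2 / 10 ^ 20) := by
  refine abs_airyR_neg_one_sub_le 52 ?_ ?_ ?_ <;> norm_num [nestedSum, nestedProd, airyRatio, abs_of_pos, abs_of_neg]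

lemma airyR_zero_at_root_right :
    |airyR 0 (-2.338107410) - (airyR 0 0 * (-0.369103549318115) +
      airyR 1 0 * (-0.506307151626056))| ≤ 2 * (2 / 10 ^ 15) := by
  refine abs_airyR_zero_sub_le 13 ?_ ?_ ?_ <;> norm_num [nestedSum, nestedProd, airyRatio, abs_of_pos, abs_of_neg]

lemma airyR_zero_at_root_left :
    |airyR 0 (-2.338107411) - (airyR 0 0 * (-0.369103550268270) +
      airyR 1 0 * (-0.506307150220137))| ≤ 2 * (2 / 10 ^ 15) := by
  refine abs_airyR_zero_sub_le 13 ?_ ?_ ?_ <;> norm_num [nestedSum, nestedProd, airyRatio, abs_of_pos, abs_of_neg]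

lemma airyR_neg_one_at_root_right :
    |airyR (-1) (-2.338107410) - (-(1 / 3) + airyR 0 0 * (-1.361050430944437) +
      airyR 1 0 * 1.768830440662993)| ≤ 2 * (2 / 10 ^ 15) := by
  refine abs_airyR_neg_one_sub_le 13 ?_ ?_ ?_ <;> norm_num [nestedSum, nestedProd, airyRatio, abs_of_pos, abs_of_neg]

lemma airyR_zero_at_neg_six_fifths :
    |airyR 0 (-1.2) - (airyR 0 0 * 0.728196 +
      airyR 1 0 * (-1.034174))| ≤ 2 * (2 / 10 ^ 6) := by
  refine abs_airyR_zero_sub_le 5 ?_ ?_ ?_ <;> norm_num [nestedSum, nestedProd, airyRatio, abs_of_pos, abs_of_neg]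

lemma airyR_zero_at_neg_seven_halves :
    |airyR 0 (-3.5) - (airyR 0 0 * (-0.391513) +
      airyR 1 0 * 0.913902)| ≤ 2 * (2 / 10 ^ 6) := by
  refine abs_airyR_zero_sub_le 13 ?_ ?_ ?_ <;> norm_num [nestedSum, nestedProd, airyRatio, abs_of_pos, abs_of_neg]

lemma airyR_one_at_neg_seven_halves :
    |airyR 1 (-3.5) - (airyR 0 0 * (-1.047261) +
      airyR 1 0 * (-0.109589))| ≤ 2 * (2 / 10 ^ 6) := by
  refine abs_airyR_one_sub_le 13 ?_ ?_ ?_ <;> norm_num [nestedSum, nestedProd, airyRatio, abs_of_pos, abs_of_neg]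

/-- The height `33/10` is close to `√11`, which minimizes `s³/3 - 11s`; the exponent is `-24.321`.
-/
lemma exp_neg_twentyfour_le :
    Real.exp ((33 / 10) ^ 3 / 3 - 33 / 10 * 11) ≤ 29 / 10 ^ 12 := by
  have h1 : (2.718 : ℝ) ^ 24 ≤ Real.exp 24 := by
    rw [show (24 : ℝ) = (24 : ℕ) * 1 by norm_num, Real.exp_nat_mul]
    have := Real.exp_one_gt_d9
    gcongr
    linarith
  have h2 : (1.321 : ℝ) ≤ Real.exp 0.321 := by
    have := Real.add_one_le_exp (0.321 : ℝ); linarith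
  have h3 : (2.718 : ℝ) ^ 24 * 1.321 ≤ Real.exp 24.321 := by
    rw [show (24.321 : ℝ) = 24 + 0.321 by norm_num, Real.exp_add]
    gcongr
  rw [show ((33 : ℝ) / 10) ^ 3 / 3 - 33 / 10 * 11 = -24.321 by norm_num, Real.exp_neg]
  refine (inv_anti₀ (by norm_num) h3).trans (by norm_num)

lemma abs_airyR_zero_eleven_le : |airyR 0 11| ≤ 5 / 10 ^ 12 := by
  refine (abs_airyR_zero_le (s := 33 / 10) (by norm_num) 11).trans ?_
  have h1 : √(Real.pi / (33 / 10)) ≤ 1 := by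
    rw [Real.sqrt_le_one]
    rw [div_le_one (by norm_num)]
    linarith [Real.pi_lt_d2]
  rw [div_le_iff₀ (by positivity)]
  calc _ ≤ 29 / 10 ^ 12 * (1 : ℝ) := by gcongr; exact exp_neg_twentyfour_le
    _ ≤ 5 / 10 ^ 12 * (2 * 3.14) := by norm_num
    _ ≤ _ := by gcongr; exact Real.pi_gt_d2.le

lemma abs_airyR_neg_one_eleven_le : |airyR (-1) 11| ≤ 2 / 10 ^ 12 := by
  refine (abs_airyR_neg_one_le (s := 33 / 10) (by norm_num) 11).trans ?_
  have h1 : √(Real.pi / (33 / 10)) ≤ 1 := by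
    rw [Real.sqrt_le_one]
    rw [div_le_one (by norm_num)]
    linarith [Real.pi_lt_d2]
  rw [div_le_iff₀ (by positivity)]
  calc _ ≤ 29 / 10 ^ 12 / (33 / 10) * (1 : ℝ) := by gcongr; exact exp_neg_twentyfour_le
    _ ≤ 2 / 10 ^ 12 * (2 * 3.14) := by norm_num
    _ ≤ _ := by gcongr; exact Real.pi_gt_d2.le

lemma solve_linear_aux {f g F G a b e1 e2 : ℝ} (h1 : a * f + b * g = e1) (h2 : a * F + b * G = e2) :
    a * (f * G - g * F) = e1 * G - e2 * g ∧ b * (f * G - g * F) = e2 * f - e1 * F := by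
  subst h1 h2; constructor <;> ring

/-- `Ai(11)` and the primitive at `11` are of size `10⁻¹²`, while the Taylor series express them
through `Ai(0)`, `Ai'(0)` and the constant `-1/3`. This gives two linear equations with right sides
near `0` and `1/3`, solved by Cramer's rule. The determinant is as large as the coefficients, about
`10¹⁰` in size, so the accuracy of the right sides is kept. -/
lemma airyR_zero_mem :
    |airyR 0 0 - 0.355028053887817| ≤ 7 / 10 ^ 12 ∧
    |airyR 1 0 + 0.258819403792807| ≤ 7 / 10 ^ 12 := by
  have h1 := airyR_zero_at_eleven
  have h2 := airyR_neg_one_at_eleven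
  have h3 := abs_airyR_zero_eleven_le
  have h4 := abs_airyR_neg_one_eleven_le
  obtain ⟨e1, he1⟩ : ∃ e, airyR 0 0 * 9233445116.52951211791308837497 + airyR 1 0 * 12665712084.80833992572096707679 = e :=
    ⟨_, rfl⟩
  obtain ⟨e2, he2⟩ : ∃ e, airyR 0 0 * 2845570334.21852960401899332618 + airyR 1 0 * 3903329050.37490987181588167628 = e :=
    ⟨_, rfl⟩
  obtain ⟨s1, s2⟩ := solve_linear_aux he1 he2
  rw [he1] at h1
  rw [add_assoc, he2] at h2
  rw [abs_le] at h1 h2 h3 h4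
  norm_num at h1 h2 h3 h4 s1 s2
  constructor <;> rw [abs_le] <;> constructor <;> linarith

lemma airyR_zero_zero_mem : |airyR 0 0 - 0.355028053887817| ≤ 7 / 10 ^ 12 :=
  airyR_zero_mem.1

lemma airyR_one_zero_mem : |airyR 1 0 + 0.258819403792807| ≤ 7 / 10 ^ 12 :=
  airyR_zero_mem.2

lemma airyR_zero_zero_pos : 0 < airyR 0 0 := by
  have h1 := abs_le.1 airyR_zero_zero_mem
  norm_num at h1; linarith [h1.1]

lemma airyR_one_zero_neg : airyR 1 0 < 0 := by
  have h1 := abs_le.1 airyR_one_zero_mem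
  norm_num at h1; linarith [h1.2]

lemma airyR_zero_root_right_pos : 0 < airyR 0 (-2.338107410) := by
  have h := (abs_le.1 airyR_zero_at_root_right).1
  have ha := abs_le.1 airyR_zero_zero_mem
  have hb := abs_le.1 airyR_one_zero_mem
  obtain ⟨ha1, ha2⟩ := ha
  obtain ⟨hb1, hb2⟩ := hb
  linarith

lemma airyR_zero_root_left_neg : airyR 0 (-2.338107411) < 0 := by
  have h := (abs_le.1 airyR_zero_at_root_left).2
  have ha := abs_le.1 airyR_zero_zero_mem
  have hb := abs_le.1 airyR_one_zero_mem
  obtain ⟨ha1, ha2⟩ := ha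
  obtain ⟨hb1, hb2⟩ := hb
  linarith

lemma airyG_root_right_mem : |airyG (-2.338107410) - (-0.274352059137)| ≤ 4 / 10 ^ 11 := by
  obtain ⟨h1, h2⟩ := abs_le.1 airyR_neg_one_at_root_right
  have ha := abs_le.1 airyR_zero_zero_mem
  have hb := abs_le.1 airyR_one_zero_mem
  obtain ⟨ha1, ha2⟩ := ha
  obtain ⟨hb1, hb2⟩ := hb
  rw [airyG_eq, abs_le]
  constructor <;> linarith

lemma airyR_zero_neg_six_fifths_pos : 0 < airyR 0 (-1.2) := by
  have h := (abs_le.1 airyR_zero_at_neg_six_fifths).1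
  have ha := abs_le.1 airyR_zero_zero_mem
  have hb := abs_le.1 airyR_one_zero_mem
  obtain ⟨ha1, ha2⟩ := ha
  obtain ⟨hb1, hb2⟩ := hb
  linarith

lemma airyR_zero_neg_seven_halves_mem : |airyR 0 (-3.5) - (-0.3755)| ≤ 1 / 10 ^ 4 := by
  obtain ⟨h1, h2⟩ := abs_le.1 airyR_zero_at_neg_seven_halves
  have ha := abs_le.1 airyR_zero_zero_mem
  have hb := abs_le.1 airyR_one_zero_mem
  obtain ⟨ha1, ha2⟩ := ha
  obtain ⟨hb1, hb2⟩ := hb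
  rw [abs_le]
  constructor <;> linarith

lemma airyR_one_neg_seven_halves_mem : |airyR 1 (-3.5) - (-0.3434)| ≤ 1 / 10 ^ 4 := by
  obtain ⟨h1, h2⟩ := abs_le.1 airyR_one_at_neg_seven_halves
  have ha := abs_le.1 airyR_zero_zero_mem
  have hb := abs_le.1 airyR_one_zero_mem
  obtain ⟨ha1, ha2⟩ := ha
  obtain ⟨hb1, hb2⟩ := hb
  rw [abs_le]
  constructor <;> linarith

/-- `0.27` is just below `|G(η₀)| ≈ 0.2743`, so the minimum of `G` is not attained to the left of
`-3.5`. The bound comes from the energy at `-3.5`. -/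
lemma abs_airyG_le_of_le_neg_seven_halves {x : ℝ} (hx : x ≤ -3.5) : |airyG x| ≤ 0.27 := by
  refine (abs_airyG_le_of_le hx (by norm_num)).trans ?_
  have hE : airyEnergy (-3.5) ≤ 0.4185 ^ 2 := by
    have h1 := abs_le.1 airyR_zero_neg_seven_halves_mem
    have h2 := abs_le.1 airyR_one_neg_seven_halves_mem
    have e1 : airyR 0 (-3.5) ^ 2 ≤ 0.3756 ^ 2 := by
      apply sq_le_sq'
      · linarith [h1.1]
      · linarith [h1.2]
    have e2 : airyR 1 (-3.5) ^ 2 ≤ 0.3435 ^ 2 := by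
      apply sq_le_sq'
      · linarith [h2.1]
      · linarith [h2.2]
    unfold airyEnergy
    rw [div_neg, sub_neg_eq_add]
    have : airyR 1 (-3.5) ^ 2 / 3.5 ≤ 0.3435 ^ 2 / 3.5 := by gcongr
    refine (add_le_add e1 this).trans (by norm_num)
  have h1 : √(airyEnergy (-3.5)) ≤ 0.4185 := Real.sqrt_le_iff.2 ⟨by norm_num, hE⟩
  have h2 : √(1 / (-(-3.5)) + 1 / (-(-3.5)) ^ 4) ≤ (0.541 : ℝ) :=
    Real.sqrt_le_iff.2 ⟨by norm_num, by norm_num⟩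
  calc _ ≤ 0.4185 * ((0.541 : ℝ) + 1 / (-3.5) ^ 2) := by gcongr
    _ ≤ 0.27 := by norm_num

end

noncomputable section

/-! ### Zeros of the Airy function and the range of `airyG` -/

/-- `Ai'² - x Ai²` has derivative `-Ai²`, so at any `x ≤ 0` it is at least its value `Ai'(0)² > 0`
at the origin. -/
lemma airyR_one_ne_zero_of_zero {x : ℝ} (hx : x ≤ 0) (h : airyR 0 x = 0) : airyR 1 x ≠ 0 := by
  have hd : ∀ t, HasDerivAt (fun t => airyR 1 t ^ 2 - t * airyR 0 t ^ 2) (-(airyR 0 t ^ 2)) t := by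
    intro t
    have := ((hasDerivAt_airyR_one t).pow 2).sub
      ((hasDerivAt_id t).mul ((hasDerivAt_airyR_zero t).pow 2))
    refine this.congr_deriv ?_
    simp only [id, Nat.cast_ofNat, Nat.add_one_sub_one, pow_one, Pi.pow_apply]
    ring
  have hanti : Antitone fun t => airyR 1 t ^ 2 - t * airyR 0 t ^ 2 :=
    antitone_of_deriv_nonpos (fun t => (hd t).differentiableAt) fun t => by
      rw [(hd t).deriv]; nlinarith [sq_nonneg (airyR 0 t)]
  have := hanti hx
  simp only [h] at this
  intro h1
  rw [h1] at this
  nlinarith [airyR_one_zero_neg]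

/-- A solution of `y'' = x y` cannot have a nonnegative maximum on a short interval, relative to a
concave parabola. -/
lemma neg_of_neg_left {y y' : ℝ → ℝ} (hy : ∀ x, HasDerivAt y (y' x) x)
    (hy' : ∀ x, HasDerivAt y' (x * y x) x) {a b : ℝ} (hb : b ≤ 0)
    (hsmall : (b - a) ^ 2 * (-a) < 8) (ha : y a < 0) (hyb : y b ≤ 0)
    (hnd : ∀ x ∈ Set.Icc a b, y x = 0 → y' x ≠ 0) : ∀ x ∈ Set.Ico a b, y x < 0 := by
  intro x₀ hx₀
  by_contra hcon
  push Not at hcon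
  have hab : a < b := hx₀.1.trans_lt hx₀.2
  have hba : 0 < (b - a) ^ 2 := by have := sub_pos.2 hab; positivity
  -- The upper bound on `k` keeps `ψ` positive on `[a, b]`; the lower bound makes `2k + xψ` positive
  -- there. `hsmall` says exactly that both are compatible.
  obtain ⟨k, hk1, hk2⟩ : ∃ k, -a / 2 < k ∧ k < 4 / (b - a) ^ 2 := by
    apply exists_between
    rw [lt_div_iff₀ hba]
    linarith
  have hk0 : 0 < k := by linarith
  rw [lt_div_iff₀ hba] at hk2
  set m := (a + b) / 2 with hm
  set ψ : ℝ → ℝ := fun x => 1 - k * (x - m) ^ 2 with hψ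
  have hψpos : ∀ x ∈ Set.Icc a b, 0 < ψ x := by
    intro x hx
    have : (x - m) ^ 2 ≤ ((b - a) / 2) ^ 2 := by
      apply sq_le_sq'
      · linarith [hx.1, hx.2]
      · linarith [hx.1, hx.2]
    simp only [hψ]
    nlinarith
  have hψd : ∀ x, HasDerivAt ψ (-(2 * k * (x - m))) x := by
    intro x
    have := ((((hasDerivAt_id x).sub_const m).pow 2).const_mul k).const_sub 1
    refine this.congr_deriv ?_
    simp
    ring
  -- `w` is the Wronskian of `y` and `ψ`, so `(y/ψ)' = w/ψ²`; and `w' = y (2k + xψ)` has the sign of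
  -- `y`.
  set w : ℝ → ℝ := fun x => y' x * ψ x - y x * (-(2 * k * (x - m))) with hw
  have hwd : ∀ x, HasDerivAt w (y x * (2 * k + x * ψ x)) x := by
    intro x
    have h1 : HasDerivAt (fun x => -(2 * k * (x - m))) (-(2 * k)) x := by
      have := (((hasDerivAt_id x).sub_const m).const_mul (2 * k)).neg
      exact this.congr_deriv (by simp)
    have := ((hy' x).mul (hψd x)).sub ((hy x).mul h1)
    refine this.congr_deriv ?_
    ring
  have hcoef : ∀ x ∈ Set.Icc a b, 0 < 2 * k + x * ψ x := by
    intro x hx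
    have h1 : ψ x ≤ 1 := by simp only [hψ]; nlinarith [sq_nonneg (x - m)]
    have h2 : x ≤ 0 := hx.2.trans hb
    nlinarith [hx.1, hψpos x hx]
  have hrd : ∀ x ∈ Set.Icc a b, HasDerivAt (fun x => y x / ψ x) (w x / ψ x ^ 2) x := fun x hx =>
    (hy x).div (hψd x) (hψpos x hx).ne'
  have hrc : ContinuousOn (fun x => y x / ψ x) (Set.Icc a b) := fun x hx =>
    (hrd x hx).continuousAt.continuousWithinAt
  obtain ⟨c', hc', hmax'⟩ := isCompact_Icc.exists_isMaxOn ⟨a, Set.left_mem_Icc.2 hab.le⟩ hrc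
  have hr0 : 0 ≤ y x₀ / ψ x₀ := div_nonneg hcon (hψpos x₀ ⟨hx₀.1, hx₀.2.le⟩).le
  have hra : y a / ψ a < 0 := div_neg_of_neg_of_pos ha (hψpos a (Set.left_mem_Icc.2 hab.le))
  have hrb : y b / ψ b ≤ 0 := div_nonpos_of_nonpos_of_nonneg hyb
    (hψpos b (Set.right_mem_Icc.2 hab.le)).le
  have hx₀a : a < x₀ := by
    rcases hx₀.1.eq_or_lt with h | h
    · rw [← h] at hcon; linarith
    · exact h
  -- If the maximum is attained at `b`, then `y b ≤ 0` forces the maximum to be at most `0`, and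
  -- `x₀`, where the ratio is nonnegative, is an interior maximum as well.
  obtain ⟨c, hc, hmax, hcpos⟩ : ∃ c ∈ Set.Ioo a b, IsMaxOn (fun x => y x / ψ x) (Set.Icc a b) c ∧
      0 ≤ y c / ψ c := by
    have h0 : y x₀ / ψ x₀ ≤ y c' / ψ c' := hmax' ⟨hx₀.1, hx₀.2.le⟩
    have hac : a ≠ c' := by rintro rfl; linarith
    rcases eq_or_ne c' b with h | h
    · refine ⟨x₀, ⟨hx₀a, hx₀.2⟩, fun x hx => ?_, hr0⟩
      have h1 : y x / ψ x ≤ y c' / ψ c' := hmax' hx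
      change y x / ψ x ≤ y x₀ / ψ x₀
      rw [h] at h1
      linarith
    · exact ⟨c', ⟨hc'.1.lt_of_ne hac, hc'.2.lt_of_ne h⟩, hmax', hr0.trans h0⟩
  have hcI : c ∈ Set.Icc a b := Set.Ioo_subset_Icc_self hc
  have hloc : IsLocalMax (fun x => y x / ψ x) c := hmax.isLocalMax (Icc_mem_nhds hc.1 hc.2)
  have hw0 : w c = 0 := by
    have := hloc.hasDerivAt_eq_zero (hrd c hcI)
    have hne := (hψpos c hcI).ne'
    simpa [hne] using this
  have hyc : 0 ≤ y c := by
    have h1 := mul_nonneg hcpos (hψpos c hcI).le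
    rwa [div_mul_cancel₀ _ (hψpos c hcI).ne'] at h1
  -- At the maximum `w c = 0`. If `y c = 0`, then also `y' c = 0`, which is excluded. If `y c > 0`,
  -- then `w` increases from `0`, so `y/ψ` increases strictly past its maximum.
  rcases hyc.eq_or_lt with h0 | h0
  · apply hnd c hcI h0.symm
    simp only [hw, ← h0, zero_mul, sub_zero] at hw0
    exact (mul_eq_zero.1 hw0).resolve_right (hψpos c hcI).ne'
  · obtain ⟨δ, hδ, hpos⟩ : ∃ δ > 0, ∀ x, |x - c| < δ → 0 < y x := by
      have := (hy c).continuousAt.eventually (lt_mem_nhds h0)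
      obtain ⟨δ, hδ, h⟩ := Metric.eventually_nhds_iff.1 this
      exact ⟨δ, hδ, fun x hx => h (by rwa [Real.dist_eq])⟩
    set d := min (c + δ / 2) b with hd
    have hcd : c < d := lt_min (by linarith) hc.2
    have hdsub : Set.Icc c d ⊆ Set.Icc a b := Set.Icc_subset_Icc hc.1.le (min_le_right _ _)
    have hyd : ∀ x ∈ Set.Icc c d, 0 < y x := fun x hx => hpos x (by
      rw [abs_of_nonneg (by linarith [hx.1])]
      have := hx.2.trans (min_le_left _ _)
      linarith)
    have hwmono : StrictMonoOn w (Set.Icc c d) := by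
      refine strictMonoOn_of_deriv_pos (convex_Icc c d)
        (fun x _ => (hwd x).continuousAt.continuousWithinAt) fun x hx => ?_
      have hx' := interior_subset hx
      rw [(hwd x).deriv]
      exact mul_pos (hyd x hx') (hcoef x (hdsub hx'))
    have hrmono : StrictMonoOn (fun x => y x / ψ x) (Set.Icc c d) := by
      refine strictMonoOn_of_deriv_pos (convex_Icc c d) (hrc.mono hdsub) fun x hx => ?_
      have hx' := interior_subset hx
      rw [interior_Icc] at hx
      rw [(hrd x (hdsub hx')).deriv]
      have h1 := hwmono (Set.left_mem_Icc.2 hcd.le) hx' hx.1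
      rw [hw0] at h1
      have := hψpos x (hdsub hx')
      positivity
    have h1 := hrmono (Set.left_mem_Icc.2 hcd.le) (Set.right_mem_Icc.2 hcd.le) hcd
    have h2 : y d / ψ d ≤ y c / ψ c := hmax (hdsub (Set.right_mem_Icc.2 hcd.le))
    simp only at h1
    linarith

lemma airyR_zero_pos_of_mem {a b : ℝ} (hb : b ≤ 0) (hsmall : (b - a) ^ 2 * (-a) < 8)
    (ha : 0 < airyR 0 a) (hyb : 0 ≤ airyR 0 b) : ∀ x ∈ Set.Ico a b, 0 < airyR 0 x := by
  intro x hx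
  have := neg_of_neg_left (y := fun x => -airyR 0 x) (y' := fun x => -airyR 1 x)
    (fun x => (hasDerivAt_airyR_zero x).neg)
    (fun x => (hasDerivAt_airyR_one x).neg.congr_deriv (by ring)) hb hsmall (by simpa using ha)
    (by simpa using hyb) (fun x hx h => by
      simpa using airyR_one_ne_zero_of_zero (hx.2.trans hb) (by simpa using h)) x hx
  linarith

lemma airyR_zero_neg_of_mem {a b : ℝ} (hb : b ≤ 0) (hsmall : (b - a) ^ 2 * (-a) < 8)
    (ha : airyR 0 a < 0) (hyb : airyR 0 b ≤ 0) : ∀ x ∈ Set.Ico a b, airyR 0 x < 0 :=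
  neg_of_neg_left hasDerivAt_airyR_zero hasDerivAt_airyR_one hb hsmall ha hyb
    fun _ hx h => airyR_one_ne_zero_of_zero (hx.2.trans hb) h

/-! #### Positivity to the right of the largest zero -/

lemma analyticOnNhd_airyG : AnalyticOnNhd ℝ airyG Set.univ := by
  intro x _
  obtain ⟨F, hF, hFG⟩ := exists_entire_airyG
  have h1 : AnalyticAt ℂ F x := Differentiable.analyticAt (fun z => (hF z).differentiableAt) x
  have h2 := h1.re_ofReal
  have h3 : (fun x : ℝ => (F x).re) = airyG := by
    ext x; rw [hFG, Complex.ofReal_re]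
  rwa [h3] at h2

/-- The level sets of `airyG` are Lebesgue null sets. -/
lemma ae_airyG_ne (μ : ℝ) : ∀ᵐ x, airyG x ≠ μ := by
  -- By analyticity either `G` is constant, impossible since `G'(0) = Ai(0) > 0`, or the level set
  -- has codiscrete complement and is null.
  rcases analyticOnNhd_airyG.eqOn_or_eventually_ne_of_preconnected
    (g := fun _ => μ) analyticOnNhd_const isPreconnected_univ with h | h
  · exfalso
    have h1 : airyG = fun _ => μ := funext fun x => h (Set.mem_univ x)
    have h2 := hasDerivAt_airyG 0
    rw [h1] at h2
    exact airyR_zero_zero_pos.ne' (h2.unique (hasDerivAt_const 0 μ))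
  · have := ae_restrict_le_codiscreteWithin (μ := volume) MeasurableSet.univ h
    rwa [Measure.restrict_univ] at this

/-- On `[0, ∞)` the product `Ai Ai'` is nondecreasing and tends to `0`, hence is nonpositive. After
a zero of `Ai` it is also nonnegative, so `Ai` vanishes identically from there on and `G` has a
level set containing a half line. -/
lemma airyR_zero_ne_zero_of_nonneg {x : ℝ} (hx : 0 ≤ x) : airyR 0 x ≠ 0 := by
  intro h0
  have hd : ∀ t, HasDerivAt (fun t => airyR 0 t * airyR 1 t) (airyR 1 t ^ 2 + t * airyR 0 t ^ 2) t := by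
    intro t
    refine ((hasDerivAt_airyR_zero t).mul (hasDerivAt_airyR_one t)).congr_deriv ?_
    ring
  have hmono : MonotoneOn (fun t => airyR 0 t * airyR 1 t) (Set.Ici 0) := by
    refine monotoneOn_of_deriv_nonneg (convex_Ici 0)
      (fun t _ => (hd t).continuousAt.continuousWithinAt)
      (fun t _ => (hd t).differentiableAt.differentiableWithinAt) fun t ht => ?_
    rw [interior_Ici] at ht
    rw [(hd t).deriv]
    have : 0 ≤ t := le_of_lt ht
    positivity
  have hlim : Tendsto (fun t => airyR 0 t * airyR 1 t) atTop (𝓝 0) := by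
    simpa using (tendsto_airyR_atTop 0).mul (tendsto_airyR_atTop 1)
  have hnonpos : ∀ t, 0 ≤ t → airyR 0 t * airyR 1 t ≤ 0 := by
    intro t ht
    refine ge_of_tendsto hlim ?_
    filter_upwards [eventually_ge_atTop t] with s hs using hmono ht (ht.trans hs) hs
  have hzero : ∀ t, x ≤ t → airyR 0 t * airyR 1 t = 0 := by
    intro t ht
    refine le_antisymm (hnonpos t (hx.trans ht)) ?_
    have := hmono hx (hx.trans ht) ht
    simpa [h0] using this
  have hA : ∀ t, x ≤ t → airyR 0 t = 0 := by
    intro t ht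
    have hconst := constant_of_has_deriv_right_zero (f := fun t => airyR 0 t ^ 2) (a := x) (b := t)
      ((continuous_airyR 0).pow 2).continuousOn (fun s hs => by
        have := (hasDerivAt_airyR_zero s).pow 2
        refine (this.congr_deriv ?_).hasDerivWithinAt
        have := hzero s hs.1
        simp
        exact mul_eq_zero.1 this) t (Set.right_mem_Icc.2 ht)
    simp only [h0] at hconst
    simpa using hconst
  have hG : ∀ t, x ≤ t → airyG t = airyG x := fun t ht =>
    constant_of_has_deriv_right_zero (f := airyG) (a := x) (b := t)
      continuous_airyG.continuousOn (fun s hs => by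
        have := (hasDerivAt_airyG s).hasDerivWithinAt (s := Set.Ici s)
        rwa [hA s hs.1] at this) t (Set.right_mem_Icc.2 ht)
  have hnull := ae_airyG_ne (airyG x)
  rw [ae_iff] at hnull
  have hsub : Set.Ici x ⊆ {a | ¬airyG a ≠ airyG x} := fun t ht => by simpa using hG t ht
  have := measure_mono_null hsub hnull
  simp at this

/-- The comparison argument needs `(b - a)²(-a) < 8`, which fails for the whole interval from
`-2.338` to `0`; the intermediate point `-1.2` splits it into two admissible ones. -/
lemma airyR_zero_pos_of_ge {x : ℝ} (hx : -2.338107410 ≤ x) : 0 < airyR 0 x := by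
  rcases le_total 0 x with h | h
  · by_contra hcon
    push Not at hcon
    obtain ⟨y, hy, hy0⟩ := intermediate_value_Icc' h (continuous_airyR 0).continuousOn
      ⟨hcon, airyR_zero_zero_pos.le⟩
    exact airyR_zero_ne_zero_of_nonneg hy.1 hy0
  · rcases h.eq_or_lt with rfl | h
    · exact airyR_zero_zero_pos
    rcases lt_or_ge x (-1.2) with h2 | h2
    · exact airyR_zero_pos_of_mem (a := -2.338107410) (b := -1.2) (by norm_num) (by norm_num)
        airyR_zero_root_right_pos airyR_zero_neg_six_fifths_pos.le x ⟨hx, h2⟩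
    · exact airyR_zero_pos_of_mem (a := -1.2) (b := 0) (by norm_num) (by norm_num)
        airyR_zero_neg_six_fifths_pos airyR_zero_zero_pos.le x ⟨h2, h⟩

lemma airyAi_eq_zero_iff (x : ℝ) : airyAi x = 0 ↔ airyR 0 x = 0 := by
  rw [← airyD_zero, ← ofReal_airyR, Complex.ofReal_eq_zero]

/-- The Airy function has a largest real zero, near `-2.338107410`. -/
lemma exists_isGreatest_zero : ∃ η₀ : ℝ, IsGreatest {x : ℝ | airyAi x = 0} η₀ ∧
    -2.338107411 < η₀ ∧ η₀ < -2.338107410 := by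
  have hcl : IsCompact {x : ℝ | x ∈ Set.Icc (-2.338107411 : ℝ) (-2.338107410) ∧ airyR 0 x = 0} :=
    isCompact_Icc.inter_right (isClosed_eq (continuous_airyR 0) continuous_const)
  have hne : {x : ℝ | x ∈ Set.Icc (-2.338107411 : ℝ) (-2.338107410) ∧ airyR 0 x = 0}.Nonempty := by
    obtain ⟨y, hy, hy0⟩ := intermediate_value_Icc (by norm_num : (-2.338107411 : ℝ) ≤ -2.338107410)
      (continuous_airyR 0).continuousOn
      ⟨airyR_zero_root_left_neg.le, airyR_zero_root_right_pos.le⟩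
    exact ⟨y, hy, hy0⟩
  obtain ⟨η₀, ⟨hη, hη0⟩, hub⟩ := hcl.exists_isGreatest hne
  refine ⟨η₀, ⟨(airyAi_eq_zero_iff η₀).2 hη0, fun x hx => ?_⟩, hη.1.lt_of_ne ?_, hη.2.lt_of_ne ?_⟩
  · have hx0 : airyR 0 x = 0 := (airyAi_eq_zero_iff x).1 hx
    by_contra hcon
    push Not at hcon
    rcases lt_or_ge x (-2.338107410) with h | h
    · have := hub ⟨⟨hη.1.trans hcon.le, h.le⟩, hx0⟩
      linarith
    · exact (airyR_zero_pos_of_ge h).ne' hx0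
  · rintro rfl; exact airyR_zero_root_left_neg.ne hη0
  · rintro rfl; exact airyR_zero_root_right_pos.ne' hη0

lemma airyR_zero_pos_of_gt {η₀ x : ℝ} (hη : IsGreatest {x : ℝ | airyAi x = 0} η₀)
    (hx : η₀ < x) : 0 < airyR 0 x := by
  rcases le_total (-2.338107410) x with h | h
  · exact airyR_zero_pos_of_ge h
  · by_contra hcon
    push Not at hcon
    obtain ⟨y, hy, hy0⟩ := intermediate_value_Icc h (continuous_airyR 0).continuousOn
      ⟨hcon, airyR_zero_root_right_pos.le⟩
    have := hη.2 ((airyAi_eq_zero_iff y).2 hy0)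
    linarith [hy.1]

lemma strictMonoOn_airyG {η₀ : ℝ} (hη : IsGreatest {x : ℝ | airyAi x = 0} η₀) :
    StrictMonoOn airyG (Set.Ici η₀) := by
  refine strictMonoOn_of_deriv_pos (convex_Ici η₀) continuous_airyG.continuousOn fun x hx => ?_
  rw [interior_Ici] at hx
  rw [(hasDerivAt_airyG x).deriv]
  exact airyR_zero_pos_of_gt hη hx

lemma airyG_lt_one_of_ge {η₀ x : ℝ} (hη : IsGreatest {x : ℝ | airyAi x = 0} η₀) (hx : η₀ ≤ x) :
    airyG x < 1 := by
  have h1 : airyG x < airyG (x + 1) :=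
    strictMonoOn_airyG hη hx (Set.mem_Ici.2 (by linarith)) (by linarith)
  refine h1.trans_le (ge_of_tendsto tendsto_airyG_atTop ?_)
  filter_upwards [eventually_ge_atTop (x + 1)] with t ht
  exact (strictMonoOn_airyG hη).monotoneOn (Set.mem_Ici.2 (by linarith))
    (Set.mem_Ici.2 (by linarith)) ht

/-- `G'` vanishes at `η₀`, so the error from replacing `η₀` by the end of its bracket is quadratic:
`|Ai'| ≤ e³ < 21` on the bracket of length `10⁻⁹`, hence `|Ai| ≤ 21 · 10⁻⁹` and a change of `G` of
at most `10⁻¹⁵`. -/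
lemma abs_airyG_zero_sub_le {η₀ : ℝ} (hη : IsGreatest {x : ℝ | airyAi x = 0} η₀)
    (hl : -2.338107411 < η₀) (hr : η₀ < -2.338107410) :
    |airyG η₀ - (-0.2743520591)| < 1e-10 := by
  have hη0 : airyR 0 η₀ = 0 := (airyAi_eq_zero_iff η₀).1 hη.1
  have hA : ∀ x ∈ Set.Icc η₀ (-2.338107410), |airyR 0 x| ≤ 21 / 10 ^ 9 := by
    intro x hx
    have hbd : ∀ t ∈ Set.Icc η₀ (-2.338107410), ‖airyR 1 t‖ ≤ 21 := by
      intro t ht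
      refine (abs_airyR_one_le t).trans ?_
      have h1 : Real.exp (-t) ≤ Real.exp 1 ^ 3 := by
        rw [← Real.exp_nat_mul]
        exact Real.exp_le_exp.2 (by push_cast; linarith [ht.1])
      have h2 : Real.exp 1 ^ 3 ≤ 2.7183 ^ 3 :=
        pow_le_pow_left₀ (Real.exp_pos _).le (by linarith [Real.exp_one_lt_d9]) 3
      exact h1.trans (h2.trans (by norm_num))
    have := (convex_Icc η₀ (-2.338107410)).norm_image_sub_le_of_norm_hasDerivWithin_le
      (fun t _ => (hasDerivAt_airyR_zero t).hasDerivWithinAt) hbd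
      (Set.left_mem_Icc.2 hr.le) hx
    rw [hη0, sub_zero, Real.norm_eq_abs, Real.norm_of_nonneg (by linarith [hx.1])] at this
    linarith [hx.2]
  have hG := (convex_Icc η₀ (-2.338107410)).norm_image_sub_le_of_norm_hasDerivWithin_le
      (fun t _ => (hasDerivAt_airyG t).hasDerivWithinAt) hA
      (Set.left_mem_Icc.2 hr.le) (Set.right_mem_Icc.2 hr.le)
  rw [Real.norm_eq_abs, Real.norm_of_nonneg (by linarith)] at hG
  have h1 : |airyG (-2.338107410) - airyG η₀| ≤ 1 / 10 ^ 15 := by linarith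
  have h2 := airyG_root_right_mem
  rw [abs_le] at h1 h2
  rw [abs_lt]
  constructor <;> linarith [h1.1, h1.2, h2.1, h2.2]

/-- On `[-3.5, η₀)` the function `Ai` is negative, by the comparison argument, so `G` decreases
there to `G(η₀)`; to the left of `-3.5` the bound `0.27` takes over. -/
lemma airyG_mem_of_le {η₀ x : ℝ} (hη : IsGreatest {x : ℝ | airyAi x = 0} η₀)
    (hl : -2.338107411 < η₀) (hr : η₀ < -2.338107410) (hx : x ≤ η₀) :
    airyG η₀ ≤ airyG x ∧ airyG x < 1 := by
  have hη0 : airyR 0 η₀ = 0 := (airyAi_eq_zero_iff η₀).1 hη.1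
  have hval := abs_lt.1 (abs_airyG_zero_sub_le hη hl hr)
  rcases le_total x (-3.5) with h | h
  · have := abs_le.1 (abs_airyG_le_of_le_neg_seven_halves h)
    norm_num at this hval
    constructor <;> linarith [this.1, this.2, hval.2]
  · have hneg : ∀ t ∈ Set.Ico (-3.5) η₀, airyR 0 t < 0 := by
      refine airyR_zero_neg_of_mem (by linarith) ?_ ?_ hη0.le
      · have h1 : η₀ - (-3.5) ≤ 1.2 := by linarith
        have h2 : 0 ≤ η₀ - (-3.5) := by linarith
        nlinarith
      · have := (abs_le.1 airyR_zero_neg_seven_halves_mem).2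
        linarith
    have hanti : AntitoneOn airyG (Set.Icc (-3.5) η₀) := by
      refine antitoneOn_of_deriv_nonpos (convex_Icc _ _) continuous_airyG.continuousOn
        (fun t _ => (hasDerivAt_airyG t).differentiableAt.differentiableWithinAt) fun t ht => ?_
      rw [interior_Icc] at ht
      rw [(hasDerivAt_airyG t).deriv]
      exact (hneg t ⟨ht.1.le, ht.2⟩).le
    have hle : (-3.5 : ℝ) ≤ η₀ := by linarith
    refine ⟨hanti ⟨h, hx⟩ (Set.right_mem_Icc.2 hle) hx, ?_⟩
    have h1 := hanti (Set.left_mem_Icc.2 hle) ⟨h, hx⟩ h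
    have h2 := (abs_le.1 (abs_airyG_le_of_le_neg_seven_halves (le_refl (-3.5)))).2
    linarith

lemma range_airyG {η₀ : ℝ} (hη : IsGreatest {x : ℝ | airyAi x = 0} η₀)
    (hl : -2.338107411 < η₀) (hr : η₀ < -2.338107410) :
    Set.range airyG = Set.Ico (airyG η₀) 1 := by
  apply Set.Subset.antisymm
  · rintro _ ⟨x, rfl⟩
    rcases le_total x η₀ with h | h
    · exact airyG_mem_of_le hη hl hr h
    · exact ⟨(strictMonoOn_airyG hη).monotoneOn Set.self_mem_Ici h h, airyG_lt_one_of_ge hη h⟩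
  · rintro y ⟨hy1, hy2⟩
    obtain ⟨x, hx1, hx2⟩ := ((eventually_ge_atTop η₀).and
      (tendsto_airyG_atTop.eventually (lt_mem_nhds hy2))).exists
    obtain ⟨z, -, hz⟩ := intermediate_value_Icc hx1 continuous_airyG.continuousOn ⟨hy1, hx2.le⟩
    exact ⟨z, hz⟩

end

noncomputable section

/-! ### Multiplication operators on `L²(ℝ)` -/

open BoundedContinuousFunction in
lemma memLp_boundedContinuous_mul (m : ℝ →ᵇ ℂ) {u : ℝ → ℂ} (hu : MemLp u 2) :
    MemLp (fun x => m x * u x) 2 :=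
  MemLp.of_le_mul hu (m.continuous.aestronglyMeasurable.mul hu.1) (c := ‖m‖)
    (Eventually.of_forall fun x => by
      rw [norm_mul]
      exact mul_le_mul_of_nonneg_right (m.norm_coe_le_norm x) (norm_nonneg _))

open BoundedContinuousFunction in
/-- Multiplication by a bounded continuous function on `L²(ℝ)`. -/
def mulL2 (m : ℝ →ᵇ ℂ) : L2R →L[ℂ] L2R :=
  LinearMap.mkContinuous
    { toFun := fun u => (memLp_boundedContinuous_mul m (Lp.memLp u)).toLp _
      map_add' := fun u v => by
        ext1
        filter_upwards [MemLp.coeFn_toLp (memLp_boundedContinuous_mul m (Lp.memLp (u + v))),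
          Lp.coeFn_add ((memLp_boundedContinuous_mul m (Lp.memLp u)).toLp _)
            ((memLp_boundedContinuous_mul m (Lp.memLp v)).toLp _),
          MemLp.coeFn_toLp (memLp_boundedContinuous_mul m (Lp.memLp u)),
          MemLp.coeFn_toLp (memLp_boundedContinuous_mul m (Lp.memLp v)),
          Lp.coeFn_add u v] with x h1 h2 h3 h4 h5
        rw [h1, h2, Pi.add_apply, h3, h4, h5, Pi.add_apply, mul_add]
      map_smul' := fun c u => by
        ext1
        filter_upwards [MemLp.coeFn_toLp (memLp_boundedContinuous_mul m (Lp.memLp (c • u))),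
          Lp.coeFn_smul c ((memLp_boundedContinuous_mul m (Lp.memLp u)).toLp _),
          MemLp.coeFn_toLp (memLp_boundedContinuous_mul m (Lp.memLp u)),
          Lp.coeFn_smul c u] with x h1 h2 h3 h4
        rw [h1, RingHom.id_apply, h2, Pi.smul_apply, h3, h4, Pi.smul_apply, smul_eq_mul,
          smul_eq_mul, mul_left_comm] }
    ‖m‖ fun u => by
      refine Lp.norm_le_mul_norm_of_ae_le_mul ?_
      filter_upwards [MemLp.coeFn_toLp (memLp_boundedContinuous_mul m (Lp.memLp u))] with x hx
      simp only [LinearMap.coe_mk, AddHom.coe_mk]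
      rw [hx, norm_mul]
      exact mul_le_mul_of_nonneg_right (m.norm_coe_le_norm x) (norm_nonneg _)

open BoundedContinuousFunction

lemma coeFn_mulL2 (m : ℝ →ᵇ ℂ) (u : L2R) : mulL2 m u =ᵐ[volume] fun x => m x * u x :=
  MemLp.coeFn_toLp (memLp_boundedContinuous_mul m (Lp.memLp u))

lemma mulL2_mul_apply (m n : ℝ →ᵇ ℂ) (u : L2R) : mulL2 m (mulL2 n u) = mulL2 (m * n) u := by
  ext1
  filter_upwards [coeFn_mulL2 m (mulL2 n u), coeFn_mulL2 n u, coeFn_mulL2 (m * n) u]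
    with x h1 h2 h3
  rw [h1, h2, h3, BoundedContinuousFunction.mul_apply, mul_assoc]

lemma mulL2_one_apply (u : L2R) : mulL2 1 u = u := by
  ext1
  filter_upwards [coeFn_mulL2 1 u] with x h1
  exact h1.trans (one_mul _)

lemma norm_mulL2_apply_of_norm_eq_one {m : ℝ →ᵇ ℂ} (hm : ∀ x, ‖m x‖ = 1) (u : L2R) :
    ‖mulL2 m u‖ = ‖u‖ := by
  refine le_antisymm (Lp.norm_le_norm_of_ae_le ?_) (Lp.norm_le_norm_of_ae_le ?_) <;>
  · filter_upwards [coeFn_mulL2 m u] with x h1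
    rw [h1, norm_mul, hm, one_mul]

/-- Multiplication by a continuous unimodular function, as a unitary operator on `L²(ℝ)`. -/
def mulL2Equiv (m : ℝ →ᵇ ℂ) (hm : ∀ x, ‖m x‖ = 1) : L2R ≃ₗᵢ[ℂ] L2R where
  toFun := mulL2 m
  invFun := mulL2 (star m)
  map_add' := map_add _
  map_smul' := map_smul _
  left_inv u := by
    rw [mulL2_mul_apply, show star m * m = 1 from ?_, mulL2_one_apply]
    ext x
    have h : (starRingEnd ℂ) (m x) * m x = 1 := by rw [Complex.conj_mul', hm]; norm_num
    exact h
  right_inv u := by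
    rw [mulL2_mul_apply, show m * star m = 1 from ?_, mulL2_one_apply]
    ext x
    have h : m x * (starRingEnd ℂ) (m x) = 1 := by rw [Complex.mul_conj', hm]; norm_num
    exact h
  norm_map' := norm_mulL2_apply_of_norm_eq_one hm

lemma inner_mulL2_left (m : ℝ →ᵇ ℂ) (u v : L2R) :
    inner ℂ (mulL2 m u) v = inner ℂ u (mulL2 (star m) v) := by
  rw [L2.inner_def, L2.inner_def]
  refine integral_congr_ae ?_
  filter_upwards [coeFn_mulL2 m u, coeFn_mulL2 (star m) v] with x h1 h2
  rw [h1, h2]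
  simp
  ring

lemma norm_sq_eq_integral_norm_sq (u : L2R) : ‖u‖ ^ 2 = ∫ x, ‖u x‖ ^ 2 := by
  rw [← @inner_self_eq_norm_sq ℂ, L2.inner_def, ← integral_re]
  · refine integral_congr_ae (Eventually.of_forall fun x => ?_)
    simp only [inner_self_eq_norm_sq]
  · exact L2.integrable_inner u u

lemma re_inner_mulL2 {m : ℝ →ᵇ ℂ} {r : ℝ → ℝ} (hm : ∀ x, m x = r x) (u : L2R) :
    (inner ℂ u (mulL2 m u)).re = ∫ x, r x * ‖u x‖ ^ 2 := by
  rw [L2.inner_def, ← RCLike.re_eq_complex_re, ← integral_re (L2.integrable_inner u (mulL2 m u))]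
  refine integral_congr_ae ?_
  filter_upwards [coeFn_mulL2 m u] with x h1
  rw [h1, hm, ← smul_eq_mul, inner_smul_right, RCLike.re_eq_complex_re, Complex.re_ofReal_mul,
    ← RCLike.re_eq_complex_re, inner_self_eq_norm_sq]

lemma integrable_norm_sq (u : L2R) : Integrable (fun x => ‖u x‖ ^ 2) :=
  (memLp_two_iff_integrable_sq_norm (Lp.memLp u).1).1 (Lp.memLp u)

lemma re_inner_mulL2_mem {m : ℝ →ᵇ ℂ} {r : ℝ → ℝ} (hm : ∀ x, m x = r x) {a b : ℝ}
    (hr : ∀ x, r x ∈ Set.Icc a b) (u : L2R) :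
    a * ‖u‖ ^ 2 ≤ (inner ℂ u (mulL2 m u)).re ∧ (inner ℂ u (mulL2 m u)).re ≤ b * ‖u‖ ^ 2 := by
  have hi := integrable_norm_sq u
  have hi2 : Integrable (fun x => r x * ‖u x‖ ^ 2) := by
    have hc : Continuous r := by
      have : r = fun x => (m x).re := by ext x; simp [hm]
      rw [this]; exact Complex.continuous_re.comp m.continuous
    exact hi.bdd_mul hc.aestronglyMeasurable (c := max |a| |b|)
      (Eventually.of_forall fun x => abs_le_max_abs_abs (hr x).1 (hr x).2)
  rw [re_inner_mulL2 hm, norm_sq_eq_integral_norm_sq, ← integral_const_mul, ← integral_const_mul]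
  exact ⟨integral_mono (hi.const_mul a) hi2 fun x =>
      mul_le_mul_of_nonneg_right (hr x).1 (sq_nonneg _),
    integral_mono hi2 (hi.const_mul b) fun x =>
      mul_le_mul_of_nonneg_right (hr x).2 (sq_nonneg _)⟩

lemma isSelfAdjoint_mulL2 {m : ℝ →ᵇ ℂ} {r : ℝ → ℝ} (hm : ∀ x, m x = r x) :
    IsSelfAdjoint (mulL2 m) := by
  rw [ContinuousLinearMap.isSelfAdjoint_iff_isSymmetric]
  intro u v
  have : star m = m := by ext x; simp [hm]
  simpa [this] using inner_mulL2_left m u v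

lemma norm_mulL2_le {m : ℝ →ᵇ ℂ} {C : ℝ} (hC : 0 ≤ C) (hm : ∀ x, ‖m x‖ ≤ C) :
    ‖mulL2 m‖ ≤ C := by
  refine ContinuousLinearMap.opNorm_le_bound _ hC fun u => Lp.norm_le_mul_norm_of_ae_le_mul ?_
  filter_upwards [coeFn_mulL2 m u] with x h1
  rw [h1, norm_mul]
  exact mul_le_mul_of_nonneg_right (hm x) (norm_nonneg _)

lemma coeFn_mulL2_sub_smul (m : ℝ →ᵇ ℂ) (μ : ℂ) (u : L2R) :
    (mulL2 m u - μ • u : L2R) =ᵐ[volume] fun x => (m x - μ) * u x := by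
  filter_upwards [coeFn_mulL2 m u, Lp.coeFn_sub (mulL2 m u) (μ • u), Lp.coeFn_smul μ u]
    with x h1 h2 h3
  rw [h2, Pi.sub_apply, h1, h3, Pi.smul_apply, smul_eq_mul, sub_mul]

lemma bijective_mulL2_sub_smul {m : ℝ →ᵇ ℂ} {μ : ℂ} {δ : ℝ} (hδ : 0 < δ)
    (h : ∀ x, δ ≤ ‖m x - μ‖) : Function.Bijective fun u : L2R => mulL2 m u - μ • u := by
  have hne : ∀ x, m x - μ ≠ 0 := fun x h0 => by
    have := h x; rw [h0, norm_zero] at this; linarith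
  let n : ℝ →ᵇ ℂ := BoundedContinuousFunction.ofNormedAddCommGroup (fun x => (m x - μ)⁻¹)
    ((m.continuous.sub continuous_const).inv₀ hne) δ⁻¹ fun x => by
      rw [norm_inv]; exact inv_anti₀ hδ (h x)
  have hn : ∀ x, n x = (m x - μ)⁻¹ := fun x => rfl
  refine Function.bijective_iff_has_inverse.2 ⟨mulL2 n, fun u => ?_, fun u => ?_⟩
  · ext1
    filter_upwards [coeFn_mulL2 n (mulL2 m u - μ • u), coeFn_mulL2_sub_smul m μ u] with x h1 h2
    rw [h1, h2, hn, inv_mul_cancel_left₀ (hne x)]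
  · ext1
    filter_upwards [coeFn_mulL2 n u, coeFn_mulL2_sub_smul m μ (mulL2 n u)] with x h1 h2
    rw [h2, h1, hn, mul_inv_cancel_left₀ (hne x)]

lemma injective_mulL2_sub_smul {m : ℝ →ᵇ ℂ} {μ : ℂ} (h : ∀ᵐ x, m x ≠ μ) :
    Function.Injective fun u : L2R => mulL2 m u - μ • u := by
  intro u v huv
  ext1
  have huv' : mulL2 m u - μ • u = mulL2 m v - μ • v := huv
  filter_upwards [coeFn_mulL2_sub_smul m μ u, coeFn_mulL2_sub_smul m μ v, h] with x h1 h2 h3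
  rw [huv', h2] at h1
  exact (mul_left_cancel₀ (sub_ne_zero.2 h3) h1).symm

/-- By continuity `|m - μ| < ε` on a small ball about `x₀`, and the indicator of that ball is an
approximate eigenvector. -/
lemma exists_norm_mulL2_sub_smul_le {m : ℝ →ᵇ ℂ} {μ : ℂ} {ε : ℝ} {x₀ : ℝ}
    (h : ‖m x₀ - μ‖ < ε) : ∃ u : L2R, u ≠ 0 ∧ ‖mulL2 m u - μ • u‖ ≤ ε * ‖u‖ := by
  have hopen : IsOpen {x | ‖m x - μ‖ < ε} :=
    isOpen_lt ((m.continuous.sub continuous_const).norm) continuous_const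
  obtain ⟨δ, hδ, hball⟩ := Metric.isOpen_iff.1 hopen x₀ h
  have hfin : volume (Metric.ball x₀ δ) ≠ ⊤ := measure_ball_lt_top.ne
  refine ⟨indicatorConstLp 2 measurableSet_ball hfin (1 : ℂ), fun h0 => ?_,
    Lp.norm_le_mul_norm_of_ae_le_mul ?_⟩
  · have h1 : ‖indicatorConstLp 2 measurableSet_ball hfin (1 : ℂ)‖ = 0 := by rw [h0, norm_zero]
    rw [norm_indicatorConstLp (by norm_num) (by norm_num)] at h1
    have h2 : (0 : ℝ) < volume.real (Metric.ball x₀ δ) := by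
      rw [Real.volume_real_ball hδ.le]; positivity
    have h3 := Real.rpow_pos_of_pos h2 (1 / (2 : ENNReal).toReal)
    simp only [norm_one, one_mul] at h1
    exact h3.ne' h1
  · filter_upwards [coeFn_mulL2_sub_smul m μ (indicatorConstLp 2 measurableSet_ball hfin (1 : ℂ)),
      indicatorConstLp_coeFn (p := 2) (hs := measurableSet_ball) (hμs := hfin) (c := (1 : ℂ))]
      with x h1 h2
    rw [h1, h2, norm_mul]
    by_cases hx : x ∈ Metric.ball x₀ δ
    · exact mul_le_mul_of_nonneg_right (le_of_lt (hball hx)) (norm_nonneg _)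
    · simp [Set.indicator_of_notMem hx]

/-- If `T` were bijective, its inverse would be bounded by the open mapping theorem, and vectors
with `‖T u‖` much smaller than `‖u‖` could not exist. -/
lemma not_surjective_of_approximate_kernel {T : L2R →L[ℂ] L2R} (hinj : Function.Injective T)
    (h : ∀ ε > 0, ∃ u : L2R, u ≠ 0 ∧ ‖T u‖ ≤ ε * ‖u‖) : ¬ Function.Surjective T := by
  intro hsurj
  let e := ContinuousLinearEquiv.ofBijective T (LinearMap.ker_eq_bot.2 hinj)
    (LinearMap.range_eq_top.2 hsurj)
  have hb : ∀ u, ‖u‖ ≤ ‖(e.symm : L2R →L[ℂ] L2R)‖ * ‖T u‖ := fun u => by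
    have := (e.symm : L2R →L[ℂ] L2R).le_opNorm (T u)
    have h2 : (e.symm : L2R →L[ℂ] L2R) (T u) = u := e.symm_apply_apply u
    rwa [h2] at this
  set K := ‖(e.symm : L2R →L[ℂ] L2R)‖
  have hK : 0 ≤ K := norm_nonneg _
  obtain ⟨u, hu, hu2⟩ := h (1 / (2 * (K + 1))) (by positivity)
  have h1 : 0 < ‖u‖ := norm_pos_iff.2 hu
  have h2 : ‖u‖ ≤ K * (1 / (2 * (K + 1)) * ‖u‖) :=
    (hb u).trans (mul_le_mul_of_nonneg_left hu2 hK)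
  have h3 : K * (1 / (2 * (K + 1)) * ‖u‖) ≤ 1 / 2 * ‖u‖ := by
    rw [← mul_assoc]
    refine mul_le_mul_of_nonneg_right ?_ h1.le
    rw [mul_one_div, div_le_div_iff₀ (by positivity) (by norm_num)]
    linarith
  linarith

/-- The orthogonal complement of the range is the kernel of the adjoint, here the kernel of `T`
itself. -/
lemma denseRange_of_isSelfAdjoint {T : L2R →L[ℂ] L2R} (hT : IsSelfAdjoint T)
    (hinj : Function.Injective T) : DenseRange T := by
  have h := ContinuousLinearMap.orthogonal_range T
  rw [ContinuousLinearMap.isSelfAdjoint_iff'.1 hT] at h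
  have hker : T.ker = ⊥ := LinearMap.ker_eq_bot.2 hinj
  have h2 : T.range.topologicalClosure = ⊤ := by
    rw [Submodule.topologicalClosure_eq_top_iff, h]
    exact hker
  exact (Submodule.dense_iff_topologicalClosure_eq_top.2 h2)

end

noncomputable section

open BoundedContinuousFunction

/-! ### Operators unitarily equivalent to a real multiplication operator -/

section Conjugate

variable {m : ℝ →ᵇ ℂ} {r : ℝ → ℝ} {A : L2R →L[ℂ] L2R} {V : L2R ≃ₗᵢ[ℂ] L2R}

lemma inner_conj_mulL2 (hA : ∀ u, A u = V.symm (mulL2 m (V u))) (u v : L2R) :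
    inner ℂ u (A v) = inner ℂ (V u) (mulL2 m (V v)) := by
  rw [hA, ← V.inner_map_map, V.apply_symm_apply]

lemma isSelfAdjoint_conj_mulL2 (hA : ∀ u, A u = V.symm (mulL2 m (V u)))
    (hm : ∀ x, m x = r x) : IsSelfAdjoint A := by
  rw [ContinuousLinearMap.isSelfAdjoint_iff_isSymmetric]
  intro u v
  have h := (ContinuousLinearMap.isSelfAdjoint_iff_isSymmetric.1 (isSelfAdjoint_mulL2 hm))
    (V u) (V v)
  change inner ℂ (A u) v = inner ℂ u (A v)
  rw [inner_conj_mulL2 hA, ← inner_conj_symm, inner_conj_mulL2 hA, inner_conj_symm]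
  exact h

lemma re_inner_conj_mulL2_mem (hA : ∀ u, A u = V.symm (mulL2 m (V u)))
    (hm : ∀ x, m x = r x) {a b : ℝ} (hr : ∀ x, r x ∈ Set.Icc a b) (u : L2R) :
    a * ‖u‖ ^ 2 ≤ (inner ℂ u (A u)).re ∧ (inner ℂ u (A u)).re ≤ b * ‖u‖ ^ 2 := by
  rw [inner_conj_mulL2 hA, ← V.norm_map u]
  exact re_inner_mulL2_mem hm hr _

lemma conj_mulL2_sub_smul (hA : ∀ u, A u = V.symm (mulL2 m (V u))) (μ : ℂ) :
    (fun u => A u - μ • u) = V.symm ∘ (fun u => mulL2 m u - μ • u) ∘ V := by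
  ext1 u
  simp [hA]

lemma spectrum_conj_mulL2_subset (hA : ∀ u, A u = V.symm (mulL2 m (V u)))
    (hm : ∀ x, m x = r x) {a b : ℝ} (hr : ∀ x, r x ∈ Set.Icc a b) :
    spectrum ℂ A ⊆ Complex.ofReal '' Set.Icc a b := by
  intro μ hμ
  by_contra hcon
  have hcl : IsClosed (Complex.ofReal '' Set.Icc a b) :=
    (isCompact_Icc.image Complex.continuous_ofReal).isClosed
  obtain ⟨δ, hδ, hball⟩ := Metric.isOpen_iff.1 hcl.isOpen_compl μ hcon
  have hbij : Function.Bijective fun u => A u - μ • u := by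
    rw [conj_mulL2_sub_smul hA]
    refine V.symm.bijective.comp ((bijective_mulL2_sub_smul hδ fun x => ?_).comp V.bijective)
    by_contra hlt
    push Not at hlt
    refine hball (show m x ∈ Metric.ball μ δ from ?_) ⟨r x, hr x, (hm x).symm⟩
    rwa [Metric.mem_ball, dist_eq_norm]
  refine hμ (?_ : IsUnit (algebraMap ℂ (L2R →L[ℂ] L2R) μ - A))
  rw [← IsUnit.neg_iff, neg_sub, ContinuousLinearMap.isUnit_iff_bijective]
  convert! hbij using 1

lemma mem_continuousSpectrum_conj_mulL2 (hA : ∀ u, A u = V.symm (mulL2 m (V u)))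
    (hm : ∀ x, m x = r x) {μ : ℝ} (hμ : μ ∈ closure (Set.range r)) (hne : ∀ᵐ x, r x ≠ μ) :
    (μ : ℂ) ∈ continuousSpectrum A := by
  have hinj : Function.Injective fun u => A u - (μ : ℂ) • u := by
    rw [conj_mulL2_sub_smul hA]
    refine V.symm.injective.comp ((injective_mulL2_sub_smul ?_).comp V.injective)
    filter_upwards [hne] with x hx
    rw [hm]
    exact_mod_cast hx
  let T : L2R →L[ℂ] L2R := A - (μ : ℂ) • ContinuousLinearMap.id ℂ L2R
  have hT : (T : L2R → L2R) = fun u => A u - (μ : ℂ) • u := rfl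
  refine ⟨hinj, ?_, ?_⟩
  · rw [← hT] at hinj ⊢
    refine denseRange_of_isSelfAdjoint ?_ hinj
    refine (isSelfAdjoint_conj_mulL2 hA hm).sub ?_
    refine IsSelfAdjoint.smul (by simp [isSelfAdjoint_iff]) (IsSelfAdjoint.one _)
  · rw [← hT] at hinj ⊢
    refine not_surjective_of_approximate_kernel hinj fun ε hε => ?_
    obtain ⟨_, ⟨x₀, rfl⟩, hx₀⟩ := Metric.mem_closure_iff.1 hμ ε hε
    obtain ⟨u, hu, hu2⟩ := exists_norm_mulL2_sub_smul_le (m := m) (μ := μ) (ε := ε) (x₀ := x₀)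
      (by rw [hm, ← Complex.ofReal_sub, Complex.norm_real, ← dist_eq_norm, dist_comm]; exact hx₀)
    refine ⟨V.symm u, by simpa using hu, ?_⟩
    have h : T (V.symm u) = V.symm (mulL2 m u - (μ : ℂ) • u) := by
      have := congrFun (conj_mulL2_sub_smul hA (μ : ℂ)) (V.symm u)
      simpa using! this
    rwa [h, V.symm.norm_map, V.symm.norm_map]

lemma continuousSpectrum_subset_spectrum (A : L2R →L[ℂ] L2R) :
    continuousSpectrum A ⊆ spectrum ℂ A := by
  intro μ hμ hunit
  refine hμ.2.2 ?_
  have hunit' : IsUnit (algebraMap ℂ (L2R →L[ℂ] L2R) μ - A) := hunit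
  rw [← IsUnit.neg_iff, neg_sub, ContinuousLinearMap.isUnit_iff_bijective] at hunit'
  exact hunit'.2

/-- A chain of inclusions closes up: spectrum ⊆ `[a, b]` ⊆ continuous spectrum ⊆ spectrum. The
endpoint `b` is not a value of `r`, but only the closure of the range matters. -/
lemma spectrum_conj_mulL2 (hA : ∀ u, A u = V.symm (mulL2 m (V u)))
    (hm : ∀ x, m x = r x) {a b : ℝ} (hab : a ≠ b) (hr : Set.range r = Set.Ico a b)
    (hne : ∀ μ, ∀ᵐ x, r x ≠ μ) :
    spectrum ℂ A = Complex.ofReal '' Set.Icc a b ∧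
      continuousSpectrum A = Complex.ofReal '' Set.Icc a b := by
  have h1 : spectrum ℂ A ⊆ Complex.ofReal '' Set.Icc a b :=
    spectrum_conj_mulL2_subset hA hm fun x => Set.Ico_subset_Icc_self (hr ▸ Set.mem_range_self x)
  have h2 : Complex.ofReal '' Set.Icc a b ⊆ continuousSpectrum A := by
    rintro _ ⟨μ, hμ, rfl⟩
    refine mem_continuousSpectrum_conj_mulL2 hA hm ?_ (hne μ)
    rwa [hr, closure_Ico hab]
  have h3 := continuousSpectrum_subset_spectrum A
  exact ⟨h1.antisymm (h2.trans h3), (h3.trans h1).antisymm h2⟩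

lemma norm_conj_mulL2_eq_one (hA : ∀ u, A u = V.symm (mulL2 m (V u)))
    (hm : ∀ x, ‖m x‖ ≤ 1) (h1 : (1 : ℂ) ∈ spectrum ℂ A) : ‖A‖ = 1 := by
  refine le_antisymm (ContinuousLinearMap.opNorm_le_bound _ zero_le_one fun u => ?_) ?_
  · rw [hA, V.symm.norm_map, ← V.norm_map u]
    exact ((mulL2 m).le_opNorm _).trans
      (mul_le_mul_of_nonneg_right (norm_mulL2_le zero_le_one hm) (norm_nonneg _))
  · have h := spectrum.norm_le_norm_mul_of_mem h1
    rw [norm_one] at h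
    exact h.trans (mul_le_of_le_one_right (norm_nonneg _) ContinuousLinearMap.norm_id_le)

end Conjugate

end

noncomputable section

/-! ### Exponential averages of `airyG` -/

/-- Half of the exponential rate is spent on absorbing the linear factor. -/
lemma add_mul_exp_neg_le {lam y : ℝ} (hlam : 0 < lam) (hy : 0 ≤ y) {k : ℝ} (hk : 0 ≤ k) :
    (k + y) * Real.exp (-lam * y) ≤ (k + 2 / lam) * Real.exp (-(lam / 2) * y) := by
  have h1 : lam / 2 * y ≤ Real.exp (lam / 2 * y) := by
    linarith [Real.add_one_le_exp (lam / 2 * y)]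
  have h2 : Real.exp (-lam * y) * Real.exp (lam / 2 * y) = Real.exp (-(lam / 2) * y) := by
    rw [← Real.exp_add]; ring_nf
  have h3 : 1 ≤ Real.exp (lam / 2 * y) := Real.one_le_exp (by positivity)
  have h4 : k + y ≤ (k + 2 / lam) * Real.exp (lam / 2 * y) := by
    have h5 : y = 2 / lam * (lam / 2 * y) := by field_simp
    have h6 : 2 / lam * (lam / 2 * y) ≤ 2 / lam * Real.exp (lam / 2 * y) := by gcongr
    nlinarith
  calc (k + y) * Real.exp (-lam * y)
      ≤ (k + 2 / lam) * Real.exp (lam / 2 * y) * Real.exp (-lam * y) := by gcongr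
    _ = (k + 2 / lam) * (Real.exp (-lam * y) * Real.exp (lam / 2 * y)) := by ring
    _ = _ := by rw [h2]

lemma integrableOn_exp_neg_mul_Ioi {lam : ℝ} (hlam : 0 < lam) :
    IntegrableOn (fun y : ℝ => Real.exp (-lam * y)) (Set.Ioi 0) :=
  integrableOn_exp_mul_Ioi (neg_lt_zero.2 hlam) 0

/-- The average of `airyG (s - ·)` against the exponential distribution of rate `lam`. -/
def expAvgG (lam s : ℝ) : ℝ := ∫ y in Set.Ioi (0 : ℝ), airyG (s - y) * (lam * Real.exp (-lam * y))

lemma integrableOn_expAvgG {lam : ℝ} (hlam : 0 < lam) (s : ℝ) :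
    IntegrableOn (fun y => airyG (s - y) * (lam * Real.exp (-lam * y))) (Set.Ioi 0) := by
  obtain ⟨K, hK, hb⟩ := exists_abs_airyG_le
  exact ((integrableOn_exp_neg_mul_Ioi hlam).const_mul lam).bdd_mul
    (continuous_airyG.comp (by fun_prop)).aestronglyMeasurable
    (Eventually.of_forall fun y => hb (s - y))

lemma integrableOn_airyR_mul_exp_neg {lam : ℝ} (hlam : 0 < lam) (s : ℝ) :
    IntegrableOn (fun y => airyR 0 (s - y) * Real.exp (-lam * y)) (Set.Ioi 0) := by
  obtain ⟨C, hC, hb⟩ := exists_abs_airyR_zero_le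
  refine (((integrableOn_exp_neg_mul_Ioi (half_pos hlam)).const_mul
    (C * (1 + |s| + 2 / lam)))).mono'
    (((continuous_airyR 0).comp (by fun_prop)).mul (by fun_prop)).aestronglyMeasurable ?_
  filter_upwards [ae_restrict_mem measurableSet_Ioi] with y hy
  have hy : 0 < y := hy
  rw [norm_mul, Real.norm_of_nonneg (Real.exp_pos _).le, mul_assoc]
  calc ‖airyR 0 (s - y)‖ * Real.exp (-lam * y)
      ≤ (C * (1 + |s| + y)) * Real.exp (-lam * y) := by
        gcongr
        refine (hb _).trans ?_
        have := abs_sub s y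
        rw [abs_of_pos hy] at this
        exact mul_le_mul_of_nonneg_left (by linarith) hC
    _ ≤ _ := by
        rw [mul_assoc]
        exact mul_le_mul_of_nonneg_left (add_mul_exp_neg_le hlam hy.le (by positivity)) hC

/-- Integration by parts with `-G(s - y)` as primitive of `Ai(s - y)`. It turns Airy integrals
against the cutoff, which are only linearly dominated, into averages of the bounded function `G`. -/
lemma integral_airyR_mul_exp_neg {lam : ℝ} (hlam : 0 < lam) (s : ℝ) :
    ∫ y in Set.Ioi (0 : ℝ), airyR 0 (s - y) * Real.exp (-lam * y) = airyG s - expAvgG lam s := by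
  have hd : ∀ y ∈ Set.Ici (0 : ℝ), HasDerivAt (fun y => airyG (s - y) * Real.exp (-lam * y))
      (-(airyR 0 (s - y) * Real.exp (-lam * y))
        - airyG (s - y) * (lam * Real.exp (-lam * y))) y := by
    intro y _
    have h1 : HasDerivAt (fun y => airyG (s - y)) (airyR 0 (s - y) * (-1)) y :=
      (hasDerivAt_airyG (s - y)).comp y ((hasDerivAt_id y).const_sub s)
    have h2 : HasDerivAt (fun y => Real.exp (-lam * y)) (Real.exp (-lam * y) * (-lam * 1)) y :=
      ((hasDerivAt_id y).const_mul (-lam)).exp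
    exact (h1.mul h2).congr_deriv (by ring)
  have hlim : Tendsto (fun y => airyG (s - y) * Real.exp (-lam * y)) atTop (𝓝 0) := by
    have h1 : Tendsto (fun y : ℝ => s - y) atTop atBot :=
      tendsto_const_nhds.add_atBot tendsto_neg_atTop_atBot
    have h2 : Tendsto (fun y : ℝ => Real.exp (-lam * y)) atTop (𝓝 0) :=
      Real.tendsto_exp_atBot.comp (tendsto_id.const_mul_atTop_of_neg (neg_lt_zero.2 hlam))
    simpa using (tendsto_airyG_atBot.comp h1).mul h2
  have h1 := integrableOn_airyR_mul_exp_neg hlam s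
  have h2 := integrableOn_expAvgG hlam s
  have h := integral_Ioi_of_hasDerivAt_of_tendsto' hd (h1.neg.sub h2) hlim
  have h3 := integral_sub h1.neg h2
  simp only [Pi.neg_apply, integral_neg] at h3
  rw [h3] at h
  simp only [sub_zero, mul_zero, Real.exp_zero, mul_one] at h
  rw [expAvgG]
  linarith

/-- After rescaling, `lam` enters only through the argument of `G`, so limits in `lam` follow by
dominated convergence with a fixed weight. -/
lemma expAvgG_eq {lam : ℝ} (hlam : 0 < lam) (s : ℝ) :
    expAvgG lam s = ∫ y in Set.Ioi (0 : ℝ), airyG (s - y / lam) * Real.exp (-y) := by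
  have h := integral_comp_mul_left_Ioi (fun y => airyG (s - y / lam) * Real.exp (-y)) 0 hlam
  rw [mul_zero] at h
  have h2 : ∫ y in Set.Ioi (0 : ℝ), airyG (s - y / lam) * Real.exp (-y) =
      lam * ∫ y in Set.Ioi (0 : ℝ), airyG (s - lam * y / lam) * Real.exp (-(lam * y)) := by
    rw [h, smul_eq_mul, mul_inv_cancel_left₀ hlam.ne']
  rw [h2, expAvgG, ← integral_const_mul]
  congr 1 with y
  rw [mul_div_cancel_left₀ _ hlam.ne', neg_mul]
  ring

lemma abs_expAvgG_le {lam : ℝ} (hlam : 0 < lam) {K : ℝ} (hK : ∀ x, |airyG x| ≤ K) (s : ℝ) :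
    |expAvgG lam s| ≤ K := by
  rw [expAvgG_eq hlam]
  have h := norm_integral_le_of_norm_le (μ := volume.restrict (Set.Ioi (0 : ℝ)))
    (f := fun y => airyG (s - y / lam) * Real.exp (-y))
    (g := fun y => K * Real.exp (-y)) ((exp_neg_integrableOn_Ioi 0 one_pos).congr_fun
      (fun y _ => by ring_nf) measurableSet_Ioi |>.const_mul K)
    (Eventually.of_forall fun y => by
      rw [norm_mul, Real.norm_of_nonneg (Real.exp_pos _).le]
      exact mul_le_mul_of_nonneg_right (hK _) (Real.exp_pos _).le)
  rwa [integral_const_mul, integral_exp_neg_Ioi_zero, mul_one] at h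

lemma tendsto_expAvgG {lam : ℕ → ℝ} (hlam : ∀ n, 0 < lam n) {s L : ℝ}
    (h : ∀ y > 0, Tendsto (fun n => airyG (s - y / lam n)) atTop (𝓝 L)) :
    Tendsto (fun n => expAvgG (lam n) s) atTop (𝓝 L) := by
  obtain ⟨K, hK, hb⟩ := exists_abs_airyG_le
  simp_rw [expAvgG_eq (hlam _)]
  have hL : L = ∫ y in Set.Ioi (0 : ℝ), L * Real.exp (-y) := by
    rw [integral_const_mul, integral_exp_neg_Ioi_zero, mul_one]
  have hi : IntegrableOn (fun y : ℝ => Real.exp (-y)) (Set.Ioi 0) :=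
    (exp_neg_integrableOn_Ioi 0 one_pos).congr_fun (fun y _ => by ring_nf) measurableSet_Ioi
  rw [show (𝓝 L) = 𝓝 (∫ y in Set.Ioi (0 : ℝ), L * Real.exp (-y)) from congrArg 𝓝 hL]
  refine tendsto_integral_of_dominated_convergence (fun y => K * Real.exp (-y)) (fun n => ?_)
    (hi.const_mul K) (fun n => Eventually.of_forall fun y => ?_) ?_
  · exact ((continuous_airyG.comp (by fun_prop)).mul (by fun_prop)).aestronglyMeasurable
  · rw [norm_mul, Real.norm_of_nonneg (Real.exp_pos _).le]
    exact mul_le_mul_of_nonneg_right (hb _) (Real.exp_pos _).le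
  · filter_upwards [ae_restrict_mem measurableSet_Ioi] with y hy
    exact (h y hy).mul_const _

lemma tendsto_expAvgG_atTop {lam : ℕ → ℝ} (hlam : ∀ n, 0 < lam n) (h : Tendsto lam atTop atTop)
    (s : ℝ) : Tendsto (fun n => expAvgG (lam n) s) atTop (𝓝 (airyG s)) := by
  refine tendsto_expAvgG hlam fun y _ => (continuous_airyG.tendsto s).comp ?_
  simpa using (tendsto_const_nhds (x := s)).sub (h.const_div_atTop y)

/-- As the rate tends to `0` the average sees only `G` near `-∞`. The normalization `G(-∞) = 0` thus
ensures that removing the cutoff adds no constant to the multiplier. -/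
lemma tendsto_expAvgG_zero {lam : ℕ → ℝ} (hlam : ∀ n, 0 < lam n) (h : Tendsto lam atTop (𝓝 0))
    (s : ℝ) : Tendsto (fun n => expAvgG (lam n) s) atTop (𝓝 0) := by
  refine tendsto_expAvgG hlam fun y hy => tendsto_airyG_atBot.comp ?_
  refine tendsto_const_nhds.add_atBot (tendsto_neg_atTop_atBot.comp ?_)
  have h2 : Tendsto (fun n => (lam n)⁻¹) atTop atTop :=
    (tendsto_nhdsWithin_iff.2 ⟨h, Eventually.of_forall hlam⟩ :
      Tendsto lam atTop (𝓝[>] 0)).inv_tendsto_nhdsGT_zero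
  simpa [div_eq_mul_inv] using h2.const_mul_atTop hy

/-! ### The exponential cutoff and its Fourier transform -/

/-- The cutoff `e^{-aη} - e^{-bη}` on the positive half line. -/
def expCutoff (a b : ℝ) : ℝ → ℂ :=
  (Set.Ioi 0).indicator fun η => ((Real.exp (-a * η) - Real.exp (-b * η) : ℝ) : ℂ)

lemma measurable_expCutoff (a b : ℝ) : Measurable (expCutoff a b) :=
  (Continuous.measurable (by fun_prop)).indicator measurableSet_Ioi

lemma expCutoff_of_nonpos (a b : ℝ) {η : ℝ} (h : η ≤ 0) : expCutoff a b η = 0 :=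
  Set.indicator_of_notMem (by simpa using h) _

lemma expCutoff_of_pos (a b : ℝ) {η : ℝ} (h : 0 < η) :
    expCutoff a b η = ((Real.exp (-a * η) - Real.exp (-b * η) : ℝ) : ℂ) :=
  Set.indicator_of_mem (Set.mem_Ioi.2 h) _

lemma norm_expCutoff_le {a b : ℝ} (ha : 0 < a) (hb : 0 < b) (η : ℝ) : ‖expCutoff a b η‖ ≤ 1 := by
  rcases le_or_gt η 0 with h | h
  · simp [expCutoff_of_nonpos a b h]
  · rw [expCutoff_of_pos a b h, Complex.norm_real, Real.norm_eq_abs]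
    have h1 : Real.exp (-a * η) ≤ 1 := Real.exp_le_one_iff.2 (by nlinarith)
    have h2 : Real.exp (-b * η) ≤ 1 := Real.exp_le_one_iff.2 (by nlinarith)
    rw [abs_le]
    constructor <;> linarith [Real.exp_pos (-a * η), Real.exp_pos (-b * η)]

lemma integrable_add_abs_mul_expCutoff {a b : ℝ} (ha : 0 < a) (hb : 0 < b) {k : ℝ} (hk : 0 ≤ k) :
    Integrable fun η => ((k + |η| : ℝ) : ℂ) * expCutoff a b η := by
  have h : IntegrableOn (fun η => ((k + |η| : ℝ) : ℂ) *
      ((Real.exp (-a * η) - Real.exp (-b * η) : ℝ) : ℂ)) (Set.Ioi 0) := by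
    refine (((integrableOn_exp_neg_mul_Ioi (half_pos ha)).const_mul (k + 2 / a)).add
      ((integrableOn_exp_neg_mul_Ioi (half_pos hb)).const_mul (k + 2 / b))).mono'
      (Continuous.aestronglyMeasurable (by fun_prop)) ?_
    filter_upwards [ae_restrict_mem measurableSet_Ioi] with y hy
    have hy : 0 < y := hy
    rw [norm_mul, Complex.norm_real, Complex.norm_real, Real.norm_of_nonneg (by positivity),
      abs_of_pos hy]
    have h1 : ‖Real.exp (-a * y) - Real.exp (-b * y)‖ ≤ Real.exp (-a * y) + Real.exp (-b * y) :=
      (norm_sub_le _ _).trans_eq (by simp)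
    refine (mul_le_mul_of_nonneg_left h1 (by positivity)).trans ?_
    rw [mul_add]
    exact add_le_add (add_mul_exp_neg_le ha hy.le hk) (add_mul_exp_neg_le hb hy.le hk)
  refine (integrable_indicator_iff measurableSet_Ioi).2 h |>.congr (Eventually.of_forall fun η => ?_)
  rw [expCutoff, Set.indicator_mul_right]

lemma integrable_expCutoff {a b : ℝ} (ha : 0 < a) (hb : 0 < b) : Integrable (expCutoff a b) := by
  refine (integrable_add_abs_mul_expCutoff ha hb zero_le_one).mono
    (measurable_expCutoff a b).aestronglyMeasurable (Eventually.of_forall fun η => ?_)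
  rw [norm_mul, Complex.norm_real, Real.norm_of_nonneg (by positivity)]
  exact le_mul_of_one_le_left (norm_nonneg _) (by linarith [abs_nonneg η])

lemma tendsto_expCutoff {a b : ℕ → ℝ} (ha : Tendsto a atTop (𝓝 0)) (hb : Tendsto b atTop atTop)
    {η : ℝ} (hη : 0 < η) : Tendsto (fun n => expCutoff (a n) (b n) η) atTop (𝓝 1) := by
  simp_rw [expCutoff_of_pos _ _ hη]
  rw [← Complex.ofReal_one]
  refine (Complex.continuous_ofReal.tendsto 1).comp ?_
  have h1 : Tendsto (fun n => Real.exp (-a n * η)) atTop (𝓝 1) := by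
    have := (Real.continuous_exp.tendsto 0).comp
      (show Tendsto (fun n => -a n * η) atTop (𝓝 0) by simpa using ha.neg.mul_const η)
    rwa [Real.exp_zero] at this
  have h2 : Tendsto (fun n => Real.exp (-b n * η)) atTop (𝓝 0) :=
    Real.tendsto_exp_atBot.comp ((tendsto_neg_atTop_atBot.comp hb).atBot_mul_const hη)
  simpa using h1.sub h2

lemma integral_Ioi_exp_neg_mul_exp {a : ℝ} (ha : 0 < a) (z : ℝ) :
    ∫ η in Set.Ioi (0 : ℝ), Complex.exp (-(a + 2 * Real.pi * Complex.I * z) * η) =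
      (a + 2 * Real.pi * Complex.I * z)⁻¹ := by
  rw [integral_exp_mul_complex_Ioi (by simpa using ha)]
  rw [Complex.ofReal_zero, mul_zero, Complex.exp_zero, neg_div_neg_eq, one_div]

lemma fourier_expCutoff {a b : ℝ} (ha : 0 < a) (hb : 0 < b) (z : ℝ) :
    𝓕 (expCutoff a b) z =
      (a + 2 * Real.pi * Complex.I * z : ℂ)⁻¹ - (b + 2 * Real.pi * Complex.I * z : ℂ)⁻¹ := by
  rw [← integral_Ioi_exp_neg_mul_exp ha, ← integral_Ioi_exp_neg_mul_exp hb, ← integral_sub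
    (integrableOn_exp_mul_complex_Ioi (by simpa using ha) 0)
    (integrableOn_exp_mul_complex_Ioi (by simpa using hb) 0), Real.fourier_eq',
    ← integral_indicator measurableSet_Ioi]
  congr 1 with η
  rcases le_or_gt η 0 with h | h
  · rw [expCutoff_of_nonpos a b h, Set.indicator_of_notMem (by simpa using h), smul_zero]
  · rw [expCutoff_of_pos a b h, Set.indicator_of_mem (Set.mem_Ioi.2 h), smul_eq_mul,
      Complex.ofReal_sub, Complex.ofReal_exp, Complex.ofReal_exp, mul_sub, ← Complex.exp_add,
      ← Complex.exp_add]
    simp only [RCLike.inner_apply, conj_trivial]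
    push_cast
    ring_nf

/-- A single exponential jumps at `0` and its transform decays like `1/|z|` only. Subtracting the
second one removes the jump and gives decay like `1/z²`. -/
lemma integrable_fourier_expCutoff {a b : ℝ} (ha : 0 < a) (hb : 0 < b) :
    Integrable (𝓕 (expCutoff a b)) := by
  have hne : ∀ c : ℝ, 0 < c → ∀ z : ℝ, (c + 2 * Real.pi * Complex.I * z : ℂ) ≠ 0 := by
    intro c hc z h
    have := congrArg Complex.re h
    simp at this
    exact hc.ne' this
  have hlow : ∀ c : ℝ, 0 < c → ∀ z : ℝ,
      min c 1 * √(1 + z ^ 2) ≤ ‖(c + 2 * Real.pi * Complex.I * z : ℂ)‖ := by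
    intro c hc z
    have hm : 0 < min c 1 := lt_min hc one_pos
    rw [show (c + 2 * Real.pi * Complex.I * z : ℂ) = c + (2 * Real.pi * z : ℝ) * Complex.I by
      push_cast; ring, Complex.norm_add_mul_I]
    apply Real.le_sqrt_of_sq_le
    rw [mul_pow, Real.sq_sqrt (by positivity)]
    have h1 : min c 1 ^ 2 ≤ c ^ 2 := pow_le_pow_left₀ hm.le (min_le_left _ _) 2
    have h2 : min c 1 ^ 2 ≤ 1 := pow_le_one₀ hm.le (min_le_right _ _)
    have h3 : (1 : ℝ) ≤ (2 * Real.pi) ^ 2 := by nlinarith [Real.pi_gt_three]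
    have h4 : min c 1 ^ 2 * z ^ 2 ≤ 1 * z ^ 2 := by gcongr
    have h5 : 1 * z ^ 2 ≤ (2 * Real.pi) ^ 2 * z ^ 2 := by gcongr
    nlinarith
  have hfun : 𝓕 (expCutoff a b) = fun z : ℝ =>
      (a + 2 * Real.pi * Complex.I * z : ℂ)⁻¹ - (b + 2 * Real.pi * Complex.I * z : ℂ)⁻¹ :=
    funext (fourier_expCutoff ha hb)
  rw [hfun]
  have hma : 0 < min a 1 := lt_min ha one_pos
  have hmb : 0 < min b 1 := lt_min hb one_pos
  refine (integrable_inv_one_add_sq.const_mul (|b - a| / (min a 1 * min b 1))).mono'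
    (Continuous.aestronglyMeasurable ?_) (Eventually.of_forall fun z => ?_)
  · exact (Continuous.inv₀ (by fun_prop) (hne a ha)).sub (Continuous.inv₀ (by fun_prop) (hne b hb))
  · rw [inv_sub_inv (hne a ha z) (hne b hb z), norm_div, norm_mul,
      show (b + 2 * Real.pi * Complex.I * z - (a + 2 * Real.pi * Complex.I * z) : ℂ) =
        ((b - a : ℝ) : ℂ) by push_cast; ring, Complex.norm_real, Real.norm_eq_abs,
      ← div_eq_mul_inv, div_div]
    refine div_le_div_of_nonneg_left (abs_nonneg _) (by positivity) ?_
    calc min a 1 * min b 1 * (1 + z ^ 2)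
        = (min a 1 * √(1 + z ^ 2)) * (min b 1 * √(1 + z ^ 2)) := by
          have := Real.mul_self_sqrt (show 0 ≤ 1 + z ^ 2 by positivity)
          linear_combination (-(min a 1 * min b 1)) * this
      _ ≤ _ := mul_le_mul (hlow a ha z) (hlow b hb z) (by positivity) (norm_nonneg _)

end

noncomputable section

/-! ### The oscillatory integral with cubic phase as an average of `airyG` -/

/-- The scale `2^{4/3} π^{2/3}` of the multiplier. -/
def airyScale : ℝ := (2 : ℝ) ^ (4 / 3 : ℝ) * Real.pi ^ (2 / 3 : ℝ)

lemma airyScale_pos : 0 < airyScale := by unfold airyScale; positivity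

/-- This is the condition on `c` for `cubicPhase (c t) = e^{i(2πt)³/3}`: `πc³/6 = (2π)³/3`. -/
lemma airyScale_pow_three : airyScale ^ 3 = 16 * Real.pi ^ 2 := by
  rw [airyScale, mul_pow, ← Real.rpow_natCast, ← Real.rpow_natCast, ← Real.rpow_mul (by norm_num),
    ← Real.rpow_mul Real.pi_pos.le]
  norm_num

/-- The unimodular function `z ↦ e^{iπz³/6}`. -/
def cubicPhase (z : ℝ) : ℂ := Complex.exp (((Real.pi * z ^ 3 / 6 : ℝ) : ℂ) * Complex.I)

lemma continuous_cubicPhase : Continuous cubicPhase := by unfold cubicPhase; fun_prop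

lemma norm_cubicPhase (z : ℝ) : ‖cubicPhase z‖ = 1 := Complex.norm_exp_ofReal_mul_I _

lemma fourierInv_comp_sub_div {f : ℝ → ℂ} {c : ℝ} (hc : 0 < c) (s t : ℝ) :
    𝓕⁻ (fun x => f ((s - x) / c)) t =
      c * (Complex.exp ((2 * Real.pi * (s * t) : ℝ) * Complex.I) * 𝓕 f (c * t)) := by
  rw [Real.fourierInv_eq', Real.fourier_eq']
  have h1 := integral_sub_left_eq_self (μ := volume) (fun x : ℝ =>
    Complex.exp (↑(2 * Real.pi * inner ℝ (s - x) t) * Complex.I) • f (x / c)) s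
  have h2 := Measure.integral_comp_div (fun y : ℝ =>
    Complex.exp (↑(2 * Real.pi * inner ℝ (s - c * y) t) * Complex.I) • f y) c
  rw [abs_of_pos hc] at h2
  simp only [sub_sub_cancel] at h1
  rw [h1]
  simp only [mul_div_cancel₀ _ hc.ne'] at h2
  rw [h2, ← integral_const_mul, Complex.real_smul]
  congr 2 with y
  rw [smul_eq_mul, smul_eq_mul, ← mul_assoc, ← Complex.exp_add]
  congr 2
  simp only [RCLike.inner_apply, conj_trivial]
  push_cast
  ring

lemma integral_airyAi_mul_expCutoff {a b c : ℝ} (ha : 0 < a) (hb : 0 < b) (hc : 0 < c) (s : ℝ) :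
    ∫ x : ℝ, airyAi x * expCutoff a b ((s - x) / c) =
      ((expAvgG (b / c) s - expAvgG (a / c) s : ℝ) : ℂ) := by
  have h1 := integral_airyR_mul_exp_neg (div_pos ha hc) s
  have h2 := integral_airyR_mul_exp_neg (div_pos hb hc) s
  have h3 := integral_sub (integrableOn_airyR_mul_exp_neg (div_pos ha hc) s)
    (integrableOn_airyR_mul_exp_neg (div_pos hb hc) s)
  rw [h1, h2] at h3
  rw [show expAvgG (b / c) s - expAvgG (a / c) s =
    airyG s - expAvgG (a / c) s - (airyG s - expAvgG (b / c) s) by ring, ← h3,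
    ← integral_complex_ofReal, ← integral_sub_left_eq_self _ _ s,
    ← integral_indicator measurableSet_Ioi]
  congr 1 with y
  simp only [sub_sub_cancel]
  rcases le_or_gt y 0 with h | h
  · rw [expCutoff_of_nonpos a b (div_nonpos_of_nonpos_of_nonneg h hc.le),
      Set.indicator_of_notMem (by simpa using h), mul_zero]
  · rw [expCutoff_of_pos a b (div_pos h hc), Set.indicator_of_mem (Set.mem_Ioi.2 h), ← airyD_zero,
      ← ofReal_airyR, ← Complex.ofReal_mul]
    congr 1
    rw [mul_sub]
    ring_nf

/-- Substitute `z = ct` and read the result as the pairing of `Ai` with the cutoff in the variable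
`(cτ - x)/c`, through `integral_airyAi_mul`. -/
lemma integral_cubicPhase_mul_fourier_expCutoff {a b : ℝ} (ha : 0 < a) (hb : 0 < b) (τ : ℝ) :
    ∫ z : ℝ, Complex.exp ((2 * Real.pi * (z * τ) : ℝ) * Complex.I) *
        (cubicPhase z * 𝓕 (expCutoff a b) z) =
      ((expAvgG (b / airyScale) (airyScale * τ) - expAvgG (a / airyScale) (airyScale * τ) : ℝ) :
        ℂ) := by
  have hc := airyScale_pos
  have hc3 := airyScale_pow_three
  set c := airyScale
  rw [← integral_airyAi_mul_expCutoff ha hb hc]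
  have hcomp : ∀ {f : ℝ → ℂ}, Integrable f → Integrable fun x => f ((c * τ - x) / c) :=
    fun hf => (hf.comp_div hc.ne').comp_sub_left (c * τ)
  have hφ := hcomp (integrable_expCutoff ha hb)
  have hφ1 : Integrable fun x : ℝ => (1 + |x| : ℝ) * expCutoff a b ((c * τ - x) / c) := by
    -- This constant makes `c(k + |η|) ≥ 1 + |x|` for `η = (cτ - x)/c`.
    have hk : 0 ≤ (1 + |c * τ|) / c := by positivity
    refine ((hcomp (integrable_add_abs_mul_expCutoff ha hb hk)).const_mul (c : ℂ)).mono
      ((Continuous.aestronglyMeasurable (by fun_prop)).mul hφ.aestronglyMeasurable)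
      (Eventually.of_forall fun x => ?_)
    rw [norm_mul, norm_mul, norm_mul, ← mul_assoc, Complex.norm_real, Complex.norm_real,
      Complex.norm_real]
    refine mul_le_mul_of_nonneg_right ?_ (norm_nonneg _)
    rw [Real.norm_of_nonneg (by positivity), Real.norm_of_nonneg hc.le,
      Real.norm_of_nonneg (by positivity), abs_div, abs_of_pos hc, mul_add, mul_div_cancel₀ _ hc.ne',
      mul_div_cancel₀ _ hc.ne']
    have := abs_sub_abs_le_abs_sub x (c * τ)
    rw [abs_sub_comm] at this
    linarith
  have hF : 𝓕⁻ (fun x => expCutoff a b ((c * τ - x) / c)) = fun t =>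
      c * (Complex.exp ((2 * Real.pi * (c * τ * t) : ℝ) * Complex.I) *
        𝓕 (expCutoff a b) (c * t)) := funext fun t => fourierInv_comp_sub_div hc (c * τ) t
  have hFi : Integrable (𝓕⁻ (fun x => expCutoff a b ((c * τ - x) / c))) := by
    rw [hF]
    have h := (integrable_fourier_expCutoff ha hb).comp_mul_left' hc.ne'
    refine (h.bdd_mul (c := 1) (Continuous.aestronglyMeasurable (by fun_prop))
      (Eventually.of_forall fun t => (Complex.norm_exp_ofReal_mul_I _).le)).const_mul _
  rw [integral_airyAi_mul hφ hφ1 hFi, hF]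
  have h := Measure.integral_comp_mul_left (fun z : ℝ =>
    Complex.exp ((2 * Real.pi * (z * τ) : ℝ) * Complex.I) *
        (cubicPhase z * 𝓕 (expCutoff a b) z)) c
  rw [abs_of_pos (inv_pos.2 hc), Complex.real_smul, Complex.ofReal_inv,
    eq_inv_mul_iff_mul_eq₀ (by exact_mod_cast hc.ne'), ← integral_const_mul] at h
  rw [← h]
  congr 1 with t
  have hph : cubicPhase (c * t) = Complex.exp (Complex.I * (2 * Real.pi * t) ^ 3 / 3) := by
    rw [cubicPhase, mul_pow, hc3]
    congr 1
    push_cast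
    ring
  rw [hph]
  ring_nf

end

noncomputable section

open BoundedContinuousFunction

/-! ### Translations on `L²(ℝ)` and the Fourier transform of a correlation -/

/-- Translation by `z` on `L²(ℝ)`. -/
def translateL2 (z : ℝ) : L2R →L[ℂ] L2R :=
  (Lp.compMeasurePreservingₗᵢ ℂ (fun x : ℝ => x + z)
    (measurePreserving_add_right volume z)).toContinuousLinearMap

lemma coeFn_translateL2 (z : ℝ) (u : L2R) : translateL2 z u =ᵐ[volume] fun x => u (x + z) :=
  Lp.coeFn_compMeasurePreserving u (measurePreserving_add_right volume z)

/-- The character `τ ↦ e^{2πi zτ}`. -/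
def charBCF (z : ℝ) : ℝ →ᵇ ℂ :=
  BoundedContinuousFunction.ofNormedAddCommGroup
    (fun τ => Complex.exp ((2 * Real.pi * (z * τ) : ℝ) * Complex.I)) (by fun_prop) 1
    fun _ => (Complex.norm_exp_ofReal_mul_I _).le

lemma charBCF_apply (z τ : ℝ) :
    charBCF z τ = Complex.exp ((2 * Real.pi * (z * τ) : ℝ) * Complex.I) := rfl

lemma fourier_comp_add_right (f : ℝ → ℂ) (z w : ℝ) :
    𝓕 (fun x => f (x + z)) w = charBCF z w * 𝓕 f w := by
  rw [Real.fourier_eq', Real.fourier_eq', ← integral_const_mul,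
    ← integral_add_right_eq_self _ (-z)]
  congr 1 with x
  rw [smul_eq_mul, smul_eq_mul, charBCF_apply, ← mul_assoc, ← Complex.exp_add, neg_add_cancel_right]
  congr 2
  simp only [RCLike.inner_apply, conj_trivial]
  push_cast
  ring

lemma fourier_translateL2 (z : ℝ) (u : L2R) :
    (𝓕 (translateL2 z u) : L2R) = mulL2 (charBCF z) (𝓕 u) := by
  refine DenseRange.induction_on (p := fun u : L2R =>
      (𝓕 (translateL2 z u) : L2R) = mulL2 (charBCF z) (𝓕 u))
    (SchwartzMap.denseRange_toLpCLM (F := ℂ) (E := ℝ) (μ := volume) (p := 2)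
      ENNReal.ofNat_ne_top) u ?_ fun f => ?_
  · exact isClosed_eq
      ((Lp.fourierTransformₗᵢ ℝ ℂ).continuous.comp (translateL2 z).continuous)
      ((mulL2 (charBCF z)).continuous.comp (Lp.fourierTransformₗᵢ ℝ ℂ).continuous)
  · change (𝓕 (translateL2 z (f.toLp 2)) : L2R) = mulL2 (charBCF z) (𝓕 (f.toLp 2) : L2R)
    have h1 : translateL2 z (f.toLp 2) = (f.compSubConstCLM ℂ (-z)).toLp 2 := by
      ext1
      have h := (measurePreserving_add_right volume z).quasiMeasurePreserving.ae
        (f.coeFn_toLp 2 volume)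
      filter_upwards [coeFn_translateL2 z (f.toLp 2), h,
        (f.compSubConstCLM ℂ (-z)).coeFn_toLp 2 volume] with x e1 e2 e3
      rw [e1, e2, e3, compSubConstCLM_apply, sub_neg_eq_add]
    rw [h1, SchwartzMap.toLp_fourier_eq, SchwartzMap.toLp_fourier_eq]
    ext1
    filter_upwards [(𝓕 (f.compSubConstCLM ℂ (-z))).coeFn_toLp 2 volume,
      coeFn_mulL2 (charBCF z) ((𝓕 f).toLp 2), (𝓕 f).coeFn_toLp 2 volume] with x e1 e2 e3
    rw [e1, e2, e3, SchwartzMap.fourier_coe, SchwartzMap.fourier_coe, ← fourier_comp_add_right]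
    refine congrArg (fun F : ℝ → ℂ => 𝓕 F x) (funext fun y => ?_)
    rw [compSubConstCLM_apply, sub_neg_eq_add]

/-- The correlation at lag `z` is the inner product of `h` with a translate of `g`; under Plancherel
the translation becomes a character. -/
lemma integral_correlation {g h : ℝ → ℂ} (hg : MemLp g 2) (hh : MemLp h 2) (z : ℝ) :
    ∫ x, g (x + z / 2) * (starRingEnd ℂ) (h (x - z / 2)) =
      ∫ τ, charBCF z τ * ((𝓕 (hg.toLp g) : L2R) τ *
        (starRingEnd ℂ) ((𝓕 (hh.toLp h) : L2R) τ)) := by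
  have h1 : inner ℂ (hh.toLp h) (translateL2 z (hg.toLp g)) =
      ∫ x, g (x + z / 2) * (starRingEnd ℂ) (h (x - z / 2)) := by
    rw [L2.inner_def, ← integral_add_right_eq_self
      (fun x => g (x + z / 2) * (starRingEnd ℂ) (h (x - z / 2))) (z / 2)]
    refine integral_congr_ae ?_
    have h := (measurePreserving_add_right volume z).quasiMeasurePreserving.ae hg.coeFn_toLp
    filter_upwards [coeFn_translateL2 z (hg.toLp g), h, hh.coeFn_toLp] with x e1 e2 e3
    rw [e1, e2, e3, RCLike.inner_apply, add_assoc, add_halves, add_sub_cancel_right]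
  rw [← h1, ← Lp.inner_fourier_eq, fourier_translateL2, L2.inner_def]
  refine integral_congr_ae ?_
  filter_upwards [coeFn_mulL2 (charBCF z) (𝓕 (hg.toLp g) : L2R)] with τ e1
  rw [e1, RCLike.inner_apply, mul_assoc]

lemma integrable_mul_conj {g h : ℝ → ℂ} (hg : MemLp g 2) (hh : MemLp h 2) :
    Integrable fun x => g x * (starRingEnd ℂ) (h x) :=
  hg.integrable_mul hh.star

/-- Pairing of the inverse Fourier transform of an integrable function with a product of Fourier
transforms of square integrable functions. -/
lemma integral_mul_correlation {g h F : ℝ → ℂ} (hg : MemLp g 2) (hh : MemLp h 2)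
    (hF : Integrable F) :
    ∫ z, F z * ∫ x, g (x + z / 2) * (starRingEnd ℂ) (h (x - z / 2)) =
      ∫ τ, (∫ z, charBCF z τ * F z) * ((𝓕 (hg.toLp g) : L2R) τ *
        (starRingEnd ℂ) ((𝓕 (hh.toLp h) : L2R) τ)) := by
  have hp := integrable_mul_conj (Lp.memLp (𝓕 (hg.toLp g) : L2R)) (Lp.memLp (𝓕 (hh.toLp h) : L2R))
  simp_rw [integral_correlation hg hh, ← integral_const_mul, ← integral_mul_const]
  rw [integral_integral_swap]
  · congr 1 with τ
    congr 1 with z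
    ring
  · refine (hF.mul_prod hp).mono ?_ (ae_of_all _ fun p => ?_)
    · refine (hF.aestronglyMeasurable.comp_fst).mul (AEStronglyMeasurable.mul ?_
        hp.aestronglyMeasurable.comp_snd)
      simp only [charBCF_apply]
      exact Continuous.aestronglyMeasurable (by fun_prop)
    · simp only [Function.uncurry_def, norm_mul, charBCF_apply, Complex.norm_exp_ofReal_mul_I,
        one_mul, le_refl]

end

noncomputable section

open BoundedContinuousFunction

/-! ### The Wigner distribution over the epigraph of the parabola -/

/-- The chirp `x ↦ e^{2πi x³/3}`. -/
def chirp : ℝ →ᵇ ℂ :=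
  BoundedContinuousFunction.ofNormedAddCommGroup
    (fun x => Complex.exp ((2 * Real.pi * x ^ 3 / 3 : ℝ) * Complex.I)) (by fun_prop) 1
    fun _ => (Complex.norm_exp_ofReal_mul_I _).le

lemma chirp_apply (x : ℝ) : chirp x = Complex.exp ((2 * Real.pi * x ^ 3 / 3 : ℝ) * Complex.I) := rfl

lemma norm_chirp (x : ℝ) : ‖chirp x‖ = 1 := Complex.norm_exp_ofReal_mul_I _

lemma star_chirp_apply (x : ℝ) : star chirp x = (starRingEnd ℂ) (chirp x) := rfl

lemma chirp_mul_star_chirp (x : ℝ) : chirp x * star chirp x = 1 := by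
  rw [star_chirp_apply, Complex.mul_conj', norm_chirp]; norm_num

/-- The kernel of the Wigner distribution, before the Fourier transform in `z`. -/
def wignerKernel (g h : ℝ → ℂ) (x z : ℝ) : ℂ :=
  g (x + z / 2) * (starRingEnd ℂ) (h (x - z / 2))

lemma wigner_eq_fourier (u v : ℝ → ℂ) (x η : ℝ) :
    wigner u v (x, η) = 𝓕 (wignerKernel u v x) η := by
  rw [Real.fourier_eq', wigner]
  congr 1 with z
  rw [smul_eq_mul, wignerKernel, mul_assoc]
  congr 2
  simp only [RCLike.inner_apply, conj_trivial]
  push_cast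
  ring

/-- From `(x+z/2)³ - (x-z/2)³ = 3x²z + z³/4`. The cubic coefficient of the chirp is chosen so that
the part depending on `x` is the character of frequency `x²`; the remaining phase does not depend on
`x`. -/
lemma chirp_mul_conj_chirp (x z : ℝ) :
    chirp (x + z / 2) * (starRingEnd ℂ) (chirp (x - z / 2)) =
      Complex.exp ((2 * Real.pi * (x ^ 2 * z) : ℝ) * Complex.I) * cubicPhase z := by
  rw [chirp_apply, chirp_apply, cubicPhase, ← Complex.exp_conj, ← Complex.exp_add,
    ← Complex.exp_add]
  congr 1
  simp only [map_mul, Complex.conj_ofReal, Complex.conj_I]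
  push_cast
  ring

/-- The character of frequency `x²` from the chirps cancels the frequency shift of the shear. Only
the phase `cubicPhase`, the same for all `x`, remains. -/
lemma wigner_shear (u v : ℝ → ℂ) (x η : ℝ) :
    wigner u v (x, η + x ^ 2) = 𝓕 (fun z => cubicPhase z *
      wignerKernel (fun y => star chirp y * u y) (fun y => star chirp y * v y) x z) η := by
  rw [wigner_eq_fourier, Real.fourier_eq', Real.fourier_eq']
  congr 1 with z
  have hu : ∀ w : ℝ → ℂ, ∀ y, w y = chirp y * (star chirp y * w y) := fun w y => by
    rw [← mul_assoc, chirp_mul_star_chirp, one_mul]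
  have h : wignerKernel u v x z = Complex.exp ((2 * Real.pi * (x ^ 2 * z) : ℝ) * Complex.I) *
      (cubicPhase z *
        wignerKernel (fun y => star chirp y * u y) (fun y => star chirp y * v y) x z) := by
    rw [← mul_assoc, ← chirp_mul_conj_chirp]
    simp only [wignerKernel]
    conv_lhs => rw [hu u (x + z / 2), hu v (x - z / 2), map_mul]
    ring
  rw [h, smul_eq_mul, smul_eq_mul, ← mul_assoc, ← Complex.exp_add]
  congr 2
  simp only [RCLike.inner_apply, conj_trivial]
  push_cast
  ring

section Kernel

variable {g h : ℝ → ℂ}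

lemma norm_wignerKernel_le (x z : ℝ) : ‖wignerKernel g h x z‖ ≤
    (‖g (x + z / 2)‖ ^ 2 + ‖h (x - z / 2)‖ ^ 2) / 2 := by
  rw [wignerKernel, norm_mul, RCLike.norm_conj]
  nlinarith [sq_nonneg (‖g (x + z / 2)‖ - ‖h (x - z / 2)‖)]

lemma measurable_wignerKernel (hg : StronglyMeasurable g) (hh : StronglyMeasurable h) :
    StronglyMeasurable fun p : ℝ × ℝ => wignerKernel g h p.1 p.2 :=
  (hg.comp_measurable (by fun_prop)).mul
    (Complex.continuous_conj.comp_stronglyMeasurable (hh.comp_measurable (by fun_prop)))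

lemma integrable_comp_add_half {f : ℝ → ℝ} (hf : Integrable f) (x : ℝ) :
    Integrable fun z => f (x + z / 2) :=
  (hf.comp_add_left x).comp_div two_ne_zero

lemma integrable_comp_sub_half {f : ℝ → ℝ} (hf : Integrable f) (x : ℝ) :
    Integrable fun z => f (x - z / 2) :=
  (hf.comp_sub_left x).comp_div two_ne_zero

lemma integral_comp_add_half (f : ℝ → ℝ) (x : ℝ) : ∫ z, f (x + z / 2) = 2 * ∫ z, f z := by
  rw [Measure.integral_comp_div (fun z => f (x + z)), integral_add_left_eq_self f x]
  norm_num

lemma integral_comp_sub_half (f : ℝ → ℝ) (x : ℝ) : ∫ z, f (x - z / 2) = 2 * ∫ z, f z := by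
  rw [Measure.integral_comp_div (fun z => f (x - z)), integral_sub_left_eq_self f _ x]
  norm_num

lemma integrable_wignerKernel_left (hg : StronglyMeasurable g) (hh : StronglyMeasurable h)
    (hg2 : Integrable fun x => ‖g x‖ ^ 2) (hh2 : Integrable fun x => ‖h x‖ ^ 2) (x : ℝ) :
    Integrable (wignerKernel g h x) :=
  (((integrable_comp_add_half hg2 x).add (integrable_comp_sub_half hh2 x)).div_const 2).mono'
    ((measurable_wignerKernel hg hh).comp_measurable (by fun_prop :
      Measurable fun z : ℝ => (x, z))).aestronglyMeasurable
    (ae_of_all _ fun z => norm_wignerKernel_le x z)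

lemma integrable_wignerKernel_right (hg : StronglyMeasurable g) (hh : StronglyMeasurable h)
    (hg2 : Integrable fun x => ‖g x‖ ^ 2) (hh2 : Integrable fun x => ‖h x‖ ^ 2) (z : ℝ) :
    Integrable fun x => wignerKernel g h x z :=
  (((hg2.comp_add_right (z / 2)).add (hh2.comp_sub_right (z / 2))).div_const 2).mono'
    ((measurable_wignerKernel hg hh).comp_measurable (by fun_prop :
      Measurable fun x : ℝ => (x, z))).aestronglyMeasurable
    (ae_of_all _ fun x => norm_wignerKernel_le x z)

/-- Uniformity in `s` and `z` provides the domination when the `x`-domain is exhausted. -/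
lemma norm_setIntegral_wignerKernel_right_le
    (hg2 : Integrable fun x => ‖g x‖ ^ 2) (hh2 : Integrable fun x => ‖h x‖ ^ 2) (s : Set ℝ)
    (z : ℝ) :
    ‖∫ x in s, wignerKernel g h x z‖ ≤ ((∫ x, ‖g x‖ ^ 2) + ∫ x, ‖h x‖ ^ 2) / 2 := by
  have hi : Integrable fun x => (‖g (x + z / 2)‖ ^ 2 + ‖h (x - z / 2)‖ ^ 2) / 2 :=
    ((hg2.comp_add_right (z / 2)).add (hh2.comp_sub_right (z / 2))).div_const 2
  have h1 := norm_integral_le_of_norm_le (hi.integrableOn (s := s))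
    (ae_of_all _ fun x => norm_wignerKernel_le (g := g) (h := h) x z)
  refine h1.trans ((setIntegral_le_integral hi (ae_of_all _ fun x => by positivity)).trans_eq ?_)
  rw [integral_div, integral_add (hg2.comp_add_right (z / 2)) (hh2.comp_sub_right (z / 2)),
    integral_add_right_eq_self (fun x => ‖g x‖ ^ 2),
    integral_sub_right_eq_self (fun x => ‖h x‖ ^ 2)]

lemma integrable_wignerKernel_prod (hg : StronglyMeasurable g) (hh : StronglyMeasurable h)
    (hg2 : Integrable fun x => ‖g x‖ ^ 2) (hh2 : Integrable fun x => ‖h x‖ ^ 2) {s : Set ℝ}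
    (hs : volume s ≠ ⊤) :
    Integrable (fun p : ℝ × ℝ => wignerKernel g h p.1 p.2)
      ((volume.restrict s).prod volume) := by
  have : IsFiniteMeasure (volume.restrict s) := ⟨by simpa using hs.lt_top⟩
  have hg3 : Integrable (fun p : ℝ × ℝ => ‖g (p.1 + p.2 / 2)‖ ^ 2)
      ((volume.restrict s).prod volume) := by
    refine (integrable_prod_iff (((hg.norm.pow 2).comp_measurable
      (by fun_prop : Measurable fun p : ℝ × ℝ => p.1 + p.2 / 2)).aestronglyMeasurable)).2
      ⟨ae_of_all _ fun x => integrable_comp_add_half hg2 x, ?_⟩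
    refine (integrable_const (2 * ∫ x, ‖g x‖ ^ 2)).congr (ae_of_all _ fun x => ?_)
    simp [integral_comp_add_half fun x => ‖g x‖ ^ 2]
  have hh3 : Integrable (fun p : ℝ × ℝ => ‖h (p.1 - p.2 / 2)‖ ^ 2)
      ((volume.restrict s).prod volume) := by
    refine (integrable_prod_iff (((hh.norm.pow 2).comp_measurable
      (by fun_prop : Measurable fun p : ℝ × ℝ => p.1 - p.2 / 2)).aestronglyMeasurable)).2
      ⟨ae_of_all _ fun x => integrable_comp_sub_half hh2 x, ?_⟩
    refine (integrable_const (2 * ∫ x, ‖h x‖ ^ 2)).congr (ae_of_all _ fun x => ?_)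
    simp [integral_comp_sub_half fun x => ‖h x‖ ^ 2]
  exact ((hg3.add hh3).div_const 2).mono' (measurable_wignerKernel hg hh).aestronglyMeasurable
    (ae_of_all _ fun p => norm_wignerKernel_le p.1 p.2)

end Kernel

lemma integral_fourier_mul {f φ : ℝ → ℂ} (hf : Integrable f) (hφ : Integrable φ) :
    ∫ η, f η * 𝓕 φ η = ∫ z, 𝓕 f z * φ z := by
  have := VectorFourier.integral_fourierIntegral_smul_eq_flip (μ := volume) (ν := volume)
    (L := innerₗ ℝ) Real.continuous_fourierChar continuous_inner hf hφ
  simpa using! this.symm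

/-- Pairing with a cutoff in the shifted frequency. -/
lemma integral_integral_cutoff_mul {g h f : ℝ → ℂ} (hg : StronglyMeasurable g)
    (hh : StronglyMeasurable h) (hg2 : MemLp g 2) (hh2 : MemLp h 2) (hf : Integrable f)
    (hF : Integrable (𝓕 f))
    (hJ : Integrable fun x => ∫ η, f η * 𝓕 (fun z => cubicPhase z * wignerKernel g h x z) η) :
    ∫ x, ∫ η, f η * 𝓕 (fun z => cubicPhase z * wignerKernel g h x z) η =
      ∫ τ, (∫ z, charBCF z τ * (cubicPhase z * 𝓕 f z)) * ((𝓕 (hg2.toLp g) : L2R) τ *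
        (starRingEnd ℂ) ((𝓕 (hh2.toLp h) : L2R) τ)) := by
  have hgs := (memLp_two_iff_integrable_sq_norm hg2.1).1 hg2
  have hhs := (memLp_two_iff_integrable_sq_norm hh2.1).1 hh2
  have hk := integrable_wignerKernel_left hg hh hgs hhs
  have hcF : Integrable fun z => cubicPhase z * 𝓕 f z :=
    hF.bdd_mul (c := 1) continuous_cubicPhase.aestronglyMeasurable
      (ae_of_all _ fun z => (norm_cubicPhase z).le)
  have hpair : ∀ x, ∫ η, f η * 𝓕 (fun z => cubicPhase z * wignerKernel g h x z) η =
      ∫ z, (cubicPhase z * 𝓕 f z) * wignerKernel g h x z := fun x => by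
    rw [integral_fourier_mul hf ((hk x).bdd_mul (c := 1) continuous_cubicPhase.aestronglyMeasurable
      (ae_of_all _ fun z => (norm_cubicPhase z).le))]
    congr 1 with z
    ring
  rw [← integral_mul_correlation hg2 hh2 hcF]
  -- For general square integrable `g` and `h` the kernel need not be integrable on the plane, so
  -- Fubini is used on `|x| ≤ R` and then `R → ∞`.
  have hcov : AECover volume atTop fun R : ℝ => Set.Icc (-R) R :=
    aecover_Icc tendsto_neg_atTop_atBot tendsto_id
  have lim1 := hcov.integral_tendsto_of_countably_generated hJ
  refine tendsto_nhds_unique lim1 ?_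
  have hswap : ∀ R : ℝ, ∫ x in Set.Icc (-R) R,
      ∫ η, f η * 𝓕 (fun z => cubicPhase z * wignerKernel g h x z) η =
      ∫ z, (cubicPhase z * 𝓕 f z) * ∫ x in Set.Icc (-R) R, wignerKernel g h x z := fun R => by
    simp_rw [hpair, ← integral_const_mul]
    rw [integral_integral_swap]
    have hbd : ∀ z, ‖cubicPhase z * 𝓕 f z‖ ≤ ∫ η, ‖f η‖ := fun z => by
      rw [norm_mul, norm_cubicPhase, one_mul]
      exact VectorFourier.norm_fourierIntegral_le_integral_norm _ _ _ _ _
    exact (integrable_wignerKernel_prod hg hh hgs hhs isCompact_Icc.measure_lt_top.ne).bdd_mul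
      hcF.aestronglyMeasurable.comp_snd (ae_of_all _ fun p => hbd p.2)
  refine Tendsto.congr (fun R => (hswap R).symm) ?_
  refine tendsto_integral_filter_of_dominated_convergence
    (fun z => ‖cubicPhase z * 𝓕 f z‖ * (((∫ x, ‖g x‖ ^ 2) + ∫ x, ‖h x‖ ^ 2) / 2))
    (Eventually.of_forall fun R => hcF.aestronglyMeasurable.mul ?_)
    (Eventually.of_forall fun R => ae_of_all _ fun z => ?_) (hcF.norm.mul_const _)
    (ae_of_all _ fun z => Tendsto.const_mul _ ?_)
  · exact (StronglyMeasurable.integral_prod_left (f := wignerKernel g h)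
      (measurable_wignerKernel hg hh)).aestronglyMeasurable
  · rw [norm_mul]
    exact mul_le_mul_of_nonneg_left (norm_setIntegral_wignerKernel_right_le hgs hhs _ z)
      (norm_nonneg _)
  · exact hcov.integral_tendsto_of_countably_generated
      (integrable_wignerKernel_right hg hh hgs hhs z)

end

/-! ### Shearing the epigraph to a half plane, and removing the cutoff -/

noncomputable section

open BoundedContinuousFunction

/-- The shear `(x, η) ↦ (x, η + x²)`, which maps the half plane `η ≥ 0` to the epigraph. -/
def parabolaShear : ℝ × ℝ ≃ₜ ℝ × ℝ where
  toFun p := (p.1, p.2 + p.1 ^ 2)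
  invFun p := (p.1, p.2 - p.1 ^ 2)
  left_inv p := by simp
  right_inv p := by simp
  continuous_toFun := by fun_prop
  continuous_invFun := by fun_prop

lemma measurePreserving_parabolaShear : MeasurePreserving parabolaShear :=
  (MeasurePreserving.id volume).skew_product (g := fun x y : ℝ => y + x ^ 2) (by fun_prop)
    (ae_of_all _ fun x => (measurePreserving_add_right volume (x ^ 2)).map_eq)

lemma parabolaShear_preimage : parabolaShear ⁻¹' parabolaEpigraph = Set.univ ×ˢ Set.Ici 0 := by
  ext p
  simp [parabolaShear, parabolaEpigraph]

lemma restrict_univ_prod_Ici : (volume : Measure (ℝ × ℝ)).restrict (Set.univ ×ˢ Set.Ici 0) =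
    volume.prod (volume.restrict (Set.Ioi 0)) := by
  rw [Measure.volume_eq_prod, ← Measure.prod_restrict, Measure.restrict_univ,
    restrict_Ioi_eq_restrict_Ici]

lemma integrableOn_parabolaEpigraph_iff {w : ℝ × ℝ → ℂ} :
    IntegrableOn w parabolaEpigraph ↔ Integrable (fun p : ℝ × ℝ => w (p.1, p.2 + p.1 ^ 2))
      (volume.prod (volume.restrict (Set.Ioi 0))) := by
  rw [← restrict_univ_prod_Ici, ← parabolaShear_preimage]
  exact (measurePreserving_parabolaShear.integrableOn_comp_preimage
    parabolaShear.measurableEmbedding).symm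

lemma setIntegral_parabolaEpigraph (w : ℝ × ℝ → ℂ) :
    ∫ p in parabolaEpigraph, w p = ∫ p : ℝ × ℝ, w (p.1, p.2 + p.1 ^ 2)
      ∂(volume.prod (volume.restrict (Set.Ioi 0))) := by
  rw [← restrict_univ_prod_Ici, ← parabolaShear_preimage]
  exact (measurePreserving_parabolaShear.setIntegral_preimage_emb
    parabolaShear.measurableEmbedding w parabolaEpigraph).symm

lemma memLp_dechirp {u : ℝ → ℂ} (hu : MemLp u 2) : MemLp (fun y => star chirp y * u y) 2 :=
  memLp_boundedContinuous_mul _ hu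

lemma stronglyMeasurable_dechirp {u : ℝ → ℂ} (hu : StronglyMeasurable u) :
    StronglyMeasurable fun y => star chirp y * u y :=
  (star chirp).continuous.stronglyMeasurable.mul hu

/-- The multiplier `τ ↦ G(2^{4/3} π^{2/3} τ)`. -/
def airyMultiplier : ℝ →ᵇ ℂ :=
  BoundedContinuousFunction.ofNormedAddCommGroup (fun τ => (airyG (airyScale * τ) : ℂ))
    (Complex.continuous_ofReal.comp (continuous_airyG.comp (by fun_prop)))
    (Classical.choose exists_abs_airyG_le) fun τ => by
      rw [Complex.norm_real]
      exact (Classical.choose_spec exists_abs_airyG_le).2 _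

lemma airyMultiplier_apply (τ : ℝ) : airyMultiplier τ = (airyG (airyScale * τ) : ℂ) := rfl

/-- The integral of the Wigner distribution over the epigraph, when it converges absolutely. -/
lemma setIntegral_wigner_parabolaEpigraph {u v : ℝ → ℂ} (hu : StronglyMeasurable u)
    (hv : StronglyMeasurable v) (hu2 : MemLp u 2) (hv2 : MemLp v 2)
    (hW : IntegrableOn (wigner u v) parabolaEpigraph) :
    ∫ p in parabolaEpigraph, wigner u v p =
      ∫ τ, airyMultiplier τ * ((𝓕 ((memLp_dechirp hu2).toLp _) : L2R) τ *
        (starRingEnd ℂ) ((𝓕 ((memLp_dechirp hv2).toLp _) : L2R) τ)) := by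
  rw [setIntegral_parabolaEpigraph]
  rw [integrableOn_parabolaEpigraph_iff] at hW
  set ν : Measure (ℝ × ℝ) := volume.prod (volume.restrict (Set.Ioi 0)) with hν
  set g : ℝ → ℂ := fun y => star chirp y * u y with hg
  set h : ℝ → ℂ := fun y => star chirp y * v y with hh
  have hpos : ∀ᵐ p : ℝ × ℝ ∂ν, 0 < p.2 := by
    have h1 : ν = (volume : Measure (ℝ × ℝ)).restrict (Set.univ ×ˢ Set.Ioi 0) := by
      rw [Measure.volume_eq_prod, ← Measure.prod_restrict, Measure.restrict_univ]
    rw [h1]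
    filter_upwards [ae_restrict_mem (MeasurableSet.univ.prod measurableSet_Ioi)] with p hp
    exact hp.2
  -- Any positive `a n → 0` and `b n → ∞` would do: the cutoff then tends to `1` on `η > 0` and
  -- stays bounded by `1`.
  let a : ℕ → ℝ := fun n => 1 / ((n : ℝ) + 1)
  let b : ℕ → ℝ := fun n => (n : ℝ) + 1
  have ha : ∀ n, 0 < a n := fun n => by positivity
  have hb : ∀ n, 0 < b n := fun n => by positivity
  have ha0 : Tendsto a atTop (𝓝 0) := tendsto_one_div_add_atTop_nhds_zero_nat
  have hb0 : Tendsto b atTop atTop :=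
    tendsto_atTop_add_const_right _ _ tendsto_natCast_atTop_atTop
  have hmul : ∀ n, Integrable (fun p : ℝ × ℝ =>
      expCutoff (a n) (b n) p.2 * wigner u v (p.1, p.2 + p.1 ^ 2)) ν := fun n =>
    hW.bdd_mul ((measurable_expCutoff (a n) (b n)).comp measurable_snd).aestronglyMeasurable
      (ae_of_all _ fun p => norm_expCutoff_le (ha n) (hb n) p.2)
  have lim1 : Tendsto (fun n => ∫ p : ℝ × ℝ,
      expCutoff (a n) (b n) p.2 * wigner u v (p.1, p.2 + p.1 ^ 2) ∂ν) atTop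
      (𝓝 (∫ p : ℝ × ℝ, wigner u v (p.1, p.2 + p.1 ^ 2) ∂ν)) := by
    refine tendsto_integral_of_dominated_convergence _ (fun n => (hmul n).aestronglyMeasurable)
      hW.norm (fun n => ae_of_all _ fun p => ?_) ?_
    · rw [norm_mul]
      exact mul_le_of_le_one_left (norm_nonneg _) (norm_expCutoff_le (ha n) (hb n) p.2)
    · filter_upwards [hpos] with p hp
      simpa using (tendsto_expCutoff ha0 hb0 hp).mul_const (wigner u v (p.1, p.2 + p.1 ^ 2))
  have hinner : ∀ n x, ∫ η in Set.Ioi 0, expCutoff (a n) (b n) η * wigner u v (x, η + x ^ 2) =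
      ∫ η, expCutoff (a n) (b n) η * 𝓕 (fun z => cubicPhase z * wignerKernel g h x z) η := by
    intro n x
    rw [← integral_indicator measurableSet_Ioi]
    congr 1 with η
    rcases le_or_gt η 0 with hη | hη
    · rw [Set.indicator_of_notMem (by simpa using hη), expCutoff_of_nonpos _ _ hη, zero_mul]
    · rw [Set.indicator_of_mem (Set.mem_Ioi.2 hη), wigner_shear]
  have hval : ∀ n, ∫ p : ℝ × ℝ,
      expCutoff (a n) (b n) p.2 * wigner u v (p.1, p.2 + p.1 ^ 2) ∂ν =
      ∫ τ, ((expAvgG (b n / airyScale) (airyScale * τ) -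
          expAvgG (a n / airyScale) (airyScale * τ) : ℝ) : ℂ) *
        ((𝓕 ((memLp_dechirp hu2).toLp _) : L2R) τ *
          (starRingEnd ℂ) ((𝓕 ((memLp_dechirp hv2).toLp _) : L2R) τ)) := by
    intro n
    have hJ := (hmul n).integral_prod_left
    simp only [hinner] at hJ
    rw [integral_prod _ (hmul n)]
    simp only [hinner]
    rw [integral_integral_cutoff_mul (stronglyMeasurable_dechirp hu)
      (stronglyMeasurable_dechirp hv) (memLp_dechirp hu2) (memLp_dechirp hv2)
      (integrable_expCutoff (ha n) (hb n)) (integrable_fourier_expCutoff (ha n) (hb n)) hJ]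
    simp only [charBCF_apply,
      integral_cubicPhase_mul_fourier_expCutoff (ha n) (hb n)]
  simp only [hval] at lim1
  refine tendsto_nhds_unique lim1 ?_
  -- On the frequency side each average is bounded by `sup |G|`, so dominated convergence applies
  -- with the bound `K + K`.
  obtain ⟨K, hK, hKb⟩ := exists_abs_airyG_le
  have hp := integrable_mul_conj (Lp.memLp (𝓕 ((memLp_dechirp hu2).toLp _) : L2R))
    (Lp.memLp (𝓕 ((memLp_dechirp hv2).toLp _) : L2R))
  have hc := airyScale_pos
  have hlim : ∀ τ, Tendsto (fun n => ((expAvgG (b n / airyScale) (airyScale * τ) -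
      expAvgG (a n / airyScale) (airyScale * τ) : ℝ) : ℂ)) atTop (𝓝 (airyMultiplier τ)) := by
    intro τ
    have h1 := tendsto_expAvgG_atTop (fun n => div_pos (hb n) hc)
      (hb0.atTop_div_const hc) (airyScale * τ)
    have h2 := tendsto_expAvgG_zero (fun n => div_pos (ha n) hc)
      (by simpa using ha0.div_const airyScale) (airyScale * τ)
    have h3 := h1.sub h2
    rw [sub_zero] at h3
    exact (Complex.continuous_ofReal.tendsto _).comp h3
  refine tendsto_integral_of_dominated_convergence
    (fun τ => (K + K) * ‖(𝓕 ((memLp_dechirp hu2).toLp _) : L2R) τ *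
      (starRingEnd ℂ) ((𝓕 ((memLp_dechirp hv2).toLp _) : L2R) τ)‖) (fun n => ?_)
    (hp.norm.const_mul _) (fun n => ae_of_all _ fun τ => ?_)
    (ae_of_all _ fun τ => (hlim τ).mul_const _)
  · have hm : ∀ lam : ℝ, Measurable fun τ => expAvgG lam (airyScale * τ) := by
      intro lam
      have h1 : StronglyMeasurable (Function.uncurry fun τ y =>
          airyG (airyScale * τ - y) * (lam * Real.exp (-lam * y))) :=
        ((continuous_airyG.comp (by fun_prop)).mul (by fun_prop)).stronglyMeasurable
      exact (h1.integral_prod_right (ν := volume.restrict (Set.Ioi 0))).measurable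
    exact (Complex.measurable_ofReal.comp ((hm _).sub (hm _))).aestronglyMeasurable.mul
      hp.aestronglyMeasurable
  · rw [norm_mul, Complex.norm_real]
    refine mul_le_mul_of_nonneg_right ((norm_sub_le _ _).trans (add_le_add ?_ ?_)) (norm_nonneg _)
    · exact abs_expAvgG_le (div_pos (hb n) hc) hKb _
    · exact abs_expAvgG_le (div_pos (ha n) hc) hKb _

end

noncomputable section

open BoundedContinuousFunction

/-! ### Integrability of the Wigner distribution of Schwartz functions -/

lemma SchwartzMap.exists_norm_le_inv_one_add_sq_sq (p : 𝓢(ℝ, ℂ)) :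
    ∃ C, 0 ≤ C ∧ ∀ y, ‖p y‖ ≤ C / (1 + y ^ 2) ^ 2 := by
  have h := fun y => SchwartzMap.one_add_le_sup_seminorm_apply (𝕜 := ℝ) (m := (4, 0))
    (k := 4) (n := 0) le_rfl le_rfl p y
  simp only [norm_iteratedFDeriv_zero] at h
  refine ⟨_, ?_, fun y => (le_div_iff₀ (by positivity)).2 (le_trans ?_ (h y))⟩
  · exact le_trans (by positivity) (h 0)
  · rw [mul_comm]
    refine mul_le_mul_of_nonneg_right ?_ (norm_nonneg _)
    have h1 : 1 + y ^ 2 ≤ (1 + ‖y‖) ^ 2 := by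
      rw [Real.norm_eq_abs, ← sq_abs y]; nlinarith [abs_nonneg y]
    calc (1 + y ^ 2) ^ 2 ≤ ((1 + ‖y‖) ^ 2) ^ 2 := by gcongr
      _ = _ := by ring

/-- Since `(x+z/2)² + (x-z/2)² = 2x² + z²/2`, decay of each factor gives joint decay in `x` and `z`.
Squares of `1 + y²` are needed to separate the two variables. -/
lemma exists_norm_wignerKernel_le (p q : 𝓢(ℝ, ℂ)) :
    ∃ C, 0 ≤ C ∧ ∀ x z, ‖wignerKernel p q x z‖ ≤ C * (1 + x ^ 2)⁻¹ * (1 + z ^ 2)⁻¹ := by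
  obtain ⟨C, hC, hp⟩ := p.exists_norm_le_inv_one_add_sq_sq
  obtain ⟨D, hD, hq⟩ := q.exists_norm_le_inv_one_add_sq_sq
  refine ⟨2 * (C * D), by positivity, fun x z => ?_⟩
  rw [wignerKernel, norm_mul, RCLike.norm_conj]
  refine (mul_le_mul (hp _) (hq _) (norm_nonneg _) (by positivity)).trans ?_
  rw [div_mul_div_comm, ← div_eq_mul_inv, ← div_eq_mul_inv, div_div,
    div_le_div_iff₀ (by positivity) (by positivity)]
  have h1 : 1 + 2 * x ^ 2 + z ^ 2 / 2 ≤ (1 + (x + z / 2) ^ 2) * (1 + (x - z / 2) ^ 2) := by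
    nlinarith [mul_nonneg (sq_nonneg (x + z / 2)) (sq_nonneg (x - z / 2))]
  have h2 : (1 + x ^ 2) * (1 + z ^ 2) ≤ 2 * (1 + 2 * x ^ 2 + z ^ 2 / 2) ^ 2 := by
    nlinarith [mul_nonneg (sq_nonneg x) (sq_nonneg z), sq_nonneg (x ^ 2), sq_nonneg (z ^ 2),
      sq_nonneg x, sq_nonneg z]
  have h3 : (1 + 2 * x ^ 2 + z ^ 2 / 2) ^ 2 ≤
      ((1 + (x + z / 2) ^ 2) * (1 + (x - z / 2) ^ 2)) ^ 2 := by gcongr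
  rw [mul_pow] at h3
  calc C * D * ((1 + x ^ 2) * (1 + z ^ 2))
      ≤ C * D * (2 * ((1 + (x + z / 2) ^ 2) ^ 2 * (1 + (x - z / 2) ^ 2) ^ 2)) := by
        refine mul_le_mul_of_nonneg_left ?_ (by positivity); linarith
    _ = _ := by ring

lemma continuous_wignerKernel (p q : 𝓢(ℝ, ℂ)) :
    Continuous fun r : ℝ × ℝ => wignerKernel p q r.1 r.2 := by
  have hp := p.continuous
  have hq := q.continuous
  unfold wignerKernel
  fun_prop

lemma integrable_wignerKernel_schwartz (p q : 𝓢(ℝ, ℂ)) (x : ℝ) :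
    Integrable (wignerKernel p q x) := by
  obtain ⟨C, hC, h⟩ := exists_norm_wignerKernel_le p q
  exact (integrable_inv_one_add_sq.const_mul (C * (1 + x ^ 2)⁻¹)).mono'
    ((continuous_wignerKernel p q).comp (by fun_prop :
      Continuous fun z : ℝ => (x, z))).aestronglyMeasurable (ae_of_all _ fun z => h x z)

lemma exists_norm_fourier_wignerKernel_le (p q : 𝓢(ℝ, ℂ)) :
    ∃ C, 0 ≤ C ∧ ∀ x ξ, ‖𝓕 (wignerKernel p q x) ξ‖ ≤ C * (1 + x ^ 2)⁻¹ := by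
  obtain ⟨C, hC, h⟩ := exists_norm_wignerKernel_le p q
  refine ⟨C * Real.pi, by positivity, fun x ξ => ?_⟩
  refine (VectorFourier.norm_fourierIntegral_le_integral_norm _ _ _ _ _).trans ?_
  refine (integral_mono (integrable_wignerKernel_schwartz p q x).norm
    (integrable_inv_one_add_sq.const_mul (C * (1 + x ^ 2)⁻¹)) (h x)).trans_eq ?_
  rw [integral_const_mul, integral_univ_inv_one_add_sq]
  ring

lemma hasDerivAt_wignerKernel (p q : 𝓢(ℝ, ℂ)) (x z : ℝ) :
    HasDerivAt (wignerKernel p q x) (1 / 2 * wignerKernel (derivCLM ℂ ℂ p) q x z -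
      1 / 2 * wignerKernel p (derivCLM ℂ ℂ q) x z) z := by
  have hz : HasDerivAt (fun z : ℝ => z / 2) (1 / 2) z := (hasDerivAt_id z).div_const 2
  have h1 : HasDerivAt (fun z => p (x + z / 2)) ((1 / 2 : ℝ) • derivCLM ℂ ℂ p (x + z / 2)) z :=
    (p.differentiable.differentiableAt.hasDerivAt (x := x + z / 2)).scomp z (hz.const_add x)
  have h2 : HasDerivAt (fun z => q (x - z / 2)) ((-(1 / 2) : ℝ) • derivCLM ℂ ℂ q (x - z / 2)) z :=
    (q.differentiable.differentiableAt.hasDerivAt (x := x - z / 2)).scomp z (hz.const_sub x)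
  have h3 : HasDerivAt (fun z => (starRingEnd ℂ) (q (x - z / 2)))
      ((starRingEnd ℂ) ((-(1 / 2) : ℝ) • derivCLM ℂ ℂ q (x - z / 2))) z := h2.star
  refine (h1.mul h3).congr_deriv ?_
  simp only [wignerKernel, Complex.real_smul, map_mul, Complex.conj_ofReal]
  push_cast
  ring

/-- A factor `ξ` becomes a `z`-derivative, which gives kernels of the same type with `p` or `q`
differentiated. Two applications give the decay `ξ⁻²` needed for integrability. -/
lemma fourier_wignerKernel_mul (p q : 𝓢(ℝ, ℂ)) (x ξ : ℝ) :
    (2 * Real.pi * Complex.I * ξ) * 𝓕 (wignerKernel p q x) ξ =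
      1 / 2 * 𝓕 (wignerKernel (derivCLM ℂ ℂ p) q x) ξ -
        1 / 2 * 𝓕 (wignerKernel p (derivCLM ℂ ℂ q) x) ξ := by
  have i1 := integrable_wignerKernel_schwartz (derivCLM ℂ ℂ p) q x
  have i2 := integrable_wignerKernel_schwartz p (derivCLM ℂ ℂ q) x
  have hd : deriv (wignerKernel p q x) = fun z => (1 / 2 : ℂ) •
      wignerKernel (derivCLM ℂ ℂ p) q x z - (1 / 2 : ℂ) • wignerKernel p (derivCLM ℂ ℂ q) x z :=
    funext fun z => (hasDerivAt_wignerKernel p q x z).deriv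
  have h := congrFun (Real.fourier_deriv (integrable_wignerKernel_schwartz p q x)
    (fun z => (hasDerivAt_wignerKernel p q x z).differentiableAt)
    (by rw [hd]; exact (i1.smul (1 / 2 : ℂ)).sub (i2.smul (1 / 2 : ℂ)))) ξ
  rw [smul_eq_mul] at h
  rw [← h, hd]
  simp only [Real.fourier_eq]
  rw [← integral_const_mul, ← integral_const_mul, ← integral_sub]
  · congr 1 with z
    simp only [smul_sub, smul_eq_mul, Circle.smul_def]
    ring
  · exact ((Real.fourierIntegral_convergent_iff ξ).2 i1).const_mul _
  · exact ((Real.fourierIntegral_convergent_iff ξ).2 i2).const_mul _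

lemma exists_mul_norm_fourier_wignerKernel_le (p q : 𝓢(ℝ, ℂ)) :
    ∃ C, 0 ≤ C ∧ ∀ x ξ, |2 * Real.pi * ξ| * ‖𝓕 (wignerKernel p q x) ξ‖ ≤ C * (1 + x ^ 2)⁻¹ := by
  obtain ⟨C, hC, h⟩ := exists_norm_fourier_wignerKernel_le (derivCLM ℂ ℂ p) q
  obtain ⟨D, hD, h'⟩ := exists_norm_fourier_wignerKernel_le p (derivCLM ℂ ℂ q)
  refine ⟨C + D, by positivity, fun x ξ => ?_⟩
  have e := congrArg norm (fourier_wignerKernel_mul p q x ξ)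
  have e1 : ‖(2 * Real.pi * Complex.I * ξ : ℂ)‖ = |2 * Real.pi * ξ| := by
    simp [abs_mul]
  rw [norm_mul, e1] at e
  rw [e]
  refine (norm_sub_le _ _).trans ?_
  rw [norm_mul, norm_mul, show ‖(1 / 2 : ℂ)‖ = 1 / 2 by simp]
  have := h x ξ
  have := h' x ξ
  have := norm_nonneg (𝓕 (wignerKernel (derivCLM ℂ ℂ p) q x) ξ)
  have := norm_nonneg (𝓕 (wignerKernel p (derivCLM ℂ ℂ q) x) ξ)
  rw [add_mul]
  linarith

lemma exists_sq_mul_norm_fourier_wignerKernel_le (p q : 𝓢(ℝ, ℂ)) :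
    ∃ C, 0 ≤ C ∧ ∀ x ξ, (2 * Real.pi * ξ) ^ 2 * ‖𝓕 (wignerKernel p q x) ξ‖ ≤
      C * (1 + x ^ 2)⁻¹ := by
  obtain ⟨C, hC, h⟩ := exists_mul_norm_fourier_wignerKernel_le (derivCLM ℂ ℂ p) q
  obtain ⟨D, hD, h'⟩ := exists_mul_norm_fourier_wignerKernel_le p (derivCLM ℂ ℂ q)
  refine ⟨C + D, by positivity, fun x ξ => ?_⟩
  have e := congrArg norm (fourier_wignerKernel_mul p q x ξ)
  have e1 : ‖(2 * Real.pi * Complex.I * ξ : ℂ)‖ = |2 * Real.pi * ξ| := by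
    simp [abs_mul]
  rw [norm_mul, e1] at e
  rw [← sq_abs, sq, mul_assoc, e]
  have h0 := abs_nonneg (2 * Real.pi * ξ)
  refine (mul_le_mul_of_nonneg_left (norm_sub_le _ _) h0).trans ?_
  rw [norm_mul, norm_mul, show ‖(1 / 2 : ℂ)‖ = 1 / 2 by simp]
  have := h x ξ
  have := h' x ξ
  have := mul_nonneg h0 (norm_nonneg (𝓕 (wignerKernel (derivCLM ℂ ℂ p) q x) ξ))
  have := mul_nonneg h0 (norm_nonneg (𝓕 (wignerKernel p (derivCLM ℂ ℂ q) x) ξ))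
  rw [add_mul]
  linarith

lemma stronglyMeasurable_wigner {u v : ℝ → ℂ} (hu : StronglyMeasurable u)
    (hv : StronglyMeasurable v) : StronglyMeasurable (wigner u v) := by
  have h : StronglyMeasurable (Function.uncurry fun (p : ℝ × ℝ) (z : ℝ) =>
      Complex.exp (-2 * Complex.I * Real.pi * z * p.2) *
        u (p.1 + z / 2) * (starRingEnd ℂ) (v (p.1 - z / 2))) := by
    refine ((Continuous.stronglyMeasurable (by fun_prop)).mul
      (hu.comp_measurable (by fun_prop))).mul ?_
    exact Complex.continuous_conj.comp_stronglyMeasurable (hv.comp_measurable (by fun_prop))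
  exact h.integral_prod_right

lemma integrable_wigner_schwartz (p q : 𝓢(ℝ, ℂ)) : Integrable (wigner p q) := by
  obtain ⟨C, hC, h⟩ := exists_norm_fourier_wignerKernel_le p q
  obtain ⟨D, hD, h'⟩ := exists_sq_mul_norm_fourier_wignerKernel_le p q
  refine ((integrable_inv_one_add_sq.mul_prod integrable_inv_one_add_sq).const_mul (C + D)).mono'
    (stronglyMeasurable_wigner p.continuous.stronglyMeasurable
      q.continuous.stronglyMeasurable).aestronglyMeasurable (ae_of_all _ fun r => ?_)
  obtain ⟨x, ξ⟩ := r
  rw [wigner_eq_fourier, ← mul_assoc, ← div_eq_mul_inv, le_div_iff₀ (by positivity)]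
  have h1 := h x ξ
  have h2 := h' x ξ
  set N := ‖𝓕 (wignerKernel p q x) ξ‖
  have hN : 0 ≤ N := norm_nonneg _
  have h3 : ξ ^ 2 ≤ (2 * Real.pi * ξ) ^ 2 := by
    rw [mul_pow]
    exact le_mul_of_one_le_left (sq_nonneg _) (by nlinarith [Real.pi_gt_three])
  have h4 : ξ ^ 2 * N ≤ (2 * Real.pi * ξ) ^ 2 * N := mul_le_mul_of_nonneg_right h3 hN
  dsimp only
  linarith

end

noncomputable section

open BoundedContinuousFunction

/-! ### The Weyl quantization of the epigraph -/

/-- Multiplication by the chirp, as a unitary operator. -/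
def chirpEquiv : L2R ≃ₗᵢ[ℂ] L2R := mulL2Equiv chirp norm_chirp

/-- The Fourier multiplier with symbol `airyMultiplier`. -/
def airyFourierMultiplier : L2R →L[ℂ] L2R :=
  ((Lp.fourierTransformₗᵢ ℝ ℂ).symm.toContinuousLinearEquiv : L2R →L[ℂ] L2R) ∘L
    mulL2 airyMultiplier ∘L
      ((Lp.fourierTransformₗᵢ ℝ ℂ).toContinuousLinearEquiv : L2R →L[ℂ] L2R)

lemma isFourierMultiplier_airyFourierMultiplier :
    IsFourierMultiplier (fun τ => airyMultiplier τ) airyFourierMultiplier := by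
  intro u
  have h : (𝓕 (airyFourierMultiplier u) : L2R) = mulL2 airyMultiplier (𝓕 u) :=
    (Lp.fourierTransformₗᵢ ℝ ℂ).apply_symm_apply _
  rw [h]
  exact coeFn_mulL2 _ _

/-- The operator `A`: the Fourier multiplier conjugated by the chirp. -/
def epigraphOperator : L2R →L[ℂ] L2R :=
  (chirpEquiv.toContinuousLinearEquiv : L2R →L[ℂ] L2R) ∘L airyFourierMultiplier ∘L
    (chirpEquiv.symm.toContinuousLinearEquiv : L2R →L[ℂ] L2R)

lemma epigraphOperator_apply (u : L2R) :
    epigraphOperator u = chirpEquiv (airyFourierMultiplier (chirpEquiv.symm u)) := rfl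

/-- The unitary operator diagonalizing `epigraphOperator`. -/
def epigraphEquiv : L2R ≃ₗᵢ[ℂ] L2R := chirpEquiv.symm.trans (Lp.fourierTransformₗᵢ ℝ ℂ)

lemma epigraphOperator_eq_conj (u : L2R) :
    epigraphOperator u = epigraphEquiv.symm (mulL2 airyMultiplier (epigraphEquiv u)) := rfl

lemma epigraphEquiv_toLp {u : ℝ → ℂ} (hu : MemLp u 2) :
    epigraphEquiv (hu.toLp u) = (𝓕 ((memLp_dechirp hu).toLp _) : L2R) := by
  change (𝓕 (mulL2 (star chirp) (hu.toLp u)) : L2R) = _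
  congr 1
  ext1
  filter_upwards [coeFn_mulL2 (star chirp) (hu.toLp u), hu.coeFn_toLp,
    (memLp_dechirp hu).coeFn_toLp] with x h1 h2 h3
  rw [h1, h2, h3]

lemma inner_epigraphOperator {u v : ℝ → ℂ} (hu : StronglyMeasurable u)
    (hv : StronglyMeasurable v) (hu2 : MemLp u 2) (hv2 : MemLp v 2)
    (hW : IntegrableOn (wigner u v) parabolaEpigraph) :
    inner ℂ (hv2.toLp v) (epigraphOperator (hu2.toLp u)) =
      ∫ p in parabolaEpigraph, wigner u v p := by
  rw [setIntegral_wigner_parabolaEpigraph hu hv hu2 hv2 hW,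
    inner_conj_mulL2 epigraphOperator_eq_conj, epigraphEquiv_toLp, epigraphEquiv_toLp, L2.inner_def]
  refine integral_congr_ae ?_
  filter_upwards [coeFn_mulL2 airyMultiplier (𝓕 ((memLp_dechirp hu2).toLp _) : L2R)] with τ h1
  rw [h1, RCLike.inner_apply, mul_assoc]

lemma measurableSet_parabolaEpigraph : MeasurableSet parabolaEpigraph :=
  (isClosed_le (by fun_prop) (by fun_prop)).measurableSet

lemma parabolaSymbol_mul (w : ℝ × ℝ → ℂ) :
    (fun p => parabolaSymbol p * w p) = parabolaEpigraph.indicator w := by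
  ext p
  rw [parabolaSymbol, ← Set.indicator_mul_left]
  simp

lemma isWeylQuantization_epigraphOperator : IsWeylQuantization parabolaSymbol epigraphOperator := by
  intro u v
  have hW := (integrable_wigner_schwartz u v).integrableOn (s := parabolaEpigraph)
  rw [parabolaSymbol_mul, integral_indicator measurableSet_parabolaEpigraph,
    integrable_indicator_iff measurableSet_parabolaEpigraph]
  exact ⟨hW, inner_epigraphOperator u.continuous.stronglyMeasurable
    v.continuous.stronglyMeasurable (u.memLp 2) (v.memLp 2) hW⟩

/-- The weak definition fixes the matrix elements on Schwartz functions, which are dense in both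
arguments of the inner product. -/
lemma IsWeylQuantization.unique {a : ℝ × ℝ → ℂ} {A B : L2R →L[ℂ] L2R}
    (hA : IsWeylQuantization a A) (hB : IsWeylQuantization a B) : A = B := by
  have hdense := SchwartzMap.denseRange_toLpCLM (F := ℂ) (E := ℝ) (μ := volume) (p := 2)
    ENNReal.ofNat_ne_top
  refine ContinuousLinearMap.coeFn_injective
    (hdense.equalizer A.continuous B.continuous (funext fun u => ?_))
  refine ext_inner_left ℂ fun v => ?_
  have hc : ∀ w : L2R, Continuous fun v : L2R => inner ℂ v w := fun w => by fun_prop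
  refine congrFun (hdense.equalizer (hc (A (u.toLp 2 volume))) (hc (B (u.toLp 2 volume)))
    (funext fun v => ?_)) v
  exact ((hA u v).2).trans ((hB u v).2).symm

lemma inner_epigraphOperator_self (u : L2R) (hW : IntegrableOn (wigner u u) parabolaEpigraph) :
    inner ℂ u (epigraphOperator u) = ∫ p in parabolaEpigraph, wigner u u p := by
  have h := inner_epigraphOperator (Lp.stronglyMeasurable u) (Lp.stronglyMeasurable u)
    (Lp.memLp u) (Lp.memLp u) hW
  rwa [Lp.toLp_coeFn] at h

lemma ae_airyG_airyScale_mul_ne (μ : ℝ) : ∀ᵐ τ : ℝ, airyG (airyScale * τ) ≠ μ := by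
  have h := (Homeomorph.mulLeft₀ airyScale airyScale_pos.ne').measurableEmbedding
  have hq : Measure.QuasiMeasurePreserving (fun τ : ℝ => airyScale * τ) := by
    refine ⟨by fun_prop, ?_⟩
    rw [Real.map_volume_mul_left airyScale_pos.ne']
    exact Measure.smul_absolutelyContinuous
  exact hq.ae (ae_airyG_ne μ)

lemma range_airyG_airyScale_mul :
    Set.range (fun τ : ℝ => airyG (airyScale * τ)) = Set.range airyG :=
  (mul_left_surjective₀ airyScale_pos.ne').range_comp airyG

end

theorem mainTheorem4 :
    -- the Airy function: entire, real on the real line, and equal on the real line to the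
    -- inverse Fourier transform of `t ↦ e^{i(2πt)³/3}`
    Differentiable ℂ airyAi ∧
    (∀ x : ℝ, (airyAi x).im = 0) ∧
    IsInverseFourierTransformOf (fun x : ℝ => airyAi x)
      (fun t : ℝ => Complex.exp (Complex.I * (2 * Real.pi * t) ^ 3 / 3)) ∧
    -- the function `G` is also `∫_{-∞}^η Ai` (a convergent improper integral) and it is the
    -- restriction to the real line of an entire primitive of `Ai`
    (∀ η : ℝ, Tendsto (fun R : ℝ => ∫ ξ in R..η, (airyAi ξ).re) atBot (𝓝 (airyG η))) ∧
    (∃ F : ℂ → ℂ, (∀ z : ℂ, HasDerivAt F (airyAi z) z) ∧ ∀ η : ℝ, F η = (airyG η : ℂ)) ∧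
    -- the largest zero of the Airy function
    ∃ η₀ : ℝ, IsGreatest {x : ℝ | airyAi x = 0} η₀ ∧
      |η₀ - (-2.338107410)| < 1e-9 ∧
      |airyG η₀ - (-0.2743520591)| < 1e-10 ∧
      Set.range airyG = Set.Ico (airyG η₀) 1 ∧
      -- the Weyl quantization of `H(ξ - x²)`
      ∃ A : L2R →L[ℂ] L2R,
        IsWeylQuantization parabolaSymbol A ∧
        (∀ B : L2R →L[ℂ] L2R, IsWeylQuantization parabolaSymbol B → B = A) ∧
        (∃ (M : L2R →L[ℂ] L2R) (U : L2R ≃ₗᵢ[ℂ] L2R),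
          IsFourierMultiplier
            (fun τ : ℝ =>
              (airyG ((2 : ℝ) ^ (4 / 3 : ℝ) * Real.pi ^ (2 / 3 : ℝ) * τ) : ℂ)) M ∧
          ∀ u : L2R, A u = U (M (U.symm u))) ∧
        IsSelfAdjoint A ∧
        ‖A‖ = 1 ∧
        spectrum ℂ A = Complex.ofReal '' Set.Icc (airyG η₀) 1 ∧
        continuousSpectrum A = Complex.ofReal '' Set.Icc (airyG η₀) 1 ∧
        -- bounds of the quadratic form on all of `L²(ℝ)`
        (∀ u : L2R, airyG η₀ * ‖u‖ ^ 2 ≤ (inner ℂ u (A u)).re ∧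
          (inner ℂ u (A u)).re ≤ ‖u‖ ^ 2) ∧
        -- the quadratic form is the integral of the Wigner distribution over the epigraph
        -- whenever that integral converges absolutely
        (∀ u : L2R, IntegrableOn (wigner u u) parabolaEpigraph →
          inner ℂ u (A u) = (∫ p in parabolaEpigraph, wigner u u p) ∧
          airyG η₀ * ‖u‖ ^ 2 ≤ (∫ p in parabolaEpigraph, wigner u u p).re ∧
          (∫ p in parabolaEpigraph, wigner u u p).re ≤ ‖u‖ ^ 2) := by
  obtain ⟨η₀, hη, hl, hr⟩ := exists_isGreatest_zero
  have hrange := range_airyG hη hl hr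
  have hG := abs_airyG_zero_sub_le hη hl hr
  have hG' := abs_lt.1 hG
  norm_num at hG'
  have hm : ∀ τ, airyMultiplier τ = (airyG (airyScale * τ) : ℂ) := airyMultiplier_apply
  have hmem : ∀ τ, airyG (airyScale * τ) ∈ Set.Ico (airyG η₀) 1 := fun τ =>
    hrange ▸ Set.mem_range_self _
  have hA := epigraphOperator_eq_conj
  have hlt : airyG η₀ < 1 := by linarith [hG'.2]
  obtain ⟨hspec, hcont⟩ := spectrum_conj_mulL2 hA hm hlt.ne
    (range_airyG_airyScale_mul.trans hrange) ae_airyG_airyScale_mul_ne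
  have hform : ∀ u : L2R, airyG η₀ * ‖u‖ ^ 2 ≤ (inner ℂ u (epigraphOperator u)).re ∧
      (inner ℂ u (epigraphOperator u)).re ≤ ‖u‖ ^ 2 := fun u => by
    simpa using re_inner_conj_mulL2_mem hA hm (fun τ => Set.Ico_subset_Icc_self (hmem τ)) u
  refine ⟨differentiable_airyAi, fun x => airyD_zero ▸ airyD_im 0 x, isInverseFourierTransformOf_airyAi,
    tendsto_integral_airyAi_atBot, exists_entire_airyG, η₀, hη, ?_, hG, hrange, epigraphOperator,
    isWeylQuantization_epigraphOperator,
    fun B hB => hB.unique isWeylQuantization_epigraphOperator,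
    ⟨airyFourierMultiplier, chirpEquiv, isFourierMultiplier_airyFourierMultiplier,
      epigraphOperator_apply⟩,
    isSelfAdjoint_conj_mulL2 hA hm, norm_conj_mulL2_eq_one hA (fun τ => ?_) ?_, hspec, hcont, hform,
    fun u hu => ?_⟩
  · rw [abs_lt]
    constructor <;> linarith
  -- The lower end `G(η₀) ≈ -0.274` exceeds `-1`, so the multiplier is bounded by `1` in modulus.
  · rw [hm, Complex.norm_real, Real.norm_eq_abs, abs_le]
    exact ⟨by linarith [(hmem τ).1, hG'.1], (hmem τ).2.le⟩
  -- The value `1` is not attained by `G` but lies in the closed spectrum, and this gives the lower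
  -- bound for the norm.
  · rw [hspec]
    exact ⟨1, ⟨hlt.le, le_rfl⟩, Complex.ofReal_one⟩
  · rw [← inner_epigraphOperator_self u hu]
    exact ⟨rfl, hform u⟩
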